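/- Let $\lambda^{\otimes 2}$ be Lebesgue measure on $[0,1]^2$ and $\mathcal M_{+,1}([0,1]^2)$ the set of Borel probability measures on $[0,1]^2$. Put $h((x_1,y_1),(x_2,y_2))=1$ if $(x_1-x_2)(y_1-y_2)<0$ and $=0$ otherwise. For $\beta\in\mathbb R$ and $n\ge 2$ let $$p_n(\beta)=\frac1n\ln\int_{([0,1]^2)^n}\exp\Big[-\frac{\beta}{n-1}\sum_{1\le i<j\le n}h\big((x_i,y_i),(x_j,y_j)\big)\Big]\prod_{i=1}^n d\lambda^{\otimes 2}(x_i,y_i),\qquad p(\beta)=\lim_{n\to\infty}p_n(\beta),$$ where the limit exists for every $\beta\in\mathbb R$. For $\nu\in\mathcal M_{+,1}([0,1]^2)$ let $S(\nu|\lambda^{\otimes 2})=-\int\ln\frac{d\nu}{d\lambda^{\otimes 2}}\,d\nu$ if $\nu\ll\lambda^{\otimes 2}$, and $=-\infty$ otherwise, let $\mathcal E(\nu)=\frac12\iint h(z,w)\,d\nu(z)\,d\nu(w)$, and let $$\mathcal I_\beta(\nu)=-\big(S(\nu|\lambda^{\otimes 2})-\beta\,\mathcal E(\nu)-p(\beta)\big)\in(-\infty,\infty].$$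 For $\theta\in(0,1)$ let $L_1(\theta)=[0,\theta]$ and $L_2(\theta)=(\theta,1]$, and for $(\theta_1,\theta_2)\in(0,1)^2$ let $\Lambda_{ij}=L_i(\theta_1)\times L_j(\theta_2)$ and $|\Lambda_{ij}|=\lambda^{\otimes2}(\Lambda_{ij})$. **Theorem.** For each $\beta\in\mathbb R$, each $(\theta_1,\theta_2)\in(0,1)^2$ and all $t_{11},t_{12},t_{21},t_{22}\in[0,1]$ with $t_{11}+t_{12}+t_{21}+t_{22}=1$, $$\min\big\{\mathcal I_\beta(\nu):\nu\in\mathcal M_{+,1}([0,1]^2),\ \nu(\Lambda_{ij})=t_{ij}\text{ for all }i,j\in\{1,2\}\big\}=\widetilde\Phi_\beta(\theta_1,\theta_2;t_{11},t_{12},t_{21},t_{22})$$ (in particular the minimum is attained), where, with the convention $0\ln 0=0$, $$\begin{aligned}\widetilde\Phi_\beta(\theta_1,\theta_2;t_{11},t_{12},t_{21},t_{22})={}&p(\beta)+\sum_{i,j=1}^2t_{ij}\ln\frac{t_{ij}}{|\Lambda_{ij}|}+\sum_{i,j=1}^2t_{ij}\,p(\beta t_{ij})\\&-(t_{11}+t_{12})\,p(\beta(t_{11}+t_{12}))-(t_{11}+t_{21})\,p(\beta(t_{11}+t_{21}))\\&-(t_{12}+t_{22})\,p(\beta(t_{12}+t_{22}))-(t_{21}+t_{22})\,p(\beta(t_{21}+t_{22}))+\beta\,t_{12}t_{21}.\end{aligned}$$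 -/

import Mathlib

open MeasureTheory Filter Topology

namespace FourSquare

noncomputable section

/-- The closed unit square `[0,1]²`. Its `volume` is Lebesgue measure, a probability measure. -/
abbrev Square : Type := unitInterval × unitInterval

/-- The pair interaction: `1` if `(x₁ - x₂)(y₁ - y₂) < 0`, and `0` otherwise. -/
def h (z w : Square) : ℝ :=
  Set.indicator (Set.Iio (0 : ℝ)) (fun _ => (1 : ℝ))
    (((z.1 : ℝ) - (w.1 : ℝ)) * ((z.2 : ℝ) - (w.2 : ℝ)))

/-- The mean-field Hamiltonian of `n` particles in the unit square (meaningful for `n ≥ 2`). -/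
def hamiltonian (n : ℕ) (z : Fin n → Square) : ℝ :=
  (1 / ((n : ℝ) - 1)) * ∑ i : Fin n, ∑ j ∈ Finset.Ioi i, h (z i) (z j)

/-- The normalization constant `Z_n(β)`; `volume` is the `n`-fold product of Lebesgue measure on
the unit square. -/
def partitionFunction (n : ℕ) (β : ℝ) : ℝ :=
  ∫ z : Fin n → Square, Real.exp (-β * hamiltonian n z)

/-- The finite-volume pressure `p_n(β) = (1/n) ln Z_n(β)`. -/
def finitePressure (n : ℕ) (β : ℝ) : ℝ :=
  (1 / (n : ℝ)) * Real.log (partitionFunction n β)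

/-- The pressure `p(β) = lim_n p_n(β)`. -/
def pressure (β : ℝ) : ℝ :=
  limUnder atTop (fun n : ℕ => finitePressure n β)

/-- The relative entropy `S(μ | ν)` of probability measures, i.e. minus the Kullback-Leibler
divergence: `-∫ ln (dμ/dν) dμ` if `μ ≪ ν` (which is `-∞` if the logarithm is not `μ`-integrable),
and `-∞` otherwise. -/
def relEntropy {X : Type*} [MeasurableSpace X] (μ ν : Measure X) : EReal :=
  -((InformationTheory.klDiv μ ν : ENNReal) : EReal)

/-- The energy `ℰ(ν)` of the product state `ν ⊗ ν`. -/
def energy (ν : ProbabilityMeasure Square) : ℝ :=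
  (1 / 2) * ∫ z, ∫ w, h z w ∂(ν : Measure Square) ∂(ν : Measure Square)

/-- The large deviation rate function
`𝓘_β(ν) = -(S(ν | λ⊗λ) - β ℰ(ν) - p(β))`, with values in `(-∞, ∞]`. -/
def rateFunction (β : ℝ) (ν : ProbabilityMeasure Square) : EReal :=
  -(relEntropy (ν : Measure Square) (volume : Measure Square)
      - ((β * energy ν : ℝ) : EReal) - ((pressure β : ℝ) : EReal))

/-- The intervals `L₁(θ) = [0,θ]` (index `0`) and `L₂(θ) = (θ,1]` (index `1`). -/
def interval (θ : ℝ) : Fin 2 → Set unitInterval :=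
  ![{x | (x : ℝ) ≤ θ}, {x | θ < (x : ℝ)}]

/-- The rectangles `Λ_ij(θ₁,θ₂) = L_i(θ₁) × L_j(θ₂)`. -/
def rect (θ₁ θ₂ : ℝ) (i j : Fin 2) : Set Square :=
  interval θ₁ i ×ˢ interval θ₂ j

/-- The simplex `Σ₄` of weights `(t_ij)`; the indices `1, 2` are written `0, 1`. -/
def simplex : Set (Fin 2 → Fin 2 → ℝ) :=
  {t | (∀ i j, t i j ∈ Set.Icc (0 : ℝ) 1) ∧ ∑ i, ∑ j, t i j = 1}

/-- The set `W_{θ₁,θ₂}(t)` of probability measures that give mass `t_ij` to `Λ_ij(θ₁,θ₂)`. -/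
def measuresWithMass (θ₁ θ₂ : ℝ) (t : Fin 2 → Fin 2 → ℝ) : Set (ProbabilityMeasure Square) :=
  {ν | ∀ i j, (ν : Measure Square).real (rect θ₁ θ₂ i j) = t i j}

/-- The explicit expression for the minimum; the indices `1, 2` are written `0, 1`, and
`0 * ln 0 = 0` as usual. -/
def PhiTilde (β θ₁ θ₂ : ℝ) (t : Fin 2 → Fin 2 → ℝ) : ℝ :=
  pressure β
    + ∑ i, ∑ j, t i j * Real.log (t i j / (volume : Measure Square).real (rect θ₁ θ₂ i j))
    + ∑ i, ∑ j, t i j * pressure (β * t i j)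
    - (t 0 0 + t 0 1) * pressure (β * (t 0 0 + t 0 1))
    - (t 0 0 + t 1 0) * pressure (β * (t 0 0 + t 1 0))
    - (t 0 1 + t 1 1) * pressure (β * (t 0 1 + t 1 1))
    - (t 1 0 + t 1 1) * pressure (β * (t 1 0 + t 1 1))
    + β * t 0 1 * t 1 0

end

end FourSquare

/-!
# The four square problem for the Mallows model

The pressure is explicit. The inversions of a configuration with distinct coordinates are those of a
permutation, and averaging over the permutations of the second coordinates turns the partition
function into the generating function of inversions, a `q`-factorial with `q = e^{-β/(n-1)}`
(`integral_exp_invCount`). This gives `p(β) = ∫₀¹ ln((1 - e^{-βx}) / (βx)) dx`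
(`tendsto_finitePressure`), and it holds for every product of two atomless probability measures in
place of Lebesgue measure. Jensen's inequality for `n`-fold products therefore yields Gibbs'
variational inequality relative to every such product (`neg_pressurePrimitive_le`); with
`F(t) = t p(βt)` it bounds entropy plus energy of a measure of mass `t` from below by `-F(t)`.
Equality holds for the Frank copula, transported to the given marginals by their distribution
functions (`exists_optimal_copula`, `exists_optimal_density`).

A measure `ν` with masses `t_ij` is the sum of its restrictions to the four rectangles. The
energy splits accordingly (`crossInv_four`): the antidiagonal pair contributes the constant
`β t₁₂ t₂₁`, the diagonal pair nothing, and two rectangles in the same vertical strip contribute the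
number of inversions of the first coordinates of their points, a functional of the one-dimensional
projections alone (similarly for horizontal strips). On such a strip, with projection `m`, there is
a logistic profile of proportions `r`, `1 - r`, depending only on `m` and the two masses, such that
`∫ ln r dκ₀ + ∫ ln (1 - r) dκ₁` plus the interaction has the same value for every splitting
`m = κ₀ + κ₁` with these masses (`exists_split_profile`). Compare each restriction with the product
of the marginal densities of `ν` weighted by these profiles: Gibbs' inequality bounds the block
terms by `-F(t_ij) - t_ij ln t_ij`, the profiles contribute exactly the strip terms, and the
remaining entropy of the marginals is smallest when they are uniform on the intervals
(`mul_log_le_setIntegral`). The sum of these bounds is `PhiTilde` (`sum_blocks`, `PhiTilde_le`).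

All three inequalities are equalities for the measure whose marginals are uniform on the intervals,
split by the logistic profiles and coupled on each rectangle by the optimal density
(`exists_minimizer`).
-/

namespace FourSquare

noncomputable section

/-! ### The limiting pressure and its primitive -/

/-- The mean `∫₀¹ e^{-yv} dv`, which is `(1 - e^{-y}) / y` for `y ≠ 0` and `1` for `y = 0`. -/
def expMean (y : ℝ) : ℝ := ∫ v in (0 : ℝ)..1, Real.exp (-(y * v))

lemma expMean_intervalIntegrable (y a b : ℝ) :
    IntervalIntegrable (fun v => Real.exp (-(y * v))) volume a b :=
  Continuous.intervalIntegrable (by fun_prop) _ _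

lemma expMean_pos (y : ℝ) : 0 < expMean y :=
  intervalIntegral.intervalIntegral_pos_of_pos (expMean_intervalIntegrable y 0 1)
    (fun _ => Real.exp_pos _) one_pos

@[simp] lemma expMean_zero : expMean 0 = 1 := by simp [expMean]

lemma expMean_eq {y : ℝ} (hy : y ≠ 0) : expMean y = (1 - Real.exp (-y)) / y := by
  have hd : ∀ v ∈ Set.uIcc (0 : ℝ) 1,
      HasDerivAt (fun v => -Real.exp (-(y * v)) / y) (Real.exp (-(y * v))) v := by
    intro v _
    have h1 : HasDerivAt (fun v : ℝ => -(y * v)) (-y) v := by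
      simpa using ((hasDerivAt_id v).const_mul y).fun_neg
    have := (h1.exp.neg).div_const y
    refine this.congr_deriv ?_
    field_simp
  rw [expMean, intervalIntegral.integral_eq_sub_of_hasDerivAt hd (expMean_intervalIntegrable y 0 1)]
  simp
  ring

lemma mul_expMean {b : ℝ} (hb : b ≠ 0) (x : ℝ) :
    x * expMean (b * x) = (1 - Real.exp (-(b * x))) / b := by
  by_cases hx : x = 0
  · simp [hx]
  · rw [expMean_eq (mul_ne_zero hb hx)]
    field_simp

lemma expMean_add_le (y d : ℝ) : expMean (y + d) ≤ Real.exp |d| * expMean y := by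
  rw [expMean, expMean, ← intervalIntegral.integral_const_mul]
  refine intervalIntegral.integral_mono_on zero_le_one (expMean_intervalIntegrable _ 0 1)
    ((expMean_intervalIntegrable y 0 1).const_mul _) fun v hv => ?_
  rw [← Real.exp_add]
  apply Real.exp_le_exp.mpr
  have h1 : -(d * v) ≤ |d| := by
    calc -(d * v) ≤ |d * v| := neg_le_abs _
      _ = |d| * v := by rw [abs_mul, abs_of_nonneg hv.1]
      _ ≤ |d| * 1 := mul_le_mul_of_nonneg_left hv.2 (abs_nonneg _)
      _ = |d| := mul_one _
  linarith

lemma abs_log_expMean_sub_le (x y : ℝ) :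
    |Real.log (expMean x) - Real.log (expMean y)| ≤ |x - y| := by
  have key : ∀ x y : ℝ, Real.log (expMean x) - Real.log (expMean y) ≤ |x - y| := by
    intro x y
    have h1 := expMean_add_le y (x - y)
    rw [add_sub_cancel] at h1
    have h2 := Real.log_le_log (expMean_pos x) h1
    rw [Real.log_mul (Real.exp_ne_zero _) (expMean_pos y).ne', Real.log_exp] at h2
    linarith
  rw [abs_le]
  constructor
  · have := key y x
    rw [abs_sub_comm] at this
    linarith
  · exact key x y

lemma continuous_log_expMean : Continuous (fun y => Real.log (expMean y)) := by
  have : LipschitzWith 1 (fun y => Real.log (expMean y)) :=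
    LipschitzWith.of_dist_le_mul fun x y => by
      simpa [Real.dist_eq] using abs_log_expMean_sub_le x y
  exact this.continuous

lemma continuous_expMean : Continuous expMean := by
  have h1 : expMean = fun y => Real.exp (Real.log (expMean y)) := by
    funext y; rw [Real.exp_log (expMean_pos y)]
  rw [h1]
  exact Real.continuous_exp.comp continuous_log_expMean

/-- The closed form `∫₀¹ ln((1 - e^{-bx}) / (bx)) dx` of the pressure. -/
def limitPressure (b : ℝ) : ℝ := ∫ x in (0 : ℝ)..1, Real.log (expMean (b * x))

/-- The primitive `F_b(t) = ∫₀ᵗ ln((1 - e^{-bu}) / (bu)) du`, equal to `t p(bt)`. -/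
def pressurePrimitive (b t : ℝ) : ℝ := ∫ u in (0 : ℝ)..t, Real.log (expMean (b * u))

lemma pressurePrimitive_eq (b t : ℝ) : pressurePrimitive b t = t * limitPressure (b * t) := by
  have h1 := intervalIntegral.smul_integral_comp_mul_left (a := 0) (b := 1)
    (fun u => Real.log (expMean (b * u))) t
  simp only [mul_zero, mul_one, smul_eq_mul] at h1
  rw [pressurePrimitive, ← h1, limitPressure]
  simp only [mul_assoc]

lemma hasDerivAt_pressurePrimitive (b t : ℝ) :
    HasDerivAt (pressurePrimitive b) (Real.log (expMean (b * t))) t := by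
  have hc : Continuous fun u => Real.log (expMean (b * u)) :=
    continuous_log_expMean.comp (by fun_prop)
  exact intervalIntegral.integral_hasDerivAt_right (hc.intervalIntegrable _ _)
    hc.stronglyMeasurable.stronglyMeasurableAtFilter hc.continuousAt

@[simp] lemma pressurePrimitive_zero (b : ℝ) : pressurePrimitive b 0 = 0 := by
  simp [pressurePrimitive]

/-- Right-endpoint Riemann sums of the integral defining `limitPressure`. -/
lemma tendsto_riemann_log_expMean (b : ℝ) :
    Tendsto (fun m : ℕ => (∑ k ∈ Finset.range m, Real.log (expMean (b * ((k + 1 : ℕ) / (m : ℝ)))))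
      / m) atTop (𝓝 (limitPressure b)) := by
  have hc : Continuous fun u => Real.log (expMean (b * u)) :=
    continuous_log_expMean.comp (by fun_prop)
  have key : ∀ m : ℕ, 0 < m →
      |(∑ k ∈ Finset.range m, Real.log (expMean (b * ((k + 1 : ℕ) / (m : ℝ))))) / m
        - limitPressure b| ≤ |b| / m := by
    intro m hm
    have hm' : (0 : ℝ) < m := by exact_mod_cast hm
    have hsplit : limitPressure b = ∑ k ∈ Finset.range m,
        ∫ x in ((k : ℕ) / (m : ℝ))..((k + 1 : ℕ) / (m : ℝ)), Real.log (expMean (b * x)) := by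
      rw [intervalIntegral.sum_integral_adjacent_intervals (a := fun k : ℕ => (k : ℝ) / m)
        (fun k _ => hc.intervalIntegrable _ _)]
      simp [limitPressure, hm'.ne']
    rw [hsplit, Finset.sum_div, ← Finset.sum_sub_distrib]
    refine (Finset.abs_sum_le_sum_abs _ _).trans ?_
    have hterm : ∀ k ∈ Finset.range m,
        |Real.log (expMean (b * ((k + 1 : ℕ) / (m : ℝ)))) / m -
          ∫ x in ((k : ℕ) / (m : ℝ))..((k + 1 : ℕ) / (m : ℝ)), Real.log (expMean (b * x))|
          ≤ |b| / m / m := by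
      intro k _
      have hlen : ((k + 1 : ℕ) : ℝ) / m - (k : ℝ) / m = 1 / m := by
        push_cast; field_simp; ring
      have h1 : Real.log (expMean (b * ((k + 1 : ℕ) / (m : ℝ)))) / m =
          ∫ _x in ((k : ℕ) / (m : ℝ))..((k + 1 : ℕ) / (m : ℝ)),
            Real.log (expMean (b * ((k + 1 : ℕ) / (m : ℝ)))) := by
        rw [intervalIntegral.integral_const, hlen, smul_eq_mul]
        ring
      rw [h1, ← intervalIntegral.integral_sub (continuous_const.intervalIntegrable _ _)
        (hc.intervalIntegrable _ _)]
      have h2 := intervalIntegral.norm_integral_le_of_norm_le_const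
        (a := (k : ℕ) / (m : ℝ)) (b := (k + 1 : ℕ) / (m : ℝ)) (C := |b| / m)
        (f := fun x => Real.log (expMean (b * ((k + 1 : ℕ) / (m : ℝ)))) -
          Real.log (expMean (b * x))) ?_
      · rw [hlen, abs_of_pos (show (0 : ℝ) < 1 / m by positivity)] at h2
        rw [Real.norm_eq_abs] at h2
        calc _ ≤ _ := h2
          _ = _ := by ring
      · intro x hx
        rw [Set.uIoc_of_le (by gcongr; simp)] at hx
        rw [Real.norm_eq_abs]
        refine (abs_log_expMean_sub_le _ _).trans ?_
        rw [← mul_sub, abs_mul, div_eq_mul_one_div |b|]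
        refine mul_le_mul_of_nonneg_left ?_ (abs_nonneg _)
        rw [abs_of_nonneg (by linarith [hx.2])]
        linarith [hx.1]
    refine (Finset.sum_le_sum hterm).trans ?_
    rw [Finset.sum_const, Finset.card_range, nsmul_eq_mul]
    field_simp
    exact le_refl _
  rw [tendsto_iff_dist_tendsto_zero]
  refine squeeze_zero' (Eventually.of_forall fun _ => dist_nonneg) ?_
    (tendsto_const_div_atTop_nhds_zero_nat |b|)
  filter_upwards [eventually_gt_atTop 0] with m hm
  rw [Real.dist_eq]
  exact key m hm

/-! ### Optimal splitting of a strip -/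

/-- The logistic profile `u ↦ 1 / (1 + e^{bu - c})`. -/
def logistic (b c u : ℝ) : ℝ := 1 / (1 + Real.exp (b * u - c))

lemma logistic_pos (b c u : ℝ) : 0 < logistic b c u := by unfold logistic; positivity

lemma logistic_lt_one (b c u : ℝ) : logistic b c u < 1 := by
  unfold logistic
  rw [div_lt_one (by positivity)]
  linarith [Real.exp_pos (b * u - c)]

lemma continuous_logistic (b c : ℝ) : Continuous (logistic b c) := by
  unfold logistic
  exact continuous_const.div (by fun_prop) fun u => by positivity

lemma log_one_sub_logistic (b c u : ℝ) :
    Real.log (1 - logistic b c u) = -Real.log (1 + Real.exp (c - b * u)) := by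
  have h1 : 1 - logistic b c u = (1 + Real.exp (c - b * u))⁻¹ := by
    unfold logistic
    have : Real.exp (c - b * u) = (Real.exp (b * u - c))⁻¹ := by
      rw [← Real.exp_neg]; ring_nf
    rw [this]
    have := Real.exp_pos (b * u - c)
    field_simp
    ring
  rw [h1, Real.log_inv]

lemma log_logistic (b c u : ℝ) :
    Real.log (logistic b c u) = c - b * u - Real.log (1 + Real.exp (c - b * u)) := by
  have h1 : logistic b c u = Real.exp (c - b * u) / (1 + Real.exp (c - b * u)) := by
    unfold logistic
    have : Real.exp (c - b * u) = (Real.exp (b * u - c))⁻¹ := by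
      rw [← Real.exp_neg]; ring_nf
    rw [this]
    have := Real.exp_pos (b * u - c)
    field_simp
    ring
  rw [h1, Real.log_div (Real.exp_ne_zero _) (by positivity), Real.log_exp]

/-- The mass `∫₀ˢ r(u) du` of the logistic profile `r`. -/
def logisticMass (b c s : ℝ) : ℝ := ∫ u in (0 : ℝ)..s, logistic b c u

lemma hasDerivAt_logisticMass (b c s : ℝ) :
    HasDerivAt (logisticMass b c) (logistic b c s) s :=
  intervalIntegral.integral_hasDerivAt_right ((continuous_logistic b c).intervalIntegrable _ _)
    (continuous_logistic b c).stronglyMeasurable.stronglyMeasurableAtFilter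
    (continuous_logistic b c).continuousAt

lemma logisticMass_pos (b c : ℝ) {s : ℝ} (hs : 0 < s) : 0 < logisticMass b c s :=
  intervalIntegral.intervalIntegral_pos_of_pos
    ((continuous_logistic b c).intervalIntegrable _ _) (fun u => logistic_pos b c u) hs

lemma logisticMass_lt (b c : ℝ) {s : ℝ} (hs : 0 < s) : logisticMass b c s < s := by
  have h1 : 0 < ∫ u in (0 : ℝ)..s, (1 - logistic b c u) :=
    intervalIntegral.intervalIntegral_pos_of_pos
      ((continuous_const.sub (continuous_logistic b c)).intervalIntegrable _ _)
      (fun u => sub_pos.mpr (logistic_lt_one b c u)) hs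
  rw [intervalIntegral.integral_sub (continuous_const.intervalIntegrable _ _)
    ((continuous_logistic b c).intervalIntegrable _ _)] at h1
  simp only [intervalIntegral.integral_const, sub_zero, smul_eq_mul, mul_one] at h1
  exact sub_pos.mp h1

lemma hasDerivAt_log_one_add_exp (b c u : ℝ) :
    HasDerivAt (fun u => Real.log (1 + Real.exp (c - b * u))) (-(b * logistic b c u)) u := by
  have h1 : HasDerivAt (fun u : ℝ => c - b * u) (-b) u := by
    simpa using ((hasDerivAt_id u).const_mul b).const_sub c
  have h2 := (h1.exp.const_add 1).log (by positivity)
  refine h2.congr_deriv ?_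
  unfold logistic
  have : Real.exp (c - b * u) = (Real.exp (b * u - c))⁻¹ := by
    rw [← Real.exp_neg]; ring_nf
  rw [this]
  have := Real.exp_pos (b * u - c)
  field_simp
  ring

lemma mul_logisticMass (b c s : ℝ) :
    b * logisticMass b c s =
      Real.log (1 + Real.exp c) - Real.log (1 + Real.exp (c - b * s)) := by
  have h1 := intervalIntegral.integral_eq_sub_of_hasDerivAt (a := 0) (b := s)
    (fun u _ => hasDerivAt_log_one_add_exp b c u)
    ((continuous_const.mul (continuous_logistic b c)).neg.intervalIntegrable _ _)
  rw [intervalIntegral.integral_neg, intervalIntegral.integral_const_mul] at h1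
  simp only [mul_zero, sub_zero] at h1
  rw [logisticMass]
  linarith

lemma exp_mul_logisticMass (b c s : ℝ) :
    Real.exp (b * logisticMass b c s) = (1 + Real.exp c) / (1 + Real.exp (c - b * s)) := by
  rw [mul_logisticMass, Real.exp_sub, Real.exp_log (by positivity), Real.exp_log (by positivity)]

lemma logisticMass_zero_left (c s : ℝ) :
    logisticMass 0 c s = s * (Real.exp c / (1 + Real.exp c)) := by
  unfold logisticMass logistic
  simp only [zero_mul, zero_sub, intervalIntegral.integral_const, sub_zero, smul_eq_mul]
  rw [Real.exp_neg]
  have := Real.exp_pos c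
  field_simp
  ring

/-- The function `a(x) = x expMean (b x) = ∫₀ˣ e^{-bv} dv` of the logistic mass `T(s)` is explicit:
`a(T(s)) = a(s) e^c / (1 + e^c)`. -/
lemma logisticMass_mul_expMean (b c s : ℝ) :
    logisticMass b c s * expMean (b * logisticMass b c s) =
      Real.exp c / (1 + Real.exp c) * (s * expMean (b * s)) := by
  by_cases hb : b = 0
  · subst hb
    simp only [zero_mul, expMean_zero, logisticMass_zero_left]
    ring
  · rw [mul_expMean hb, mul_expMean hb, Real.exp_neg (b * logisticMass b c s),
      exp_mul_logisticMass, Real.exp_sub, Real.exp_neg (b * s)]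
    have := Real.exp_pos c
    have := Real.exp_pos (b * s)
    field_simp
    ring

/-- The counterpart of `logisticMass_mul_expMean` for the complementary mass:
`a(s - T(s)) = a(s) / (1 + e^{c - bs})`. -/
lemma sub_logisticMass_mul_expMean (b c s : ℝ) :
    (s - logisticMass b c s) * expMean (b * (s - logisticMass b c s)) =
      1 / (1 + Real.exp (c - b * s)) * (s * expMean (b * s)) := by
  by_cases hb : b = 0
  · subst hb
    simp only [zero_mul, expMean_zero, logisticMass_zero_left, sub_zero]
    have := Real.exp_pos c
    field_simp
    ring
  · rw [mul_expMean hb, mul_expMean hb, mul_sub, neg_sub, Real.exp_sub (b * logisticMass b c s),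
      exp_mul_logisticMass, Real.exp_sub, Real.exp_neg (b * s)]
    have := Real.exp_pos c
    have := Real.exp_pos (b * s)
    field_simp
    ring

/-- The minimal cost of splitting a strip of mass `t₁ + t₂` into a part of mass `t₁` and a part of
mass `t₂`: entropy of the splitting plus `b` times the number of cross inversions. -/
def splitCost (b t₁ t₂ : ℝ) : ℝ :=
  pressurePrimitive b t₁ + pressurePrimitive b t₂ - pressurePrimitive b (t₁ + t₂)
    + t₁ * Real.log t₁ + t₂ * Real.log t₂ - (t₁ + t₂) * Real.log (t₁ + t₂)

/-- The value of entropy plus interaction for the logistic profile is `splitCost`: both sides vanish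
at `s = 0` and have the same derivative in `s` for fixed `c`. -/
lemma logistic_value (b c : ℝ) {s : ℝ} (hs : 0 < s) :
    c * logisticMass b c s - (∫ u in (0 : ℝ)..s, Real.log (1 + Real.exp (c - b * u)))
      - b * logisticMass b c s ^ 2 / 2 =
    splitCost b (logisticMass b c s) (s - logisticMass b c s) := by
  set T := logisticMass b c with hT
  have hL : Continuous fun u => Real.log (1 + Real.exp (c - b * u)) :=
    Continuous.log (by fun_prop) fun u => by positivity
  have hLd : ∀ x, HasDerivAt (fun s => ∫ u in (0 : ℝ)..s, Real.log (1 + Real.exp (c - b * u)))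
      (Real.log (1 + Real.exp (c - b * x))) x := fun x =>
    intervalIntegral.integral_hasDerivAt_right (hL.intervalIntegrable _ _)
      hL.stronglyMeasurable.stronglyMeasurableAtFilter hL.continuousAt
  have hTd : ∀ x, HasDerivAt T (logistic b c x) x := hasDerivAt_logisticMass b c
  have hTc : Continuous T := continuous_iff_continuousAt.mpr fun x => (hTd x).continuousAt
  have hFc : Continuous (pressurePrimitive b) :=
    continuous_iff_continuousAt.mpr fun x => (hasDerivAt_pressurePrimitive b x).continuousAt
  have hLc : Continuous (fun s => ∫ u in (0 : ℝ)..s, Real.log (1 + Real.exp (c - b * u))) :=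
    continuous_iff_continuousAt.mpr fun x => (hLd x).continuousAt
  set D : ℝ → ℝ := fun s => (c * T s - (∫ u in (0 : ℝ)..s, Real.log (1 + Real.exp (c - b * u)))
      - b * T s ^ 2 / 2) - (pressurePrimitive b (T s) + pressurePrimitive b (s - T s)
      - pressurePrimitive b s + T s * Real.log (T s) + (s - T s) * Real.log (s - T s)
      - s * Real.log s) with hD
  have hDc : Continuous D := by
    have e1 : Continuous fun s => T s * Real.log (T s) := Real.continuous_mul_log.comp hTc
    have e2 : Continuous fun s => (s - T s) * Real.log (s - T s) :=
      Real.continuous_mul_log.comp (continuous_id.sub hTc)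
    have e3 : Continuous fun s : ℝ => s * Real.log s := Real.continuous_mul_log
    have e4 : Continuous fun s => pressurePrimitive b (T s) := hFc.comp hTc
    have e5 : Continuous fun s => pressurePrimitive b (s - T s) := hFc.comp (continuous_id.sub hTc)
    exact (((continuous_const.mul hTc).sub hLc).sub
      ((continuous_const.mul (hTc.pow 2)).div_const 2)).sub
      (((((e4.add e5).sub hFc).add e1).add e2).sub e3)
  have hDd : ∀ x ∈ Set.Ioo 0 s, HasDerivAt D 0 x := by
    intro x hx
    have hx0 : 0 < x := hx.1
    have p1 : 0 < T x := logisticMass_pos b c hx0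
    have p2 : 0 < x - T x := sub_pos.mpr (logisticMass_lt b c hx0)
    have d2 : HasDerivAt (fun s => s - T s) (1 - logistic b c x) x := (hasDerivAt_id x).sub (hTd x)
    have F1 := (hasDerivAt_pressurePrimitive b (T x)).comp x (hTd x)
    have F2 := (hasDerivAt_pressurePrimitive b (x - T x)).comp x d2
    have F3 := hasDerivAt_pressurePrimitive b x
    have G1 := (Real.hasDerivAt_mul_log p1.ne').comp x (hTd x)
    have G2 := (Real.hasDerivAt_mul_log p2.ne').comp x d2
    have G3 := Real.hasDerivAt_mul_log hx0.ne'
    have H := ((((hTd x).const_mul c).sub (hLd x)).sub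
      ((((hTd x).pow 2).const_mul b).div_const 2)).sub
      (((((F1.add F2).sub F3).add G1).add G2).sub G3)
    refine (H.congr_deriv ?_ : HasDerivAt D 0 x)
    have l1 : Real.log (T x) + Real.log (expMean (b * T x)) =
        c - Real.log (1 + Real.exp c) + (Real.log x + Real.log (expMean (b * x))) := by
      rw [← Real.log_mul p1.ne' (expMean_pos _).ne', hT, logisticMass_mul_expMean,
        Real.log_mul (by positivity) (mul_pos hx0 (expMean_pos _)).ne',
        Real.log_div (Real.exp_ne_zero _) (by positivity), Real.log_exp,
        Real.log_mul hx0.ne' (expMean_pos _).ne']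
    have l2 : Real.log (x - T x) + Real.log (expMean (b * (x - T x))) =
        -Real.log (1 + Real.exp (c - b * x)) + (Real.log x + Real.log (expMean (b * x))) := by
      rw [← Real.log_mul p2.ne' (expMean_pos _).ne', hT, sub_logisticMass_mul_expMean,
        Real.log_mul (by positivity) (mul_pos hx0 (expMean_pos _)).ne',
        Real.log_div one_ne_zero (by positivity), Real.log_one,
        Real.log_mul hx0.ne' (expMean_pos _).ne']
      ring
    have l3 := mul_logisticMass b c x
    rw [← hT] at l3
    simp only [Nat.cast_ofNat, Nat.add_one_sub_one, pow_one]
    have e1 : Real.log (expMean (b * T x)) = c - Real.log (1 + Real.exp c)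
      + (Real.log x + Real.log (expMean (b * x))) - Real.log (T x) := by linarith
    have e2 : Real.log (expMean (b * (x - T x))) = -Real.log (1 + Real.exp (c - b * x))
      + (Real.log x + Real.log (expMean (b * x))) - Real.log (x - T x) := by linarith
    rw [e1, e2]
    have e3 : Real.log (1 + Real.exp c) = b * T x + Real.log (1 + Real.exp (c - b * x)) := by
      linarith
    rw [e3]
    ring
  have hT0 : T 0 = 0 := by simp [hT, logisticMass]
  have hD0 : D 0 = 0 := by simp [hD, hT0]
  obtain ⟨x, hx, hxe⟩ := exists_hasDerivAt_eq_slope D (fun _ => 0) hs hDc.continuousOn hDd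
  rw [hD0, sub_zero, sub_zero, eq_comm, div_eq_zero_iff] at hxe
  have hDs : D s = 0 := hxe.resolve_right hs.ne'
  simp only [hD] at hDs
  rw [splitCost, add_sub_cancel]
  linarith

lemma exists_logisticMass_eq (b : ℝ) {t₁ t₂ : ℝ} (h₁ : 0 < t₁) (h₂ : 0 < t₂) :
    ∃ c, logisticMass b c (t₁ + t₂) = t₁ := by
  by_cases hb : b = 0
  · subst hb
    refine ⟨Real.log (t₁ / t₂), ?_⟩
    rw [logisticMass_zero_left, Real.exp_log (by positivity)]
    field_simp
    ring
  · -- the value of `c` is forced by `mul_logisticMass`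
    have hpos : 0 < (Real.exp (b * t₁) - 1) / (1 - Real.exp (-(b * t₂))) := by
      rcases lt_or_gt_of_ne hb with hb | hb
      · apply div_pos_of_neg_of_neg
        · rw [sub_neg, Real.exp_lt_one_iff]; exact mul_neg_of_neg_of_pos hb h₁
        · rw [sub_neg, Real.one_lt_exp_iff]; linarith [mul_neg_of_neg_of_pos hb h₂]
      · apply div_pos
        · rw [sub_pos, Real.one_lt_exp_iff]; positivity
        · rw [sub_pos, Real.exp_lt_one_iff]; linarith [mul_pos hb h₂]
    refine ⟨Real.log ((Real.exp (b * t₁) - 1) / (1 - Real.exp (-(b * t₂)))), ?_⟩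
    set c := Real.log ((Real.exp (b * t₁) - 1) / (1 - Real.exp (-(b * t₂)))) with hc
    have hec : Real.exp c = (Real.exp (b * t₁) - 1) / (1 - Real.exp (-(b * t₂))) :=
      Real.exp_log hpos
    have hne : 1 - Real.exp (-(b * t₂)) ≠ 0 := by
      intro h0; rw [h0, div_zero] at hpos; exact lt_irrefl _ hpos
    have h3 : Real.exp (b * logisticMass b c (t₁ + t₂)) = Real.exp (b * t₁) := by
      rw [exp_mul_logisticMass, div_eq_iff (by positivity)]
      have e1 : Real.exp (c - b * (t₁ + t₂)) =
          Real.exp c * (Real.exp (-(b * t₂)) / Real.exp (b * t₁)) := by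
        rw [← Real.exp_sub, ← Real.exp_add]; ring_nf
      rw [e1, hec]
      have := Real.exp_pos (b * t₁)
      field_simp
      ring
    exact mul_left_cancel₀ hb (Real.exp_injective h3)

/-! ### Inversions of permutations -/

/-- The number of inversions of a permutation, as a real number. -/
def permInv {n : ℕ} (σ : Equiv.Perm (Fin n)) : ℝ :=
  ∑ i : Fin n, ∑ j ∈ Finset.Ioi i, if σ j < σ i then 1 else 0

/-- The permutation of `Fin (n + 1)` that sends `0` to `p` and whose restriction to the other points
has the relative order of `e`. -/
def insertPerm {n : ℕ} (p : Fin (n + 1)) (e : Equiv.Perm (Fin n)) : Equiv.Perm (Fin (n + 1)) :=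
  (finSuccEquiv' 0).trans ((Equiv.optionCongr e).trans (finSuccEquiv' p).symm)

@[simp] lemma insertPerm_zero {n : ℕ} (p : Fin (n + 1)) (e : Equiv.Perm (Fin n)) :
    insertPerm p e 0 = p := by
  simp [insertPerm]

@[simp] lemma insertPerm_succ {n : ℕ} (p : Fin (n + 1)) (e : Equiv.Perm (Fin n)) (i : Fin n) :
    insertPerm p e i.succ = p.succAbove (e i) := by
  have h1 : finSuccEquiv' 0 i.succ = some i := by
    rw [← Fin.zero_succAbove i]
    exact finSuccEquiv'_succAbove 0 i
  simp [insertPerm, h1]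

lemma insertPerm_bijective (n : ℕ) :
    Function.Bijective (fun a : Fin (n + 1) × Equiv.Perm (Fin n) => insertPerm a.1 a.2) := by
  rw [Fintype.bijective_iff_injective_and_card]
  constructor
  · rintro ⟨p, e⟩ ⟨p', e'⟩ hpe
    simp only at hpe
    have h1 : p = p' := by
      have := congrArg (fun σ : Equiv.Perm (Fin (n + 1)) => σ 0) hpe
      simpa using this
    subst h1
    have h2 : e = e' := by
      ext i
      have := congrArg (fun σ : Equiv.Perm (Fin (n + 1)) => σ i.succ) hpe
      simp only [insertPerm_succ] at this
      rw [Fin.succAbove_right_injective this]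
    rw [h2]
  · simp [Fintype.card_perm, Nat.factorial_succ]

lemma permInv_insertPerm {n : ℕ} (p : Fin (n + 1)) (e : Equiv.Perm (Fin n)) :
    permInv (insertPerm p e) = (p : ℕ) + permInv e := by
  unfold permInv
  rw [Fin.sum_univ_succ, Fin.sum_Ioi_zero]
  congr 1
  · simp only [insertPerm_succ, insertPerm_zero, Fin.succAbove_lt_iff_castSucc_lt]
    rw [Equiv.sum_comp e (fun k : Fin n => if k.castSucc < p then (1 : ℝ) else 0)]
    rw [Finset.sum_boole]
    have h1 : (Finset.univ.filter fun k : Fin n => k.castSucc < p) =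
        Finset.univ.filter fun k : Fin n => (k : ℕ) < (p : ℕ) := by
      ext k; simp [Fin.lt_def]
    rw [h1, Fin.card_filter_val_lt, min_eq_right (Nat.lt_succ_iff.mp p.2)]
  · refine Finset.sum_congr rfl fun i _ => ?_
    rw [Fin.sum_Ioi_succ]
    refine Finset.sum_congr rfl fun j _ => ?_
    simp only [insertPerm_succ]
    congr 1
    rw [(Fin.strictMono_succAbove p).lt_iff_lt]

/-- The generating function of inversions is the `q`-factorial, here with `q = e^{-d}`. -/
lemma sum_exp_permInv (d : ℝ) (n : ℕ) :
    ∑ σ : Equiv.Perm (Fin n), Real.exp (-d * permInv σ) =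
      ∏ k ∈ Finset.range n, ∑ j ∈ Finset.range (k + 1), Real.exp (-d * (j : ℝ)) := by
  induction n with
  | zero => simp [permInv]
  | succ n ih =>
    rw [Finset.prod_range_succ, ← ih,
      ← (Equiv.ofBijective _ (insertPerm_bijective n)).sum_comp, Fintype.sum_prod_type,
      Finset.sum_mul, Finset.sum_comm]
    refine Finset.sum_congr rfl fun e _ => ?_
    rw [Finset.sum_range (fun j : ℕ => Real.exp (-d * (j : ℝ))), Finset.mul_sum]
    refine Finset.sum_congr rfl fun p _ => ?_
    simp only [Equiv.ofBijective_apply]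
    rw [permInv_insertPerm, ← Real.exp_add]
    ring_nf

lemma sum_exp_eq_expMean (d : ℝ) (k : ℕ) :
    ∑ j ∈ Finset.range k, Real.exp (-d * (j : ℝ)) =
      (k : ℝ) * (expMean (d * k) / expMean d) := by
  by_cases hd : d = 0
  · subst hd; simp
  · have h1 : ∀ j : ℕ, Real.exp (-d * (j : ℝ)) = Real.exp (-d) ^ j := by
      intro j; rw [← Real.exp_nat_mul]; ring_nf
    simp only [h1]
    have hne : Real.exp (-d) ≠ 1 := by
      simpa [Real.exp_eq_one_iff] using hd
    rw [geom_sum_eq hne, ← mul_div_assoc, mul_expMean hd, expMean_eq hd]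
    have h2 : Real.exp (-(d * (k : ℝ))) = Real.exp (-d) ^ k := by
      rw [← Real.exp_nat_mul]; ring_nf
    rw [h2]
    have h3 : Real.exp (-d) - 1 ≠ 0 := sub_ne_zero.mpr hne
    have h4 : 1 - Real.exp (-d) ≠ 0 := sub_ne_zero.mpr hne.symm
    field_simp
    ring

/-! ### The pair interaction -/

lemma h_eq_ite (z w : Square) :
    h z w = if ((z.1 : ℝ) - w.1) * ((z.2 : ℝ) - w.2) < 0 then 1 else 0 := by
  simp [h, Set.indicator_apply]

lemma h_comm (z w : Square) : h z w = h w z := by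
  rw [h_eq_ite, h_eq_ite]
  congr 2
  ring

@[simp] lemma h_self (z : Square) : h z z = 0 := by simp [h_eq_ite]

lemma h_nonneg (z w : Square) : 0 ≤ h z w := by
  rw [h_eq_ite]; split_ifs <;> norm_num

lemma h_le_one (z w : Square) : h z w ≤ 1 := by
  rw [h_eq_ite]; split_ifs <;> norm_num

lemma measurable_h : Measurable fun p : Square × Square => h p.1 p.2 := by
  unfold h
  refine Measurable.comp (g := Set.indicator (Set.Iio (0 : ℝ)) fun _ => (1 : ℝ))
    (measurable_const.indicator measurableSet_Iio) ?_
  fun_prop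

/-- The number of inverted pairs of a configuration. -/
def invCount {n : ℕ} (z : Fin n → Square) : ℝ := ∑ i : Fin n, ∑ j ∈ Finset.Ioi i, h (z i) (z j)

lemma sum_Ioi_eq_half {n : ℕ} (g : Fin n → Fin n → ℝ) (hs : ∀ i j, g i j = g j i)
    (h0 : ∀ i, g i i = 0) :
    ∑ i, ∑ j ∈ Finset.Ioi i, g i j = (1 / 2) * ∑ i, ∑ j, g i j := by
  have h1 : ∀ i, ∑ j, g i j = ∑ j ∈ Finset.Ioi i, g i j + ∑ j ∈ Finset.Iio i, g i j := by
    intro i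
    have : (Finset.univ : Finset (Fin n)) = insert i (Finset.Ioi i ∪ Finset.Iio i) := by
      ext j
      simp only [Finset.mem_univ, Finset.mem_insert, Finset.mem_union, Finset.mem_Ioi,
        Finset.mem_Iio, true_iff]
      rcases lt_trichotomy j i with h | h | h
      · exact Or.inr (Or.inr h)
      · exact Or.inl h
      · exact Or.inr (Or.inl h)
    rw [this, Finset.sum_insert (by simp), h0, zero_add, Finset.sum_union]
    rw [Finset.disjoint_left]
    intro j hj hj'
    rw [Finset.mem_Ioi] at hj
    rw [Finset.mem_Iio] at hj'
    exact lt_asymm hj hj'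
  have h2 : ∑ i, ∑ j ∈ Finset.Iio i, g i j = ∑ i, ∑ j ∈ Finset.Ioi i, g i j := by
    rw [Finset.sum_comm' (t' := Finset.univ) (s' := fun j => Finset.Ioi j)]
    · exact Finset.sum_congr rfl fun i _ => Finset.sum_congr rfl fun j _ => hs _ _
    · intro x y; simp
  simp only [h1, Finset.sum_add_distrib, h2]
  ring

lemma invCount_eq_half {n : ℕ} (z : Fin n → Square) :
    invCount z = (1 / 2) * ∑ i, ∑ j, h (z i) (z j) :=
  sum_Ioi_eq_half _ (fun _ _ => h_comm _ _) fun _ => h_self _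

lemma invCount_comp {n : ℕ} (z : Fin n → Square) (τ : Equiv.Perm (Fin n)) :
    invCount (fun i => z (τ i)) = invCount z := by
  rw [invCount_eq_half, invCount_eq_half, Equiv.sum_comp τ (fun i => ∑ j, h (z i) (z (τ j)))]
  congr 1
  exact Finset.sum_congr rfl fun i _ => Equiv.sum_comp τ (fun j => h (z i) (z j))

lemma invCount_nonneg {n : ℕ} (z : Fin n → Square) : 0 ≤ invCount z :=
  Finset.sum_nonneg fun _ _ => Finset.sum_nonneg fun _ _ => h_nonneg _ _

lemma invCount_le {n : ℕ} (z : Fin n → Square) : invCount z ≤ (n : ℝ) * n := by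
  rw [invCount_eq_half]
  have : ∑ i, ∑ j, h (z i) (z j) ≤ ∑ _i : Fin n, ∑ _j : Fin n, (1 : ℝ) :=
    Finset.sum_le_sum fun i _ => Finset.sum_le_sum fun j _ => h_le_one _ _
  simp at this
  have h0 : (0 : ℝ) ≤ (n : ℝ) * n := by positivity
  linarith

lemma measurable_invCount {n : ℕ} : Measurable (invCount : (Fin n → Square) → ℝ) := by
  unfold invCount
  refine Finset.measurable_sum _ fun i _ => Finset.measurable_sum _ fun j _ => ?_
  exact measurable_h.comp (by fun_prop : Measurable fun z : Fin n → Square => (z i, z j))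

/-- Against increasing first coordinates, the inversions of a configuration are those of the
permutation that orders the second coordinates. -/
lemma invCount_strictMono {n : ℕ} {x y : Fin n → unitInterval} (hx : StrictMono x)
    (hy : StrictMono y) (π : Equiv.Perm (Fin n)) :
    invCount (fun i => (x i, y (π i))) = permInv π := by
  refine Finset.sum_congr rfl fun i _ => Finset.sum_congr rfl fun j hj => ?_
  rw [Finset.mem_Ioi] at hj
  have h1 : ((x i : ℝ) - x j) < 0 := sub_neg.mpr (hx hj)
  rw [h_eq_ite]
  congr 1
  simp only [mul_neg_iff, h1, h1.not_gt, false_and, true_and, false_or, sub_pos, eq_iff_iff]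
  exact hy.lt_iff_lt

/-- Permuting the second coordinates of a configuration in general position produces each
permutation exactly once. -/
lemma sum_exp_invCount (d : ℝ) {n : ℕ} {x y : Fin n → unitInterval} (hx : Function.Injective x)
    (hy : Function.Injective y) :
    ∑ σ : Equiv.Perm (Fin n), Real.exp (-d * invCount (fun i => (x i, y (σ i)))) =
      ∑ σ : Equiv.Perm (Fin n), Real.exp (-d * permInv σ) := by
  have hx' : StrictMono (x ∘ Tuple.sort x) :=
    (Tuple.monotone_sort x).strictMono_of_injective (hx.comp (Equiv.injective _))
  have hy' : StrictMono (y ∘ Tuple.sort y) :=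
    (Tuple.monotone_sort y).strictMono_of_injective (hy.comp (Equiv.injective _))
  rw [← ((Equiv.mulRight (Tuple.sort x)).trans (Equiv.mulLeft (Tuple.sort y)⁻¹)).sum_comp
    (fun π => Real.exp (-d * permInv π))]
  refine Finset.sum_congr rfl fun σ _ => ?_
  rw [← invCount_strictMono hx' hy', ← invCount_comp _ (Tuple.sort x)]
  simp [Equiv.Perm.mul_apply]

/-! ### The partition function of an atomless product measure -/

section

variable {α γ : Measure unitInterval} [IsProbabilityMeasure α] [IsProbabilityMeasure γ]

lemma map_pi_pair {X : Type*} [MeasurableSpace X] (μ : Measure X) [IsProbabilityMeasure μ] {n : ℕ}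
    {i j : Fin n} (hij : i ≠ j) :
    (Measure.pi fun _ : Fin n => μ).map (fun z => (z i, z j)) = μ.prod μ := by
  have hind := ProbabilityTheory.iIndepFun_pi (μ := fun _ : Fin n => μ) (X := fun _ => id)
    (fun _ => aemeasurable_id)
  have h2 := (ProbabilityTheory.indepFun_iff_map_prod_eq_prod_map_map
    (measurable_pi_apply i).aemeasurable (measurable_pi_apply j).aemeasurable).mp
    (hind.indepFun hij)
  have h3 : ∀ k : Fin n, (Measure.pi fun _ : Fin n => μ).map (fun z => z k) = μ := fun k =>
    (measurePreserving_eval (fun _ : Fin n => μ) k).map_eq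
  rw [h3, h3] at h2
  exact h2

lemma ae_injective_of_pair {X Y : Type*} [MeasurableSpace X] (μ : Measure X)
    [IsProbabilityMeasure μ] (n : ℕ) (f : X → Y)
    (hf : ∀ᵐ p ∂(μ.prod μ), f p.1 ≠ f p.2) :
    ∀ᵐ z ∂(Measure.pi fun _ : Fin n => μ), Function.Injective fun i => f (z i) := by
  have h1 : ∀ i j : Fin n, i ≠ j →
      ∀ᵐ z ∂(Measure.pi fun _ : Fin n => μ), f (z i) ≠ f (z j) := by
    intro i j hij
    rw [← map_pi_pair μ hij] at hf
    exact ae_of_ae_map (f := fun z : Fin n → X => (z i, z j)) (p := fun p => f p.1 ≠ f p.2)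
      (by fun_prop) hf
  have h2 : ∀ᵐ z ∂(Measure.pi fun _ : Fin n => μ), ∀ i j : Fin n, i ≠ j → f (z i) ≠ f (z j) := by
    rw [ae_all_iff]; intro i
    rw [ae_all_iff]; intro j
    by_cases hij : i = j
    · simp [hij]
    · filter_upwards [h1 i j hij] with z hz _ using hz
  filter_upwards [h2] with z hz i j hij
  by_contra hne
  exact hz i j hne hij

lemma ae_prod_fst_ne [NullSingletonClass α] :
    ∀ᵐ p ∂((α.prod γ).prod (α.prod γ)), p.1.1 ≠ p.2.1 := by
  refine (Measure.ae_prod_iff_ae_ae (p := fun p : Square × Square => p.1.1 ≠ p.2.1)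
    (measurableSet_eq_fun (by fun_prop) (by fun_prop)).compl).mpr
    (Eventually.of_forall fun z => ?_)
  have h1 : ∀ᵐ x ∂((α.prod γ).map Prod.fst), z.1 ≠ x := by
    rw [Measure.map_fst_prod, measure_univ, one_smul]
    filter_upwards [Measure.ae_ne α z.1] with x hx using hx.symm
  exact ae_of_ae_map (f := Prod.fst) (p := fun x => z.1 ≠ x) (by fun_prop) h1

lemma ae_prod_snd_ne [NullSingletonClass γ] :
    ∀ᵐ p ∂((α.prod γ).prod (α.prod γ)), p.1.2 ≠ p.2.2 := by
  refine (Measure.ae_prod_iff_ae_ae (p := fun p : Square × Square => p.1.2 ≠ p.2.2)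
    (measurableSet_eq_fun (by fun_prop) (by fun_prop)).compl).mpr
    (Eventually.of_forall fun z => ?_)
  have h1 : ∀ᵐ x ∂((α.prod γ).map Prod.snd), z.2 ≠ x := by
    rw [Measure.map_snd_prod, measure_univ, one_smul]
    filter_upwards [Measure.ae_ne γ z.2] with x hx using hx.symm
  exact ae_of_ae_map (f := Prod.snd) (p := fun x => z.2 ≠ x) (by fun_prop) h1

lemma measurePreserving_permute_snd {n : ℕ} (σ : Equiv.Perm (Fin n)) :
    MeasurePreserving (fun (z : Fin n → Square) i => ((z i).1, (z (σ i)).2))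
      (Measure.pi fun _ => α.prod γ) (Measure.pi fun _ => α.prod γ) := by
  have e := measurePreserving_arrowProdEquivProdArrow unitInterval unitInterval (Fin n)
    (fun _ => α) (fun _ => γ)
  have h1 : MeasurePreserving (fun (y : Fin n → unitInterval) i => y (σ i))
      (Measure.pi fun _ => γ) (Measure.pi fun _ => γ) := by
    have := (measurePreserving_piCongrLeft (fun _ : Fin n => γ) σ⁻¹)
    convert! this using 1
    funext y i
    have hi : i = σ⁻¹ (σ i) := by simp
    conv_rhs => rw [hi]
    exact (Equiv.piCongrLeft_apply_apply (fun _ : Fin n => unitInterval) σ⁻¹ y (σ i)).symm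
  exact (e.symm.comp ((MeasurePreserving.id _).prod h1)).comp e

/-- The partition function is the same for all atomless product reference measures: averaging over
the permutations of the second coordinates turns it into a sum over the symmetric group. -/
lemma integral_exp_invCount [NullSingletonClass α] [NullSingletonClass γ] (d : ℝ) (n : ℕ) :
    ∫ z, Real.exp (-d * invCount z) ∂(Measure.pi fun _ : Fin n => α.prod γ) =
      ∏ k ∈ Finset.range n, expMean (d * (k + 1 : ℕ)) / expMean d := by
  set μ := Measure.pi fun _ : Fin n => α.prod γ with hμ
  have hint : Integrable (fun z : Fin n → Square => Real.exp (-d * invCount z)) μ := by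
    refine Integrable.of_bound (C := Real.exp (|d| * (n * n)))
      (by have := @measurable_invCount n; fun_prop) (Eventually.of_forall fun z => ?_)
    rw [Real.norm_eq_abs, Real.abs_exp]
    apply Real.exp_le_exp.mpr
    calc -d * invCount z ≤ |-d * invCount z| := le_abs_self _
      _ = |d| * invCount z := by rw [abs_mul, abs_neg, abs_of_nonneg (invCount_nonneg z)]
      _ ≤ _ := mul_le_mul_of_nonneg_left (invCount_le z) (abs_nonneg _)
  have hperm : ∀ σ : Equiv.Perm (Fin n),
      Integrable (fun z : Fin n → Square =>
        Real.exp (-d * invCount fun i => ((z i).1, (z (σ i)).2))) μ ∧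
      ∫ z, Real.exp (-d * invCount fun i => ((z i).1, (z (σ i)).2)) ∂μ =
        ∫ z, Real.exp (-d * invCount z) ∂μ := by
    intro σ
    have hmp : MeasurePreserving (fun (z : Fin n → Square) i => ((z i).1, (z (σ i)).2)) μ μ :=
      measurePreserving_permute_snd σ
    refine ⟨hmp.integrable_comp_of_integrable hint, ?_⟩
    have h2 := integral_map (μ := μ) hmp.measurable.aemeasurable
      (f := fun z : Fin n → Square => Real.exp (-d * invCount z))
      (by rw [hmp.map_eq]; exact hint.aestronglyMeasurable)
    rw [hmp.map_eq] at h2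
    exact h2.symm
  have hsum : ∑ σ : Equiv.Perm (Fin n), ∫ z, Real.exp (-d * invCount z) ∂μ =
      ∑ σ : Equiv.Perm (Fin n), Real.exp (-d * permInv σ) := by
    rw [← Finset.sum_congr rfl fun σ _ => (hperm σ).2, ← integral_finsetSum _
      fun σ _ => (hperm σ).1]
    have hae : (fun z : Fin n → Square => ∑ σ : Equiv.Perm (Fin n),
        Real.exp (-d * invCount fun i => ((z i).1, (z (σ i)).2))) =ᵐ[μ]
        fun _ => ∑ σ : Equiv.Perm (Fin n), Real.exp (-d * permInv σ) := by
      filter_upwards [ae_injective_of_pair (α.prod γ) n Prod.fst ae_prod_fst_ne,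
        ae_injective_of_pair (α.prod γ) n Prod.snd ae_prod_snd_ne] with z h1 h2
      exact sum_exp_invCount d (x := fun i => (z i).1) (y := fun i => (z i).2) h1 h2
    rw [integral_congr_ae hae, integral_const, probReal_univ, one_smul]
  rw [Finset.sum_const, Finset.card_univ, Fintype.card_perm, Fintype.card_fin, nsmul_eq_mul,
    sum_exp_permInv] at hsum
  simp only [sum_exp_eq_expMean] at hsum
  have hfac : ∏ k ∈ Finset.range n, ((k + 1 : ℕ) : ℝ) = (n.factorial : ℝ) := by
    rw [← Finset.prod_range_add_one_eq_factorial, Nat.cast_prod]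
  rw [Finset.prod_mul_distrib, hfac] at hsum
  have hne : (n.factorial : ℝ) ≠ 0 := Nat.cast_ne_zero.mpr (Nat.factorial_ne_zero n)
  exact mul_left_cancel₀ hne hsum

end

/-! ### The pressure -/

lemma exp_hamiltonian_eq (n : ℕ) (β : ℝ) (z : Fin n → Square) :
    Real.exp (-β * hamiltonian n z) = Real.exp (-(β / ((n : ℝ) - 1)) * invCount z) := by
  unfold hamiltonian invCount
  ring_nf

/-- The finite pressure can be computed with any atomless product reference measure. -/
lemma finitePressure_eq (α γ : Measure unitInterval) [IsProbabilityMeasure α]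
    [IsProbabilityMeasure γ] [NullSingletonClass α] [NullSingletonClass γ] (n : ℕ) (β : ℝ) :
    finitePressure n β = (1 / (n : ℝ)) * Real.log (∫ z, Real.exp (-(β / ((n : ℝ) - 1)) * invCount z)
      ∂(Measure.pi fun _ : Fin n => α.prod γ)) := by
  unfold finitePressure partitionFunction
  simp only [exp_hamiltonian_eq]
  rw [integral_exp_invCount, volume_pi, Measure.volume_eq_prod, integral_exp_invCount]

/-- For `n + 1` particles the exponent `d = β / n` of the `q`-factorial makes the first `n` of its
`n + 1` factors a Riemann sum. -/
lemma finitePressure_eq_sum (n : ℕ) (β : ℝ) :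
    finitePressure (n + 1) β =
      ((n : ℝ) / (n + 1 : ℕ)) * ((∑ k ∈ Finset.range n,
          Real.log (expMean (β * ((k + 1 : ℕ) / (n : ℝ))))) / n)
        + (1 / (n + 1 : ℕ)) * Real.log (expMean (β / n * (n + 1 : ℕ)))
        - Real.log (expMean (β / n)) := by
  rw [finitePressure_eq volume volume, integral_exp_invCount]
  have h1 : ((n + 1 : ℕ) : ℝ) - 1 = n := by push_cast; ring
  rw [h1, Real.log_prod (fun k _ => (div_pos (expMean_pos _) (expMean_pos _)).ne')]
  simp only [Real.log_div (expMean_pos _).ne' (expMean_pos _).ne']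
  rw [Finset.sum_sub_distrib, Finset.sum_const, Finset.card_range, nsmul_eq_mul,
    Finset.sum_range_succ]
  have h2 : ∀ k : ℕ, β / (n : ℝ) * (k + 1 : ℕ) = β * ((k + 1 : ℕ) / (n : ℝ)) := by
    intro k; ring
  simp only [h2]
  have h3 : ((n + 1 : ℕ) : ℝ) ≠ 0 := by positivity
  rcases Nat.eq_zero_or_pos n with hn | hn
  · subst hn; simp
  · have h4 : (n : ℝ) ≠ 0 := by positivity
    field_simp

theorem tendsto_finitePressure (β : ℝ) :
    Tendsto (fun n : ℕ => finitePressure n β) atTop (𝓝 (limitPressure β)) := by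
  rw [← tendsto_add_atTop_iff_nat 1]
  simp only [finitePressure_eq_sum]
  have hφ := continuous_log_expMean
  have t1 : Tendsto (fun n : ℕ => (n : ℝ) / (n + 1 : ℕ)) atTop (𝓝 1) := by
    simpa using tendsto_natCast_div_add_atTop (1 : ℝ)
  have t0 : Tendsto (fun n : ℕ => 1 / ((n + 1 : ℕ) : ℝ)) atTop (𝓝 0) := by
    simpa using tendsto_one_div_add_atTop_nhds_zero_nat (𝕜 := ℝ)
  have t2 : Tendsto (fun n : ℕ => β / (n : ℝ)) atTop (𝓝 0) := tendsto_const_div_atTop_nhds_zero_nat β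
  have t3 : Tendsto (fun n : ℕ => β / (n : ℝ) * (n + 1 : ℕ)) atTop (𝓝 β) := by
    have h1 : Tendsto (fun n : ℕ => β + β / (n : ℝ)) atTop (𝓝 (β + 0)) := tendsto_const_nhds.add t2
    rw [add_zero] at h1
    refine h1.congr' ?_
    filter_upwards [eventually_gt_atTop 0] with n hn
    have : (n : ℝ) ≠ 0 := by positivity
    push_cast
    field_simp
  have H := ((t1.mul (tendsto_riemann_log_expMean β)).add
    (t0.mul ((hφ.tendsto β).comp t3))).sub ((hφ.tendsto 0).comp t2)
  simpa using H

theorem pressure_eq (β : ℝ) : pressure β = limitPressure β :=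
  (tendsto_finitePressure β).limUnder_eq

/-! ### Real densities -/

section Density

variable {X : Type*} [MeasurableSpace X] {μ : Measure X} {f g : X → ℝ}

lemma integral_density (hf : Measurable f) (hf0 : ∀ x, 0 ≤ f x) (g : X → ℝ) :
    ∫ x, g x ∂(μ.withDensity fun x => ENNReal.ofReal (f x)) = ∫ x, f x * g x ∂μ := by
  rw [integral_withDensity_eq_integral_toReal_smul hf.ennreal_ofReal (by simp)]
  simp [ENNReal.toReal_ofReal (hf0 _)]

lemma integrable_density_iff (hf : Measurable f) (hf0 : ∀ x, 0 ≤ f x) :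
    Integrable g (μ.withDensity fun x => ENNReal.ofReal (f x)) ↔
      Integrable (fun x => f x * g x) μ := by
  rw [integrable_withDensity_iff_integrable_smul' hf.ennreal_ofReal (by simp)]
  simp [ENNReal.toReal_ofReal (hf0 _)]

lemma ae_density_pos (hf : Measurable f) :
    ∀ᵐ x ∂(μ.withDensity fun x => ENNReal.ofReal (f x)), 0 < f x := by
  rw [ae_withDensity_iff hf.ennreal_ofReal]
  refine Eventually.of_forall fun x hx => ?_
  by_contra hneg
  exact hx (ENNReal.ofReal_of_nonpos (not_lt.mp hneg))

lemma pi_withDensity {n : ℕ} (μ : Measure X) [IsProbabilityMeasure μ] {F : X → ENNReal}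
    (hF : Measurable F) [SigmaFinite (μ.withDensity F)] :
    (Measure.pi fun _ : Fin n => μ.withDensity F) =
      (Measure.pi fun _ : Fin n => μ).withDensity fun z => ∏ i, F (z i) := by
  refine Measure.pi_eq fun s hs => ?_
  rw [withDensity_apply _ (MeasurableSet.univ_pi hs), ← lintegral_indicator
    (MeasurableSet.univ_pi hs)]
  have h1 : (Set.univ.pi s).indicator (fun z : Fin n → X => ∏ i, F (z i)) =
      fun z => ∏ i, (s i).indicator F (z i) := by
    funext z
    by_cases hz : z ∈ Set.univ.pi s
    · rw [Set.indicator_of_mem hz]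
      exact Finset.prod_congr rfl fun i _ => (Set.indicator_of_mem (hz i (Set.mem_univ i)) _).symm
    · rw [Set.indicator_of_notMem hz]
      simp only [Set.mem_pi, Set.mem_univ, true_implies, not_forall] at hz
      obtain ⟨i, hi⟩ := hz
      exact (Finset.prod_eq_zero (Finset.mem_univ i) (Set.indicator_of_notMem hi _)).symm
  rw [h1]
  have hind := ProbabilityTheory.iIndepFun_pi (μ := fun _ : Fin n => μ)
    (X := fun i => (s i).indicator F) (fun i => (hF.indicator (hs i)).aemeasurable)
  rw [ProbabilityTheory.lintegral_prod_eq_prod_lintegral_of_indepFun Finset.univ _ hind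
    (fun i => (hF.indicator (hs i)).comp (measurable_pi_apply i))]
  refine Finset.prod_congr rfl fun i _ => ?_
  rw [withDensity_apply _ (hs i), ← lintegral_indicator (hs i)]
  exact (measurePreserving_eval (fun _ : Fin n => μ) i).lintegral_comp (hF.indicator (hs i))

end Density

/-! ### Interaction of measures -/

/-- The interaction `∬ h(z, w) dν(z) dν'(w)`. -/
def crossInv (ν ν' : Measure Square) : ℝ := ∫ z, ∫ w, h z w ∂ν' ∂ν

lemma energy_eq (ν : ProbabilityMeasure Square) :
    energy ν = (1 / 2) * crossInv (ν : Measure Square) ν := rfl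

lemma integrable_h_prod (ν ν' : Measure Square) [IsFiniteMeasure ν] [IsFiniteMeasure ν'] :
    Integrable (fun p : Square × Square => h p.1 p.2) (ν.prod ν') := by
  refine Integrable.of_bound measurable_h.aestronglyMeasurable (C := 1)
    (Eventually.of_forall fun p => ?_)
  rw [Real.norm_eq_abs, abs_of_nonneg (h_nonneg _ _)]
  exact h_le_one _ _

lemma crossInv_eq_prod (ν ν' : Measure Square) [IsFiniteMeasure ν] [IsFiniteMeasure ν'] :
    crossInv ν ν' = ∫ p, h p.1 p.2 ∂(ν.prod ν') :=
  (integral_prod _ (integrable_h_prod ν ν')).symm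

lemma crossInv_comm (ν ν' : Measure Square) [IsFiniteMeasure ν] [IsFiniteMeasure ν'] :
    crossInv ν ν' = crossInv ν' ν := by
  rw [crossInv, integral_integral_swap (integrable_h_prod ν ν'), crossInv]
  simp only [h_comm]

lemma crossInv_smul (c : ENNReal) (ν : Measure Square) :
    crossInv (c • ν) (c • ν) = c.toReal ^ 2 * crossInv ν ν := by
  unfold crossInv
  simp only [integral_smul_measure, smul_eq_mul, integral_const_mul]
  ring

/-! ### Gibbs' variational inequality -/

section

variable {α γ : Measure unitInterval} {f : Square → ℝ} {ν : Measure Square}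

/-- Jensen's inequality for the `n`-fold product of `ν`: the normalization `1 / (n - 1)` of the
Hamiltonian makes the bound exact for every `n`. -/
lemma neg_finitePressure_le [IsProbabilityMeasure α] [IsProbabilityMeasure γ]
    [NullSingletonClass α] [NullSingletonClass γ] [IsProbabilityMeasure ν]
    (hf : Measurable f) (hf0 : ∀ z, 0 ≤ f z)
    (hν : ν = (α.prod γ).withDensity fun z => ENNReal.ofReal (f z))
    (hint : Integrable (fun z => Real.log (f z)) ν) (b : ℝ) {n : ℕ} (hn : 2 ≤ n) :
    -finitePressure n b ≤ ∫ z, Real.log (f z) ∂ν + b / 2 * crossInv ν ν := by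
  set d : ℝ := b / ((n : ℝ) - 1) with hd
  set ρn := Measure.pi fun _ : Fin n => α.prod γ with hρn
  set νn := Measure.pi fun _ : Fin n => ν with hνn
  have hn1 : (0 : ℝ) < (n : ℝ) - 1 := by
    have : (2 : ℝ) ≤ n := by exact_mod_cast hn
    linarith
  have hn0 : (0 : ℝ) < n := by linarith
  set g : (Fin n → Square) → ℝ := fun z => ∏ i, f (z i) with hg
  have hgm : Measurable g := Finset.measurable_prod _ fun i _ => hf.comp (measurable_pi_apply i)
  have hg0 : ∀ z, 0 ≤ g z := fun z => Finset.prod_nonneg fun i _ => hf0 _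
  have hνn' : νn = ρn.withDensity fun z => ENNReal.ofReal (g z) := by
    have h1 : SigmaFinite ((α.prod γ).withDensity fun z => ENNReal.ofReal (f z)) := by
      rw [← hν]; infer_instance
    rw [hνn, hρn]
    conv_lhs => rw [hν]
    rw [pi_withDensity _ hf.ennreal_ofReal]
    congr 1
    funext z
    rw [hg, ENNReal.ofReal_prod_of_nonneg fun i _ => hf0 _]
  set Φ : (Fin n → Square) → ℝ := fun z => -d * invCount z - ∑ i, Real.log (f (z i)) with hΦ
  have hexp_le : ∀ z : Fin n → Square, Real.exp (-d * invCount z) ≤ Real.exp (|d| * (n * n)) := by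
    intro z
    apply Real.exp_le_exp.mpr
    calc -d * invCount z ≤ |-d * invCount z| := le_abs_self _
      _ = |d| * invCount z := by rw [abs_mul, abs_neg, abs_of_nonneg (invCount_nonneg z)]
      _ ≤ _ := mul_le_mul_of_nonneg_left (invCount_le z) (abs_nonneg _)
  have hintInv : Integrable (invCount : (Fin n → Square) → ℝ) νn := by
    refine Integrable.of_bound (C := (n : ℝ) * n) measurable_invCount.aestronglyMeasurable
      (Eventually.of_forall fun z => ?_)
    rw [Real.norm_eq_abs, abs_of_nonneg (invCount_nonneg z)]
    exact invCount_le z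
  have hintLog : ∀ i : Fin n, Integrable (fun z : Fin n → Square => Real.log (f (z i))) νn :=
    fun i => (measurePreserving_eval (fun _ : Fin n => ν) i).integrable_comp_of_integrable hint
  have hintLogs : Integrable (fun z : Fin n → Square => ∑ i, Real.log (f (z i))) νn :=
    integrable_finsetSum _ fun i _ => hintLog i
  have hintΦ : Integrable Φ νn := (hintInv.const_mul _).sub hintLogs
  have hvalLog : ∀ i : Fin n, ∫ z, Real.log (f (z i)) ∂νn = ∫ z, Real.log (f z) ∂ν := by
    intro i
    exact integral_comp_eval (μ := fun _ : Fin n => ν) (i := i) (f := fun z => Real.log (f z))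
      hint.aestronglyMeasurable
  have hpair : ∀ i j : Fin n, i ≠ j → Integrable (fun z : Fin n → Square => h (z i) (z j)) νn ∧
      ∫ z, h (z i) (z j) ∂νn = crossInv ν ν := by
    intro i j hij
    have hmap := map_pi_pair ν hij
    have hI := integrable_h_prod ν ν
    rw [crossInv_eq_prod]
    rw [← hmap] at hI ⊢
    have hm : AEMeasurable (fun z : Fin n → Square => (z i, z j)) νn := by fun_prop
    exact ⟨hI.comp_aemeasurable hm, (integral_map hm measurable_h.aestronglyMeasurable).symm⟩
  have hvalInv : ∫ z, invCount z ∂νn = (n : ℝ) * ((n : ℝ) - 1) / 2 * crossInv ν ν := by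
    unfold invCount
    rw [integral_finsetSum _ fun i _ => integrable_finsetSum _ fun j hj =>
      (hpair i j (Finset.mem_Ioi.mp hj).ne).1]
    have h1 : ∀ i : Fin n, ∫ z, ∑ j ∈ Finset.Ioi i, h (z i) (z j) ∂νn =
        ∑ j ∈ Finset.Ioi i, crossInv ν ν := by
      intro i
      rw [integral_finsetSum _ fun j hj => (hpair i j (Finset.mem_Ioi.mp hj).ne).1]
      exact Finset.sum_congr rfl fun j hj => (hpair i j (Finset.mem_Ioi.mp hj).ne).2
    simp only [h1]
    have h2 := sum_Ioi_eq_half (n := n) (fun i j => if i = j then 0 else crossInv ν ν)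
      (fun i j => by simp [eq_comm]) (fun i => by simp)
    have h3 : ∀ i : Fin n, ∑ j ∈ Finset.Ioi i, (if i = j then 0 else crossInv ν ν) =
        ∑ j ∈ Finset.Ioi i, crossInv ν ν := fun i =>
      Finset.sum_congr rfl fun j hj => if_neg (Finset.mem_Ioi.mp hj).ne
    simp only [h3] at h2
    rw [h2]
    have h4 : ∀ i : Fin n, ∑ j, (if i = j then 0 else crossInv ν ν) =
        ((n : ℝ) - 1) * crossInv ν ν := by
      intro i
      have : ∀ j, (if i = j then 0 else crossInv ν ν) =
          crossInv ν ν - if i = j then crossInv ν ν else 0 := by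
        intro j; split_ifs <;> simp
      simp only [this, Finset.sum_sub_distrib, Finset.sum_const, Finset.card_univ,
        Fintype.card_fin, nsmul_eq_mul, Finset.sum_ite_eq, Finset.mem_univ, if_true]
      ring
    simp only [h4, Finset.sum_const, Finset.card_univ, Fintype.card_fin, nsmul_eq_mul]
    ring
  set m : ℝ := ∫ z, Φ z ∂νn with hm
  have hmval : m = -(n * (∫ z, Real.log (f z) ∂ν + b / 2 * crossInv ν ν)) := by
    rw [hm, hΦ, integral_sub (hintInv.const_mul _) hintLogs, integral_const_mul, hvalInv,
      integral_finsetSum _ fun i _ => hintLog i]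
    simp only [hvalLog, Finset.sum_const, Finset.card_univ, Fintype.card_fin, nsmul_eq_mul]
    rw [hd]
    field_simp
    ring
  -- Jensen's inequality, by integrating `e^m (1 + Φ - m) ≤ e^Φ` against `νn`; where the density `g`
  -- vanishes there is nothing to compare
  have hkey : Real.exp m ≤ ∫ z, Real.exp (-d * invCount z) ∂ρn := by
    have hI0 : Integrable (fun z => 1 + Φ z) νn := (integrable_const 1).add hintΦ
    have hI1 : Integrable (fun z => Real.exp m * (1 + Φ z - m)) νn :=
      (hI0.sub (integrable_const m)).const_mul _
    have e1 : ∫ z, Real.exp m * (1 + Φ z - m) ∂νn = Real.exp m := by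
      rw [integral_const_mul, integral_sub hI0 (integrable_const m),
        integral_add (integrable_const 1) hintΦ]
      simp [← hm]
    rw [← e1]
    have hI2 := hI1
    rw [hνn'] at hI2 ⊢
    rw [integrable_density_iff hgm hg0] at hI2
    rw [integral_density hgm hg0]
    refine integral_mono hI2 ?_ fun z => ?_
    · refine Integrable.of_bound (C := Real.exp (|d| * (n * n)))
        (by have := @measurable_invCount n; fun_prop) (Eventually.of_forall fun z => ?_)
      rw [Real.norm_eq_abs, Real.abs_exp]
      exact hexp_le z
    · by_cases hz : ∀ i, f (z i) ≠ 0
      · have e2 : Real.exp (-d * invCount z) = g z * Real.exp (Φ z) := by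
          have e3 : g z = Real.exp (∑ i, Real.log (f (z i))) := by
            rw [Real.exp_sum]
            exact Finset.prod_congr rfl fun i _ =>
              (Real.exp_log (lt_of_le_of_ne (hf0 _) (hz i).symm)).symm
          rw [e3, ← Real.exp_add]
          congr 1
          simp only [hΦ]
          ring
        simp only
        rw [e2]
        refine mul_le_mul_of_nonneg_left ?_ (hg0 z)
        have e4 : Real.exp (Φ z) = Real.exp m * Real.exp (Φ z - m) := by
          rw [← Real.exp_add]; ring_nf
        rw [e4]
        refine mul_le_mul_of_nonneg_left ?_ (Real.exp_pos m).le
        linarith [Real.add_one_le_exp (Φ z - m)]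
      · push Not at hz
        obtain ⟨i, hi⟩ := hz
        have : g z = 0 := Finset.prod_eq_zero (Finset.mem_univ i) hi
        simp only [this, zero_mul]
        exact (Real.exp_pos _).le
  rw [finitePressure_eq α γ]
  have hlog : m ≤ Real.log (∫ z, Real.exp (-d * invCount z) ∂ρn) := by
    rw [Real.le_log_iff_exp_le (lt_of_lt_of_le (Real.exp_pos m) hkey)]
    exact hkey
  rw [hmval] at hlog
  rw [← hd, ← hρn, one_div, neg_le, inv_mul_eq_div, le_div_iff₀ hn0]
  linarith

lemma neg_limitPressure_le [IsProbabilityMeasure α] [IsProbabilityMeasure γ]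
    [NullSingletonClass α] [NullSingletonClass γ] [IsProbabilityMeasure ν]
    (hf : Measurable f) (hf0 : ∀ z, 0 ≤ f z)
    (hν : ν = (α.prod γ).withDensity fun z => ENNReal.ofReal (f z))
    (hint : Integrable (fun z => Real.log (f z)) ν) (b : ℝ) :
    -limitPressure b ≤ ∫ z, Real.log (f z) ∂ν + b / 2 * crossInv ν ν :=
  le_of_tendsto (tendsto_finitePressure b).neg
    ((eventually_ge_atTop 2).mono fun _ hn => neg_finitePressure_le hf hf0 hν hint b hn)

lemma isProbabilityMeasure_smul_ofReal_inv {X : Type*} [MeasurableSpace X] {μ : Measure X} {t : ℝ}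
    (ht : 0 < t) (hμ : μ Set.univ = ENNReal.ofReal t) :
    IsProbabilityMeasure (ENNReal.ofReal t⁻¹ • μ) :=
  ⟨by rw [Measure.smul_apply, hμ, smul_eq_mul, ← ENNReal.ofReal_mul (by positivity),
    inv_mul_cancel₀ ht.ne', ENNReal.ofReal_one]⟩

/-- Gibbs' variational inequality, scaled to measures of mass `t`. -/
theorem neg_pressurePrimitive_le [NullSingletonClass α] [NullSingletonClass γ]
    [SFinite α] [SFinite γ] {t : ℝ} (ht : 0 ≤ t)
    (hα : α Set.univ = ENNReal.ofReal t) (hγ : γ Set.univ = ENNReal.ofReal t)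
    (hνt : ν Set.univ = ENNReal.ofReal t) (hf : Measurable f) (hf0 : ∀ z, 0 ≤ f z)
    (hν : ν = (α.prod γ).withDensity fun z => ENNReal.ofReal (f z))
    (hint : Integrable (fun z => Real.log (t * f z)) ν) (b : ℝ) :
    -pressurePrimitive b t ≤ ∫ z, Real.log (t * f z) ∂ν + b / 2 * crossInv ν ν := by
  rcases ht.eq_or_lt with rfl | ht
  · rw [ENNReal.ofReal_zero, Measure.measure_univ_eq_zero] at hνt
    simp [hνt, crossInv]
  have i1 := isProbabilityMeasure_smul_ofReal_inv ht hα
  have i2 := isProbabilityMeasure_smul_ofReal_inv ht hγ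
  have i3 := isProbabilityMeasure_smul_ofReal_inv ht hνt
  have n1 : NullSingletonClass (ENNReal.ofReal t⁻¹ • α) := ⟨fun x => by simp⟩
  have n2 : NullSingletonClass (ENNReal.ofReal t⁻¹ • γ) := ⟨fun x => by simp⟩
  have hc : ENNReal.ofReal t⁻¹ * ENNReal.ofReal t = 1 := by
    rw [← ENNReal.ofReal_mul (by positivity), inv_mul_cancel₀ ht.ne', ENNReal.ofReal_one]
  have hν' : ENNReal.ofReal t⁻¹ • ν =
      ((ENNReal.ofReal t⁻¹ • α).prod (ENNReal.ofReal t⁻¹ • γ)).withDensity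
        fun z => ENNReal.ofReal (t * f z) := by
    rw [Measure.prod_smul_left, Measure.prod_smul_right, smul_smul, withDensity_smul_measure]
    have h1 : (fun z => ENNReal.ofReal (t * f z)) =
        ENNReal.ofReal t • fun z => ENNReal.ofReal (f z) := by
      funext z
      rw [Pi.smul_apply, smul_eq_mul, ENNReal.ofReal_mul ht.le]
    rw [h1, withDensity_smul _ hf.ennreal_ofReal, ← hν, smul_smul, mul_assoc, hc, mul_one]
  have key := neg_limitPressure_le (f := fun z => t * f z) (hf.const_mul t)
    (fun z => mul_nonneg ht.le (hf0 z)) hν' (hint.smul_measure (by simp)) (b * t)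
  rw [integral_smul_measure, crossInv_smul, ENNReal.toReal_ofReal (by positivity)] at key
  rw [pressurePrimitive_eq]
  have := mul_le_mul_of_nonneg_left key ht.le
  rw [smul_eq_mul] at this
  calc _ = t * -limitPressure (b * t) := by ring
    _ ≤ _ := this
    _ = _ := by field_simp

end

/-! ### Integration over the unit interval -/

lemma integral_unitInterval (g : ℝ → ℝ) : ∫ x : unitInterval, g x = ∫ x in (0 : ℝ)..1, g x := by
  rw [unitInterval.measurePreserving_coe.integral_comp unitInterval.measurableEmbedding_coe g,
    intervalIntegral.integral_of_le zero_le_one]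
  exact integral_Icc_eq_integral_Ioc

lemma integral_unitInterval_Ioi (g : ℝ → ℝ) (y : unitInterval) :
    ∫ v : unitInterval, (if y < v then g v else 0) = ∫ v in (y : ℝ)..1, g v := by
  have h1 : ∀ v : unitInterval, (if y < v then g v else 0) =
      (Set.Ioi (y : ℝ)).indicator g (v : ℝ) := by
    intro v; simp [Set.indicator_apply]
  simp only [h1]
  rw [unitInterval.measurePreserving_coe.integral_comp unitInterval.measurableEmbedding_coe,
    setIntegral_indicator measurableSet_Ioi, intervalIntegral.integral_of_le y.2.2]
  congr 2
  ext v
  simp only [Set.mem_inter_iff, Set.mem_Icc, Set.mem_Ioi, Set.mem_Ioc]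
  exact ⟨fun hv => ⟨hv.2, hv.1.2⟩, fun hv => ⟨⟨y.2.1.trans hv.1.le, hv.2⟩, hv.1⟩⟩

lemma integral_unitInterval_Iio (g : ℝ → ℝ) (y : unitInterval) :
    ∫ v : unitInterval, (if v < y then g v else 0) = ∫ v in (0 : ℝ)..y, g v := by
  have h1 : ∀ v : unitInterval, (if v < y then g v else 0) =
      (Set.Iio (y : ℝ)).indicator g (v : ℝ) := by
    intro v; simp [Set.indicator_apply]
  simp only [h1]
  rw [unitInterval.measurePreserving_coe.integral_comp unitInterval.measurableEmbedding_coe,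
    setIntegral_indicator measurableSet_Iio, intervalIntegral.integral_of_le y.2.1,
    ← integral_Ico_eq_integral_Ioc]
  congr 2
  ext v
  simp only [Set.mem_inter_iff, Set.mem_Icc, Set.mem_Iio, Set.mem_Ico]
  exact ⟨fun hv => ⟨hv.1.1, hv.2⟩, fun hv => ⟨⟨hv.1, hv.2.le.trans y.2.2⟩, hv.2⟩⟩

lemma integrable_of_continuous {X : Type*} [TopologicalSpace X] [CompactSpace X]
    [MeasurableSpace X] [OpensMeasurableSpace X] {μ : Measure X} [IsFiniteMeasure μ]
    {g : X → ℝ} (hg : Continuous g) : Integrable g μ := by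
  obtain ⟨K, hK⟩ := isCompact_univ.exists_bound_of_continuousOn hg.continuousOn
  exact Integrable.of_bound hg.measurable.aestronglyMeasurable K
    (Eventually.of_forall fun x => hK x (Set.mem_univ x))

lemma integral_square {g : Square → ℝ} (hg : Continuous g) :
    ∫ z : Square, g z = ∫ x : unitInterval, ∫ y : unitInterval, g (x, y) := by
  rw [Measure.volume_eq_prod]
  exact integral_prod _ (integrable_of_continuous hg)

/-! ### The Frank copula -/

/-- `∫₀ˣ e^{-bv} dv` for `b ≠ 0`. -/
def frankA (b x : ℝ) : ℝ := (1 - Real.exp (-(b * x))) / b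

/-- The denominator of the density of the Frank copula. -/
def frankD (b x y : ℝ) : ℝ := frankA b 1 - b * frankA b x * frankA b y

/-- The density of the Frank copula. -/
def frankDensity (b x y : ℝ) : ℝ :=
  frankA b 1 * Real.exp (-(b * x)) * Real.exp (-(b * y)) / frankD b x y ^ 2

/-- The distribution function of the Frank copula. -/
def frankCdf (b x y : ℝ) : ℝ := -Real.log (frankD b x y / frankA b 1) / b

/-- The partial derivative `∂C/∂x` of the distribution function of the Frank copula. -/
def frankCond (b x y : ℝ) : ℝ := Real.exp (-(b * x)) * frankA b y / frankD b x y

lemma frankA_eq {b : ℝ} (hb : b ≠ 0) (x : ℝ) : frankA b x = x * expMean (b * x) :=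
  (mul_expMean hb x).symm

lemma frankA_nonneg {b x : ℝ} (hb : b ≠ 0) (hx : 0 ≤ x) : 0 ≤ frankA b x := by
  rw [frankA_eq hb]; exact mul_nonneg hx (expMean_pos _).le

lemma frankA_pos {b x : ℝ} (hb : b ≠ 0) (hx : 0 < x) : 0 < frankA b x := by
  rw [frankA_eq hb]; exact mul_pos hx (expMean_pos _)

@[simp] lemma frankA_zero (b : ℝ) : frankA b 0 = 0 := by simp [frankA]

lemma one_sub_mul_frankA {b : ℝ} (hb : b ≠ 0) (x : ℝ) :
    1 - b * frankA b x = Real.exp (-(b * x)) := by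
  unfold frankA; field_simp; ring

lemma frankA_le {b x : ℝ} (hb : b ≠ 0) (hx : x ≤ 1) : frankA b x ≤ frankA b 1 := by
  have h1 : frankA b 1 - frankA b x = Real.exp (-(b * x)) * frankA b (1 - x) := by
    unfold frankA
    have : Real.exp (-(b * (1 - x))) = Real.exp (-(b * 1)) / Real.exp (-(b * x)) := by
      rw [← Real.exp_sub]; ring_nf
    rw [this]
    have := Real.exp_pos (-(b * x))
    field_simp
    ring
  have h2 : 0 ≤ Real.exp (-(b * x)) * frankA b (1 - x) :=
    mul_nonneg (Real.exp_pos _).le (frankA_nonneg hb (by linarith))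
  linarith

lemma frankD_comm (b x y : ℝ) : frankD b x y = frankD b y x := by unfold frankD; ring

lemma frankD_pos {b x : ℝ} (hb : b ≠ 0) (hx : x ∈ Set.Icc (0 : ℝ) 1) (y : ℝ) :
    0 < frankD b x y := by
  have h1 : frankD b x y = (frankA b 1 - frankA b x) + frankA b x * Real.exp (-(b * y)) := by
    rw [← one_sub_mul_frankA hb y]; unfold frankD; ring
  rw [h1]
  rcases hx.1.eq_or_lt with h0 | h0
  · rw [← h0]; simpa using frankA_pos hb one_pos
  · have h2 := frankA_le hb hx.2
    have h3 := mul_pos (frankA_pos hb h0) (Real.exp_pos (-(b * y)))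
    linarith

lemma frankD_pos' {b y : ℝ} (hb : b ≠ 0) (x : ℝ) (hy : y ∈ Set.Icc (0 : ℝ) 1) :
    0 < frankD b x y := by
  rw [frankD_comm]; exact frankD_pos hb hy x

lemma frankDensity_comm (b x y : ℝ) : frankDensity b x y = frankDensity b y x := by
  unfold frankDensity; rw [frankD_comm]; ring

lemma frankCdf_comm (b x y : ℝ) : frankCdf b x y = frankCdf b y x := by
  unfold frankCdf; rw [frankD_comm]

lemma frankDensity_pos {b x : ℝ} (hb : b ≠ 0) (hx : x ∈ Set.Icc (0 : ℝ) 1) (y : ℝ) :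
    0 < frankDensity b x y := by
  have := frankD_pos hb hx y
  have := frankA_pos hb one_pos
  unfold frankDensity
  positivity

lemma hasDerivAt_frankA {b : ℝ} (hb : b ≠ 0) (x : ℝ) :
    HasDerivAt (frankA b) (Real.exp (-(b * x))) x := by
  have h1 : HasDerivAt (fun x : ℝ => -(b * x)) (-b) x := by
    simpa using ((hasDerivAt_id x).const_mul b).fun_neg
  refine ((h1.exp.const_sub 1).div_const b).congr_deriv ?_
  field_simp

lemma hasDerivAt_frankD {b : ℝ} (hb : b ≠ 0) (x y : ℝ) :
    HasDerivAt (fun y => frankD b x y) (-(b * frankA b x * Real.exp (-(b * y)))) y :=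
  ((hasDerivAt_frankA hb y).const_mul (b * frankA b x)).const_sub _

lemma hasDerivAt_frankCond {b x : ℝ} (hb : b ≠ 0) (hx : x ∈ Set.Icc (0 : ℝ) 1) (y : ℝ) :
    HasDerivAt (fun y => frankCond b x y) (frankDensity b x y) y := by
  have hD := (frankD_pos hb hx y).ne'
  have h1 := ((hasDerivAt_frankA hb y).const_mul (Real.exp (-(b * x)))).div
    (hasDerivAt_frankD hb x y) hD
  refine h1.congr_deriv ?_
  unfold frankDensity
  rw [div_left_inj' (pow_ne_zero 2 hD)]
  unfold frankD
  ring

lemma hasDerivAt_frankCdf {b x : ℝ} (hb : b ≠ 0) (hx : x ∈ Set.Icc (0 : ℝ) 1) (y : ℝ) :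
    HasDerivAt (fun y => frankCdf b x y) (frankCond b y x) y := by
  have hD := frankD_pos hb hx y
  have hA := frankA_pos hb one_pos
  have h1 := ((((hasDerivAt_frankD hb x y).div_const (frankA b 1)).log
    (div_pos hD hA).ne').neg).div_const b
  refine h1.congr_deriv ?_
  unfold frankCond
  rw [frankD_comm b y x]
  field_simp

lemma frankCond_zero (b x : ℝ) : frankCond b x 0 = 0 := by simp [frankCond]

lemma frankD_one {b : ℝ} (hb : b ≠ 0) (x : ℝ) :
    frankD b x 1 = frankA b 1 * Real.exp (-(b * x)) := by
  rw [← one_sub_mul_frankA hb]; unfold frankD; ring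

lemma frankCond_one {b : ℝ} (hb : b ≠ 0) (x : ℝ) : frankCond b x 1 = 1 := by
  have := frankA_pos hb one_pos
  unfold frankCond
  rw [frankD_one hb]
  field_simp

lemma frankCdf_zero {b : ℝ} (hb : b ≠ 0) (x : ℝ) : frankCdf b x 0 = 0 := by
  have := (frankA_pos hb one_pos).ne'
  simp [frankCdf, frankD, this]

lemma frankCdf_one {b : ℝ} (hb : b ≠ 0) (x : ℝ) : frankCdf b x 1 = x := by
  have := (frankA_pos hb one_pos).ne'
  unfold frankCdf
  rw [frankD_one hb, mul_div_cancel_left₀ _ this, Real.log_exp]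
  field_simp

lemma continuous_frankA (b : ℝ) : Continuous (frankA b) := by unfold frankA; fun_prop

lemma continuous_frankDensity {b x : ℝ} (hb : b ≠ 0) (hx : x ∈ Set.Icc (0 : ℝ) 1) :
    Continuous fun y => frankDensity b x y := by
  unfold frankDensity
  have h1 : Continuous fun y => frankD b x y := by
    have := continuous_frankA b
    unfold frankD; fun_prop
  exact Continuous.div (by fun_prop) (h1.pow 2) fun y => pow_ne_zero 2 (frankD_pos hb hx y).ne'

lemma continuous_frankCond {b y : ℝ} (hb : b ≠ 0) (hy : y ∈ Set.Icc (0 : ℝ) 1) :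
    Continuous fun x => frankCond b x y := by
  unfold frankCond
  have h1 : Continuous fun x => frankD b x y := by
    have := continuous_frankA b
    unfold frankD; fun_prop
  exact Continuous.div (by fun_prop) h1 fun x => (frankD_pos' hb x hy).ne'

lemma integral_frankDensity {b x : ℝ} (hb : b ≠ 0) (hx : x ∈ Set.Icc (0 : ℝ) 1) (u v : ℝ) :
    ∫ y in u..v, frankDensity b x y = frankCond b x v - frankCond b x u :=
  intervalIntegral.integral_eq_sub_of_hasDerivAt (fun y _ => hasDerivAt_frankCond hb hx y)
    ((continuous_frankDensity hb hx).intervalIntegrable _ _)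

lemma integral_frankCond {b y : ℝ} (hb : b ≠ 0) (hy : y ∈ Set.Icc (0 : ℝ) 1) (u v : ℝ) :
    ∫ x in u..v, frankCond b x y = frankCdf b v y - frankCdf b u y := by
  rw [frankCdf_comm b v, frankCdf_comm b u]
  exact intervalIntegral.integral_eq_sub_of_hasDerivAt (fun x _ => hasDerivAt_frankCdf hb hy x)
    ((continuous_frankCond hb hy).intervalIntegrable _ _)

lemma exp_mul_frankCdf {b x : ℝ} (hb : b ≠ 0) (hx : x ∈ Set.Icc (0 : ℝ) 1) (y : ℝ) :
    Real.exp (b * frankCdf b x y) = frankA b 1 / frankD b x y := by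
  have hD := frankD_pos hb hx y
  have hA := frankA_pos hb one_pos
  unfold frankCdf
  rw [mul_div_cancel₀ _ hb, Real.exp_neg, Real.exp_log (div_pos hD hA), inv_div]

lemma log_frankDensity {b x : ℝ} (hb : b ≠ 0) (hx : x ∈ Set.Icc (0 : ℝ) 1) (y : ℝ) :
    Real.log (frankDensity b x y) =
      -(b * x) - b * y - Real.log (expMean b) + 2 * (b * frankCdf b x y) := by
  have hD := frankD_pos hb hx y
  have hA := frankA_pos hb one_pos
  have h1 : b * frankCdf b x y = Real.log (frankA b 1) - Real.log (frankD b x y) := by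
    rw [← Real.log_div hA.ne' hD.ne', ← exp_mul_frankCdf hb hx, Real.log_exp]
  have h2 : frankA b 1 = expMean b := by simp [frankA_eq hb]
  unfold frankDensity
  rw [Real.log_div (by positivity) (by positivity), Real.log_mul (by positivity) (by positivity),
    Real.log_mul hA.ne' (by positivity), Real.log_exp, Real.log_exp, Real.log_pow, h1, ← h2]
  push_cast
  ring

/-- `∂C/∂x` is a function of `x` and `C` alone, which makes `C ∂²C/∂x∂y` integrable in closed
form with respect to `y`. -/
lemma frankCond_eq {b x : ℝ} (hb : b ≠ 0) (hx : x ∈ Set.Icc (0 : ℝ) 1) (hx0 : 0 < x) (y : ℝ) :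
    frankCond b x y = (Real.exp (b * frankCdf b x y) - 1) / (Real.exp (b * x) - 1) := by
  have hD := frankD_pos hb hx y
  have hA := frankA_pos hb hx0
  have h1 : Real.exp (b * x) - 1 = b * frankA b x * Real.exp (b * x) := by
    unfold frankA
    rw [Real.exp_neg]
    have := Real.exp_pos (b * x)
    field_simp
  rw [exp_mul_frankCdf hb hx, h1]
  unfold frankCond
  rw [Real.exp_neg]
  have := Real.exp_pos (b * x)
  have h2 : frankA b 1 / frankD b x y - 1 = b * frankA b x * frankA b y / frankD b x y := by
    field_simp
    unfold frankD
    ring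
  rw [h2]
  field_simp

/-- The mean of the distribution function over the conditional law of the second coordinate. An
antiderivative of `C ∂²C/∂x∂y` comes from `frankCond_eq`. -/
lemma integral_frankCdf_mul {b x : ℝ} (hb : b ≠ 0) (hx : x ∈ Set.Icc (0 : ℝ) 1) (hx0 : 0 < x) :
    ∫ y in (0 : ℝ)..1, frankDensity b x y * frankCdf b x y =
      x - 1 / b + Real.exp (-(b * x)) / expMean (b * x) / b := by
  set E : ℝ := Real.exp (b * x) - 1 with hE
  have hEne : E ≠ 0 := by
    rw [hE, sub_ne_zero, Ne, Real.exp_eq_one_iff]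
    exact mul_ne_zero hb hx0.ne'
  have hd : ∀ y ∈ Set.uIcc (0 : ℝ) 1, HasDerivAt (fun y => frankCdf b x y * frankCond b x y -
      ((Real.exp (b * frankCdf b x y) - 1) / b - frankCdf b x y) / E)
      (frankDensity b x y * frankCdf b x y) y := by
    intro y _
    have c1 := hasDerivAt_frankCdf hb hx y
    have c2 := hasDerivAt_frankCond hb hx y
    refine ((c1.mul c2).sub (((((c1.const_mul b).exp.sub_const 1).div_const b).sub
      c1).div_const E)).congr_deriv ?_
    rw [frankCond_eq hb hx hx0 y, ← hE]
    field_simp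
    ring
  have hcont : Continuous fun y => frankDensity b x y * frankCdf b x y :=
    (continuous_frankDensity hb hx).mul
      (continuous_iff_continuousAt.mpr fun y => (hasDerivAt_frankCdf hb hx y).continuousAt)
  rw [intervalIntegral.integral_eq_sub_of_hasDerivAt hd (hcont.intervalIntegrable _ _),
    frankCdf_zero hb, frankCdf_one hb, frankCond_one hb]
  have h1 : Real.exp (-(b * x)) / expMean (b * x) / b = x / E := by
    rw [expMean_eq (mul_ne_zero hb hx0.ne'), hE, Real.exp_neg]
    have hne : Real.exp (b * x) - 1 ≠ 0 := hEne
    have hne' : 1 - (Real.exp (b * x))⁻¹ ≠ 0 := by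
      rw [sub_ne_zero]
      intro h0
      have : Real.exp (b * x) = 1 := by rw [← inv_inv (Real.exp (b * x)), ← h0, inv_one]
      exact hne (by rw [this, sub_self])
    have := Real.exp_pos (b * x)
    field_simp
  rw [h1, ← hE]
  simp
  field_simp
  ring

/-- Integration by parts in `limitPressure b`: the derivative of `x ln (expMean (b x))` is
`ln (expMean (b x)) + e^{-bx} / expMean (b x) - 1`. -/
lemma log_expMean_eq {b : ℝ} (hb : b ≠ 0) :
    Real.log (expMean b) = limitPressure b +
      (∫ x in (0 : ℝ)..1, Real.exp (-(b * x)) / expMean (b * x)) - 1 := by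
  have c0 : Continuous fun x => Real.log (expMean (b * x)) :=
    continuous_log_expMean.comp (by fun_prop)
  have c1 : Continuous fun x => Real.exp (-(b * x)) / expMean (b * x) :=
    Continuous.div (by fun_prop) (continuous_expMean.comp (by fun_prop)) fun x => (expMean_pos _).ne'
  have hd : ∀ x ∈ Set.Ioo (0 : ℝ) 1, HasDerivAt (fun x => x * Real.log (expMean (b * x)))
      (Real.log (expMean (b * x)) + Real.exp (-(b * x)) / expMean (b * x) - 1) x := by
    intro x hx
    have hx0 : 0 < x := hx.1
    have hA := frankA_pos hb hx0
    have g1 := ((hasDerivAt_id x).mul ((hasDerivAt_frankA hb x).log hA.ne')).sub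
      (Real.hasDerivAt_mul_log hx0.ne')
    refine (g1.congr_of_eventuallyEq ?_).congr_deriv ?_
    · filter_upwards [lt_mem_nhds hx0] with u hu
      simp only [Pi.sub_apply, Pi.mul_apply, id]
      rw [frankA_eq hb, Real.log_mul hu.ne' (expMean_pos _).ne']
      ring
    · have e1 : frankA b x = x * expMean (b * x) := frankA_eq hb x
      simp only [id]
      rw [e1, Real.log_mul hx0.ne' (expMean_pos _).ne']
      have := expMean_pos (b * x)
      field_simp
      ring
  have key := intervalIntegral.integral_eq_sub_of_hasDerivAt_of_le zero_le_one
    (continuous_id.mul c0).continuousOn hd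
    (((c0.add c1).sub continuous_const).intervalIntegrable _ _)
  have hs : IntervalIntegrable (fun x => Real.log (expMean (b * x)) +
      Real.exp (-(b * x)) / expMean (b * x)) volume 0 1 := (c0.add c1).intervalIntegrable _ _
  rw [intervalIntegral.integral_sub hs
    (continuous_const.intervalIntegrable _ _), intervalIntegral.integral_add
    (c0.intervalIntegrable _ _) (c1.intervalIntegrable _ _)] at key
  simp only [Pi.mul_apply, id, mul_one, one_mul, zero_mul, sub_zero,
    intervalIntegral.integral_const, smul_eq_mul] at key
  rw [limitPressure]
  linarith

lemma integral_square_symm {g : Square → ℝ} (hg : Continuous g) :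
    ∫ z : Square, g z = ∫ y : unitInterval, ∫ x : unitInterval, g (x, y) := by
  rw [Measure.volume_eq_prod]
  exact integral_prod_symm _ (integrable_of_continuous hg)

lemma continuous_frankD_square (b : ℝ) :
    Continuous fun z : Square => frankD b (z.1 : ℝ) (z.2 : ℝ) := by
  have := continuous_frankA b
  unfold frankD
  fun_prop

lemma continuous_frankDensity_square {b : ℝ} (hb : b ≠ 0) :
    Continuous fun z : Square => frankDensity b (z.1 : ℝ) (z.2 : ℝ) := by
  unfold frankDensity
  exact Continuous.div (by fun_prop) ((continuous_frankD_square b).pow 2) fun z =>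
    pow_ne_zero 2 (frankD_pos hb z.1.2 z.2).ne'

lemma continuous_frankCdf_square {b : ℝ} (hb : b ≠ 0) :
    Continuous fun z : Square => frankCdf b (z.1 : ℝ) (z.2 : ℝ) := by
  unfold frankCdf
  exact (Continuous.log ((continuous_frankD_square b).div_const _) fun z =>
    (div_pos (frankD_pos hb z.1.2 z.2) (frankA_pos hb one_pos)).ne').neg.div_const b

lemma integral_frankDensity_right {b : ℝ} (hb : b ≠ 0) (x : unitInterval) :
    ∫ y : unitInterval, frankDensity b x y = 1 := by
  rw [integral_unitInterval (fun y => frankDensity b x y), integral_frankDensity hb x.2,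
    frankCond_one hb, frankCond_zero, sub_zero]

lemma integral_frankDensity_left {b : ℝ} (hb : b ≠ 0) (y : unitInterval) :
    ∫ x : unitInterval, frankDensity b x y = 1 := by
  simp only [fun x : unitInterval => frankDensity_comm b (x : ℝ) (y : ℝ)]
  exact integral_frankDensity_right hb y

lemma integral_frankDensity_mul_fst {b : ℝ} (hb : b ≠ 0) {g : unitInterval → ℝ}
    (hg : Continuous g) :
    ∫ z : Square, frankDensity b z.1 z.2 * g z.1 = ∫ x, g x := by
  have hc : Continuous fun z : Square => frankDensity b z.1 z.2 * g z.1 :=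
    (continuous_frankDensity_square hb).mul (hg.comp continuous_fst)
  rw [integral_square hc]
  refine integral_congr_ae (Eventually.of_forall fun x => ?_)
  simp only
  rw [integral_mul_const, integral_frankDensity_right hb, one_mul]

lemma integral_frankDensity_mul_snd {b : ℝ} (hb : b ≠ 0) {g : unitInterval → ℝ}
    (hg : Continuous g) :
    ∫ z : Square, frankDensity b z.1 z.2 * g z.2 = ∫ x, g x := by
  have hc : Continuous fun z : Square => frankDensity b z.1 z.2 * g z.2 :=
    (continuous_frankDensity_square hb).mul (hg.comp continuous_snd)
  rw [integral_square_symm hc]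
  refine integral_congr_ae (Eventually.of_forall fun x => ?_)
  simp only
  rw [integral_mul_const, integral_frankDensity_left hb, one_mul]

lemma integral_coe_unitInterval : ∫ x : unitInterval, (x : ℝ) = 1 / 2 := by
  rw [integral_unitInterval (fun x => x)]
  norm_num

/-- The mass of the points in inversion with `(x, y)`: those to the left and above, and those to the
right and below. -/
lemma integral_frankDensity_mul_h {b : ℝ} (hb : b ≠ 0) (z : Square) :
    ∫ w : Square, frankDensity b w.1 w.2 * h z w =
      (z.1 : ℝ) + z.2 - 2 * frankCdf b z.1 z.2 := by
  obtain ⟨x, y⟩ := z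
  have hint : Integrable (fun w : Square => frankDensity b w.1 w.2 * h (x, y) w) volume := by
    refine (integrable_of_continuous (continuous_frankDensity_square hb)).mul_bdd
      (c := 1) ?_ (Eventually.of_forall fun w => ?_)
    · exact (measurable_h.comp (by fun_prop : Measurable fun w : Square =>
        (((x, y) : Square), w))).aestronglyMeasurable
    · rw [Real.norm_eq_abs, abs_of_nonneg (h_nonneg _ _)]
      exact h_le_one _ _
  rw [Measure.volume_eq_prod] at hint ⊢
  rw [integral_prod _ hint]
  have hinner : ∀ x' : unitInterval, ∫ y' : unitInterval,
      frankDensity b (x', y').1 (x', y').2 * h (x, y) (x', y') =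
      (if x' < x then 1 - frankCond b x' y else 0) + if x < x' then frankCond b x' y else 0 := by
    intro x'
    rcases lt_trichotomy x' x with hlt | heq | hgt
    · have h1 : ∀ y' : unitInterval, frankDensity b (x', y').1 (x', y').2 * h (x, y) (x', y') =
          if y < y' then frankDensity b x' y' else 0 := by
        intro y'
        have hpos : (0 : ℝ) < (x : ℝ) - x' := sub_pos.mpr hlt
        rw [h_eq_ite]
        simp [mul_neg_iff, hpos, hpos.not_gt]
      simp only [h1]
      rw [integral_unitInterval_Ioi (fun v => frankDensity b x' v), integral_frankDensity hb x'.2,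
        frankCond_one hb, if_pos hlt, if_neg hlt.not_gt, add_zero]
    · simp [heq, h_eq_ite]
    · have h1 : ∀ y' : unitInterval, frankDensity b (x', y').1 (x', y').2 * h (x, y) (x', y') =
          if y' < y then frankDensity b x' y' else 0 := by
        intro y'
        have hneg : (x : ℝ) - x' < 0 := sub_neg.mpr hgt
        rw [h_eq_ite]
        simp [mul_neg_iff, hneg, hneg.not_gt]
      simp only [h1]
      rw [integral_unitInterval_Iio (fun v => frankDensity b x' v), integral_frankDensity hb x'.2,
        frankCond_zero, if_pos hgt, if_neg hgt.not_gt, zero_add, sub_zero]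
  rw [integral_congr_ae (Eventually.of_forall hinner)]
  have hc : Continuous fun x' : unitInterval => frankCond b x' y :=
    (continuous_frankCond hb y.2).comp continuous_subtype_val
  have i1 : Integrable (fun x' : unitInterval => if x' < x then 1 - frankCond b x' y else 0) := by
    have := (integrable_of_continuous (μ := volume) (continuous_const.sub hc :
      Continuous fun x' : unitInterval => 1 - frankCond b x' y)).indicator
        (measurableSet_Iio (a := x))
    refine this.congr (Eventually.of_forall fun x' => ?_)
    simp [Set.indicator_apply]
  have i2 : Integrable (fun x' : unitInterval => if x < x' then frankCond b x' y else 0) := by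
    have := (integrable_of_continuous (μ := volume) hc).indicator
        (measurableSet_Ioi (a := x))
    refine this.congr (Eventually.of_forall fun x' => ?_)
    simp [Set.indicator_apply]
  rw [integral_add i1 i2, integral_unitInterval_Iio (fun v => 1 - frankCond b v y),
    integral_unitInterval_Ioi (fun v => frankCond b v y),
    intervalIntegral.integral_sub (continuous_const.intervalIntegrable _ _)
      ((continuous_frankCond hb y.2).intervalIntegrable _ _),
    integral_frankCond hb y.2, integral_frankCond hb y.2, frankCdf_comm b 0, frankCdf_zero hb,
    frankCdf_comm b 1, frankCdf_one hb]
  simp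
  ring

/-- The Frank copula attains equality in Gibbs' variational inequality. -/
lemma frank_value {b : ℝ} (hb : b ≠ 0) :
    (∫ z : Square, frankDensity b z.1 z.2 * Real.log (frankDensity b z.1 z.2)) +
      b / 2 * (∫ z : Square, frankDensity b z.1 z.2 *
        ∫ w : Square, frankDensity b w.1 w.2 * h z w) = -limitPressure b := by
  have cd := continuous_frankDensity_square hb
  have cC := continuous_frankCdf_square hb
  have c1 : Continuous fun z : Square => (z.1 : ℝ) := by fun_prop
  have c2 : Continuous fun z : Square => (z.2 : ℝ) := by fun_prop
  have clog : Continuous fun z : Square =>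
      frankDensity b z.1 z.2 * Real.log (frankDensity b z.1 z.2) :=
    cd.mul (cd.log fun z => (frankDensity_pos hb z.1.2 z.2).ne')
  have ch : Continuous fun z : Square =>
      frankDensity b z.1 z.2 * ((z.1 : ℝ) + z.2 - 2 * frankCdf b z.1 z.2) :=
    cd.mul ((c1.add c2).sub (continuous_const.mul cC))
  simp only [integral_frankDensity_mul_h hb]
  rw [← integral_const_mul, ← integral_add (integrable_of_continuous clog)
    ((integrable_of_continuous ch).const_mul _)]
  have hpt : ∀ z : Square, frankDensity b z.1 z.2 * Real.log (frankDensity b z.1 z.2) +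
      b / 2 * (frankDensity b z.1 z.2 * ((z.1 : ℝ) + z.2 - 2 * frankCdf b z.1 z.2)) =
      frankDensity b z.1 z.2 * (-(b / 2) * (z.1 : ℝ) - Real.log (expMean b)) +
      frankDensity b z.1 z.2 * (-(b / 2) * (z.2 : ℝ)) +
      b * (frankDensity b z.1 z.2 * frankCdf b z.1 z.2) := by
    intro z
    rw [log_frankDensity hb z.1.2]
    ring
  simp only [hpt]
  have g1 : Continuous fun x : unitInterval => -(b / 2) * (x : ℝ) - Real.log (expMean b) := by
    fun_prop
  have g2 : Continuous fun x : unitInterval => -(b / 2) * (x : ℝ) := by fun_prop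
  have I1 := integrable_of_continuous (μ := volume) (cd.mul (g1.comp continuous_fst))
  have I2 := integrable_of_continuous (μ := volume) (cd.mul (g2.comp continuous_snd))
  have I3 := integrable_of_continuous (μ := volume) (cd.mul cC)
  have I12 : Integrable (fun z : Square =>
      frankDensity b z.1 z.2 * (-(b / 2) * (z.1 : ℝ) - Real.log (expMean b)) +
      frankDensity b z.1 z.2 * (-(b / 2) * (z.2 : ℝ))) volume := I1.add I2
  have I1' : Integrable (fun z : Square =>
      frankDensity b z.1 z.2 * (-(b / 2) * (z.1 : ℝ) - Real.log (expMean b))) volume := I1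
  have I2' : Integrable (fun z : Square =>
      frankDensity b z.1 z.2 * (-(b / 2) * (z.2 : ℝ))) volume := I2
  have I3' : Integrable (fun z : Square =>
      b * (frankDensity b z.1 z.2 * frankCdf b z.1 z.2)) volume := I3.const_mul b
  rw [integral_add I12 I3', integral_add I1' I2',
    integral_frankDensity_mul_fst hb g1, integral_frankDensity_mul_snd hb g2, integral_const_mul b]
  have J1 : ∫ z : Square, frankDensity b z.1 z.2 * frankCdf b z.1 z.2 =
      ∫ x in (0 : ℝ)..1, (x - 1 / b + Real.exp (-(b * x)) / expMean (b * x) / b) := by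
    have cdC : Continuous fun z : Square => frankDensity b z.1 z.2 * frankCdf b z.1 z.2 :=
      cd.mul cC
    rw [integral_square cdC, ← integral_unitInterval
      (fun x => x - 1 / b + Real.exp (-(b * x)) / expMean (b * x) / b)]
    refine integral_congr_ae ?_
    filter_upwards [Measure.ae_ne volume (0 : unitInterval)] with x hx
    have hx0 : (0 : ℝ) < x := lt_of_le_of_ne x.2.1 fun h0 => hx (Subtype.ext h0.symm)
    rw [← integral_frankCdf_mul hb x.2 hx0]
    exact integral_unitInterval (fun y => frankDensity b x y * frankCdf b x y)
  have cE : Continuous fun x : ℝ => Real.exp (-(b * x)) / expMean (b * x) :=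
    Continuous.div (by fun_prop) (continuous_expMean.comp (by fun_prop)) fun x => (expMean_pos _).ne'
  have K1 : IntervalIntegrable (fun x : ℝ => x - 1 / b) volume 0 1 :=
    Continuous.intervalIntegrable (by fun_prop) _ _
  rw [J1, intervalIntegral.integral_add K1 ((cE.div_const b).intervalIntegrable _ _),
    intervalIntegral.integral_sub (Continuous.intervalIntegrable (by fun_prop) _ _)
      (continuous_const.intervalIntegrable _ _), intervalIntegral.integral_div b
      (fun x => Real.exp (-(b * x)) / expMean (b * x))]
  have K2 : Integrable (fun x : unitInterval => -(b / 2) * (x : ℝ)) volume :=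
    integrable_of_continuous g2
  rw [integral_sub K2 (integrable_const _), integral_const_mul, integral_coe_unitInterval]
  have := log_expMean_eq hb
  rw [this]
  simp only [integral_const, probReal_univ, integral_id, intervalIntegral.integral_const, smul_eq_mul]
  field_simp
  ring

/-- For every `b` there is a copula, with density bounded above and below, that attains equality in
Gibbs' variational inequality. -/
theorem exists_optimal_copula (b : ℝ) : ∃ c : Square → ℝ, Continuous c ∧ (∀ z, 0 < c z) ∧
    (∀ x, ∫ y, c (x, y) = 1) ∧ (∀ y, ∫ x, c (x, y) = 1) ∧
    (∫ z, Real.log (c z) ∂(volume.withDensity fun z => ENNReal.ofReal (c z))) +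
      b / 2 * crossInv (volume.withDensity fun z => ENNReal.ofReal (c z))
        (volume.withDensity fun z => ENNReal.ofReal (c z)) = -limitPressure b := by
  by_cases hb : b = 0
  · refine ⟨fun _ => 1, continuous_const, fun _ => one_pos, by simp, by simp, ?_⟩
    simp [hb, limitPressure]
  · have hc := continuous_frankDensity_square hb
    have hpos : ∀ z : Square, 0 < frankDensity b z.1 z.2 := fun z => frankDensity_pos hb z.1.2 z.2
    refine ⟨fun z => frankDensity b z.1 z.2, hc, hpos, integral_frankDensity_right hb,
      integral_frankDensity_left hb, ?_⟩
    rw [← frank_value hb, integral_density hc.measurable (fun z => (hpos z).le), crossInv,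
      integral_density hc.measurable (fun z => (hpos z).le)]
    simp only [integral_density hc.measurable (fun z => (hpos z).le)]

/-! ### The probability integral transform -/

lemma continuous_measureReal_Iic (m : Measure unitInterval) [IsFiniteMeasure m]
    [NullSingletonClass m] : Continuous fun x => m.real (Set.Iic x) := by
  have h1 : (fun x => m.real (Set.Iic x)) =
      fun x => ∫ v, (Set.Iic x).indicator (fun _ => (1 : ℝ)) v ∂m := by
    funext x
    rw [integral_indicator measurableSet_Iic]
    simp
  rw [h1, continuous_iff_continuousAt]
  intro x₀
  refine continuousAt_of_dominated (bound := fun _ => (1 : ℝ)) ?_ ?_ (integrable_const _) ?_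
  · exact Eventually.of_forall fun x =>
      (measurable_const.indicator measurableSet_Iic).aestronglyMeasurable
  · refine Eventually.of_forall fun x => Eventually.of_forall fun v => ?_
    simp only [Set.indicator_apply]
    split_ifs <;> simp
  · filter_upwards [Measure.ae_ne m x₀] with v hv
    rcases lt_or_gt_of_ne hv with hlt | hgt
    · refine (continuousAt_const (y := (1 : ℝ))).congr ?_
      filter_upwards [lt_mem_nhds hlt] with x hx
      rw [Set.indicator_of_mem (Set.mem_Iic.mpr hx.le)]
    · refine (continuousAt_const (y := (0 : ℝ))).congr ?_
      filter_upwards [gt_mem_nhds hgt] with x hx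
      rw [Set.indicator_of_notMem (Set.notMem_Iic.mpr hx)]

/-- The distribution function of a probability measure on the unit interval. -/
def cdfMap (α : Measure unitInterval) [IsProbabilityMeasure α] (x : unitInterval) : unitInterval :=
  ⟨α.real (Set.Iic x), measureReal_nonneg, measureReal_le_one⟩

section

variable (α : Measure unitInterval) [IsProbabilityMeasure α]

lemma monotone_cdfMap : Monotone (cdfMap α) := fun _ _ hxy =>
  Subtype.mk_le_mk.mpr (measureReal_mono (Set.Iic_subset_Iic.mpr hxy))

variable [NullSingletonClass α]

lemma continuous_cdfMap : Continuous (cdfMap α) :=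
  (continuous_measureReal_Iic α).subtype_mk _

lemma map_cdfMap : α.map (cdfMap α) = volume := by
  have hm := (continuous_cdfMap α).measurable
  have : IsProbabilityMeasure (α.map (cdfMap α)) := Measure.isProbabilityMeasure_map hm.aemeasurable
  refine Measure.ext_of_Iic _ _ fun u => ?_
  rw [Measure.map_apply hm measurableSet_Iic, unitInterval.volume_Iic]
  -- the largest `x` with `cdf x ≤ u` satisfies `cdf x = u`
  have h0 : cdfMap α 0 ≤ u := by
    have : cdfMap α 0 = 0 := by
      apply Subtype.ext
      have h1 : Set.Iic (0 : unitInterval) = {0} := by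
        ext x; simp
      simp [cdfMap, h1, measureReal_def]
    rw [this]; exact u.2.1
  have h1 : u ≤ cdfMap α 1 := by
    have : cdfMap α 1 = 1 := by
      apply Subtype.ext
      have h1 : Set.Iic (1 : unitInterval) = Set.univ := by
        ext x
        simp only [Set.mem_Iic, Set.mem_univ, iff_true]
        exact x.2.2
      simp [cdfMap, h1]
    rw [this]; exact u.2.2
  obtain ⟨x₁, hx₁⟩ := mem_range_of_exists_le_of_exists_ge (continuous_cdfMap α) ⟨0, h0⟩ ⟨1, h1⟩
  have hclosed : IsCompact (cdfMap α ⁻¹' Set.Iic u) :=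
    (isClosed_Iic.preimage (continuous_cdfMap α)).isCompact
  obtain ⟨x₀, hx₀, hmax⟩ := hclosed.exists_isGreatest ⟨0, h0⟩
  have hS : cdfMap α ⁻¹' Set.Iic u = Set.Iic x₀ := by
    ext x
    refine ⟨fun hx => hmax hx, fun hx => ?_⟩
    exact (monotone_cdfMap α hx).trans hx₀
  have hval : cdfMap α x₀ = u :=
    le_antisymm hx₀ (hx₁ ▸ monotone_cdfMap α (hmax (show cdfMap α x₁ ≤ u from hx₁.le)))
  rw [hS, ← ofReal_measureReal]
  congr 1
  exact congrArg Subtype.val hval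

end

/-- Under `m` the distribution function of `m` is uniform on `[0, m(univ)]`. -/
lemma integral_comp_cdf (m : Measure unitInterval) [IsFiniteMeasure m] [NullSingletonClass m]
    {g : ℝ → ℝ} (hg : Continuous g) :
    ∫ x, g (m.real (Set.Iic x)) ∂m = ∫ u in (0 : ℝ)..(m.real Set.univ), g u := by
  set s := m.real Set.univ with hs
  have hs0 : 0 ≤ s := measureReal_nonneg
  rcases hs0.eq_or_lt with h0 | h0
  · have : m = 0 := by
      rw [eq_comm, hs, measureReal_eq_zero_iff, Measure.measure_univ_eq_zero] at h0
      exact h0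
    rw [← h0, this]
    simp
  have hms : m Set.univ = ENNReal.ofReal s := by rw [hs, ofReal_measureReal]
  have hp := isProbabilityMeasure_smul_ofReal_inv h0 hms
  set α := ENNReal.ofReal s⁻¹ • m with hα
  have hn : NullSingletonClass α := ⟨fun x => by simp [hα]⟩
  have hm : m = ENNReal.ofReal s • α := by
    rw [hα, smul_smul, ← ENNReal.ofReal_mul hs0, mul_inv_cancel₀ h0.ne', ENNReal.ofReal_one,
      one_smul]
  have h1 : ∀ x, m.real (Set.Iic x) = s * (cdfMap α x : ℝ) := by
    intro x
    conv_lhs => rw [hm]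
    rw [measureReal_ennreal_smul_apply, ENNReal.toReal_ofReal hs0]
    rfl
  simp only [h1]
  rw [hm, integral_smul_measure, ENNReal.toReal_ofReal hs0]
  have h2 := integral_map (μ := α) (continuous_cdfMap α).measurable.aemeasurable
    (f := fun u : unitInterval => g (s * u))
    (by
      have : Continuous fun u : unitInterval => g (s * u) := by fun_prop
      exact this.measurable.aestronglyMeasurable)
  rw [map_cdfMap] at h2
  rw [← h2, integral_unitInterval (fun u => g (s * u))]
  simp

/-! ### Splitting a strip in two -/

lemma nullSingletonClass_of_le {X : Type*} [MeasurableSpace X] {κ m : Measure X}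
    [NullSingletonClass m] (hle : κ ≤ m) : NullSingletonClass κ :=
  ⟨fun x => le_antisymm ((hle {x}).trans (measure_singleton x).le) bot_le⟩

lemma eq_zero_of_measureReal_univ {X : Type*} [MeasurableSpace X] {κ : Measure X}
    [IsFiniteMeasure κ] (h0 : κ.real Set.univ = 0) : κ = 0 := by
  rwa [measureReal_eq_zero_iff, Measure.measure_univ_eq_zero] at h0

lemma le_logistic {b c s u : ℝ} (hu : u ∈ Set.Icc 0 s) :
    1 / (1 + Real.exp (|b| * s + |c|)) ≤ logistic b c u := by
  unfold logistic
  gcongr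
  have h1 : b * u ≤ |b| * s := by
    calc b * u ≤ |b| * u := mul_le_mul_of_nonneg_right (le_abs_self b) hu.1
      _ ≤ _ := mul_le_mul_of_nonneg_left hu.2 (abs_nonneg b)
  linarith [neg_abs_le c]

lemma one_sub_logistic (b c u : ℝ) : 1 - logistic b c u = logistic (-b) (-c) u := by
  unfold logistic
  have : Real.exp (-b * u - -c) = (Real.exp (b * u - c))⁻¹ := by
    rw [← Real.exp_neg]; ring_nf
  rw [this]
  have := Real.exp_pos (b * u - c)
  field_simp
  ring

/-- A strip whose points have projection `m` is split in two parts of masses `t 0` and `t 1`. There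
are local proportions `r` for which entropy plus interaction takes the value `splitCost` for every
splitting `κ`: the choice of `r` linearizes the interaction. -/
theorem exists_split_profile (b : ℝ) (m : Measure unitInterval) [IsFiniteMeasure m]
    [NullSingletonClass m] (t : Fin 2 → ℝ) (ht : ∀ j, 0 ≤ t j)
    (hm : m.real Set.univ = t 0 + t 1) :
    ∃ r : Fin 2 → unitInterval → ℝ, (∀ j, Measurable (r j)) ∧ (∀ j x, 0 ≤ r j x) ∧
      (∀ x, r 0 x + r 1 x = 1) ∧ (∀ j, 0 < t j → ∃ ε > 0, ∀ x, ε ≤ r j x) ∧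
      (∀ j, ∫ x, r j x ∂m = t j) ∧
      ∀ κ : Fin 2 → Measure unitInterval, κ 0 + κ 1 = m → (∀ j, (κ j).real Set.univ = t j) →
        ∑ j, ∫ x, Real.log (r j x) ∂(κ j) + b * ∫ x, (κ 1).real (Set.Iio x) ∂(κ 0) =
          splitCost b (t 0) (t 1) := by
  have hfin : ∀ κ : Fin 2 → Measure unitInterval, κ 0 + κ 1 = m →
      ∀ j, IsFiniteMeasure (κ j) ∧ κ j ≤ m := by
    intro κ hκ j
    have hle : κ j ≤ m := by
      rw [← hκ]
      fin_cases j
      · exact Measure.le_add_right le_rfl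
      · exact Measure.le_add_left le_rfl
    exact ⟨isFiniteMeasure_of_le m hle, hle⟩
  by_cases h0 : t 0 = 0
  · refine ⟨![fun _ => 0, fun _ => 1], ?_, ?_, ?_, ?_, ?_, ?_⟩
    · intro j; fin_cases j <;> exact measurable_const
    · intro j x; fin_cases j <;> simp
    · intro x; simp
    · intro j hj
      fin_cases j
      · exact absurd h0 hj.ne'
      · exact ⟨1, one_pos, fun x => by simp⟩
    · intro j
      fin_cases j
      · simp [h0]
      · simp [hm, h0]
    · intro κ hκ hκt
      have := (hfin κ hκ 0).1
      have hz : κ 0 = 0 := eq_zero_of_measureReal_univ ((hκt 0).trans h0)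
      simp [hz, h0, splitCost]
  by_cases h1 : t 1 = 0
  · refine ⟨![fun _ => 1, fun _ => 0], ?_, ?_, ?_, ?_, ?_, ?_⟩
    · intro j; fin_cases j <;> exact measurable_const
    · intro j x; fin_cases j <;> simp
    · intro x; simp
    · intro j hj
      fin_cases j
      · exact ⟨1, one_pos, fun x => by simp⟩
      · exact absurd h1 hj.ne'
    · intro j
      fin_cases j
      · simp [hm, h1]
      · simp [h1]
    · intro κ hκ hκt
      have := (hfin κ hκ 1).1
      have hz : κ 1 = 0 := eq_zero_of_measureReal_univ ((hκt 1).trans h1)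
      simp [hz, h1, splitCost]
  have p0 : 0 < t 0 := lt_of_le_of_ne (ht 0) (Ne.symm h0)
  have p1 : 0 < t 1 := lt_of_le_of_ne (ht 1) (Ne.symm h1)
  obtain ⟨c, hc⟩ := exists_logisticMass_eq b p0 p1
  set M : unitInterval → ℝ := fun x => m.real (Set.Iic x) with hM
  have hMc : Continuous M := continuous_measureReal_Iic m
  have hMr : ∀ x, M x ∈ Set.Icc 0 (t 0 + t 1) := fun x =>
    ⟨measureReal_nonneg, hm ▸ measureReal_mono (Set.subset_univ _)⟩
  have hlc : Continuous fun x => logistic b c (M x) := (continuous_logistic b c).comp hMc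
  have hI0 : ∫ x, logistic b c (M x) ∂m = t 0 := by
    rw [hM, integral_comp_cdf m (continuous_logistic b c), hm]
    exact hc
  refine ⟨![fun x => logistic b c (M x), fun x => 1 - logistic b c (M x)], ?_, ?_, ?_, ?_, ?_, ?_⟩
  · intro j
    fin_cases j
    · exact hlc.measurable
    · exact (continuous_const.sub hlc).measurable
  · intro j x
    fin_cases j
    · exact (logistic_pos b c (M x)).le
    · exact sub_nonneg.mpr (logistic_lt_one b c (M x)).le
  · intro x; simp
  · intro j _
    refine ⟨1 / (1 + Real.exp (|b| * (t 0 + t 1) + |c|)), by positivity, fun x => ?_⟩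
    fin_cases j
    · exact le_logistic (hMr x)
    · have := le_logistic (b := -b) (c := -c) (hMr x)
      rw [abs_neg, abs_neg] at this
      simpa [one_sub_logistic] using this
  · intro j
    fin_cases j
    · exact hI0
    · simp only [Fin.mk_one, Matrix.cons_val_one, Matrix.cons_val_zero]
      rw [integral_sub (integrable_const _) (integrable_of_continuous hlc), hI0]
      simp [hm]
  · intro κ hκ hκt
    obtain ⟨f0, le0⟩ := hfin κ hκ 0
    obtain ⟨f1, le1⟩ := hfin κ hκ 1
    have n0 := nullSingletonClass_of_le le0
    have n1 := nullSingletonClass_of_le le1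
    set L : ℝ → ℝ := fun u => Real.log (1 + Real.exp (c - b * u)) with hL
    have hLc : Continuous L := Continuous.log (by fun_prop) fun u => by positivity
    have hLM : Continuous fun x => L (M x) := hLc.comp hMc
    have iM : ∀ κ' : Measure unitInterval, IsFiniteMeasure κ' → Integrable M κ' :=
      fun κ' _ => integrable_of_continuous hMc
    have iL : ∀ κ' : Measure unitInterval, IsFiniteMeasure κ' →
        Integrable (fun x => L (M x)) κ' := fun κ' _ => integrable_of_continuous hLM
    have e0 : ∫ x, Real.log (logistic b c (M x)) ∂(κ 0) =
        c * t 0 - b * ∫ x, M x ∂(κ 0) - ∫ x, L (M x) ∂(κ 0) := by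
      simp only [log_logistic]
      have i1 : Integrable (fun x => c - b * M x) (κ 0) :=
        (integrable_const c).sub ((iM _ f0).const_mul b)
      rw [integral_sub i1 (iL _ f0), integral_sub (integrable_const c) ((iM _ f0).const_mul b),
        integral_const_mul, integral_const, hκt 0, smul_eq_mul, mul_comm (t 0)]
    have e1 : ∫ x, Real.log (1 - logistic b c (M x)) ∂(κ 1) = -∫ x, L (M x) ∂(κ 1) := by
      simp only [log_one_sub_logistic]
      rw [integral_neg]
    have e2 : ∫ x, L (M x) ∂(κ 0) + ∫ x, L (M x) ∂(κ 1) = ∫ u in (0 : ℝ)..(t 0 + t 1), L u := by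
      rw [← integral_add_measure (iL _ f0) (iL _ f1), hκ, ← hm]
      exact integral_comp_cdf m hLc
    -- the interaction of `κ 0` with itself depends on its mass only, whence `κ 1` may be replaced
    -- by `m`
    have e3 : ∫ x, (κ 1).real (Set.Iio x) ∂(κ 0) = ∫ x, M x ∂(κ 0) - t 0 ^ 2 / 2 := by
      have h2 : ∀ x, (κ 1).real (Set.Iio x) = M x - (κ 0).real (Set.Iic x) := by
        intro x
        rw [measureReal_congr Iio_ae_eq_Iic]
        simp only [hM]
        rw [← hκ, measureReal_add_apply]
        ring
      simp only [h2]
      rw [integral_sub (iM _ f0)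
        (integrable_of_continuous (continuous_measureReal_Iic (κ 0))),
        integral_comp_cdf (κ 0) (g := fun u => u) continuous_id, hκt 0]
      simp
    have hv := logistic_value b c (add_pos p0 p1)
    rw [hc, add_sub_cancel_left] at hv
    rw [Fin.sum_univ_two]
    simp only [Matrix.cons_val_zero, Matrix.cons_val_one]
    rw [e0, e1, e3, ← hv, ← e2]
    ring

/-! ### Optimal densities for general marginals -/

lemma map_fst_withDensity {X Y : Type*} [MeasurableSpace X] [MeasurableSpace Y] (α : Measure X)
    (γ : Measure Y) [SFinite α] [SFinite γ] {F : X × Y → ENNReal} (hF : Measurable F)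
    (h1 : ∀ x, ∫⁻ y, F (x, y) ∂γ = 1) : ((α.prod γ).withDensity F).map Prod.fst = α := by
  ext s hs
  rw [Measure.map_apply measurable_fst hs, withDensity_apply _ (measurable_fst hs),
    ← lintegral_indicator (measurable_fst hs), lintegral_prod _
      (hF.indicator (measurable_fst hs)).aemeasurable]
  have h2 : ∀ x, ∫⁻ y, (Prod.fst ⁻¹' s).indicator F (x, y) ∂γ = s.indicator (fun _ => 1) x := by
    intro x
    by_cases hx : x ∈ s
    · rw [Set.indicator_of_mem hx, ← h1 x]
      exact lintegral_congr fun y => Set.indicator_of_mem (by exact hx) _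
    · rw [Set.indicator_of_notMem hx, ← lintegral_zero (μ := γ)]
      exact lintegral_congr fun y => Set.indicator_of_notMem (by exact hx) _
  simp only [h2]
  rw [lintegral_indicator hs]
  simp

lemma map_snd_withDensity {X Y : Type*} [MeasurableSpace X] [MeasurableSpace Y] (α : Measure X)
    (γ : Measure Y) [SFinite α] [SFinite γ] {F : X × Y → ENNReal} (hF : Measurable F)
    (h1 : ∀ y, ∫⁻ x, F (x, y) ∂α = 1) : ((α.prod γ).withDensity F).map Prod.snd = γ := by
  ext s hs
  rw [Measure.map_apply measurable_snd hs, withDensity_apply _ (measurable_snd hs),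
    ← lintegral_indicator (measurable_snd hs), lintegral_prod_symm _
      (hF.indicator (measurable_snd hs)).aemeasurable]
  have h2 : ∀ y, ∫⁻ x, (Prod.snd ⁻¹' s).indicator F (x, y) ∂α = s.indicator (fun _ => 1) y := by
    intro y
    by_cases hy : y ∈ s
    · rw [Set.indicator_of_mem hy, ← h1 y]
      exact lintegral_congr fun x => Set.indicator_of_mem (by exact hy) _
    · rw [Set.indicator_of_notMem hy, ← lintegral_zero (μ := α)]
      exact lintegral_congr fun x => Set.indicator_of_notMem (by exact hy) _
  simp only [h2]
  rw [lintegral_indicator hs]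
  simp

lemma map_withDensity_comp {X Y : Type*} [MeasurableSpace X] [MeasurableSpace Y] {μ : Measure X}
    {T : X → Y} (hT : Measurable T) {F : Y → ENNReal} (hF : Measurable F) :
    (μ.withDensity fun x => F (T x)).map T = (μ.map T).withDensity F := by
  ext s hs
  rw [Measure.map_apply hT hs, withDensity_apply _ (hT hs), withDensity_apply _ hs,
    setLIntegral_map hs hF hT]

/-- Inversions are preserved by a monotone change of coordinates whose image law is atomless. -/
lemma crossInv_map {ν : Measure Square} [IsFiniteMeasure ν] {A G : unitInterval → unitInterval}
    (hA : Monotone A) (hG : Monotone G)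
    (h1 : ∀ x, ν {w | A w.1 = x} = 0) (h2 : ∀ y, ν {w | G w.2 = y} = 0) :
    crossInv (ν.map (Prod.map A G)) (ν.map (Prod.map A G)) = crossInv ν ν := by
  have hT : Measurable (Prod.map A G) := hA.measurable.prodMap hG.measurable
  have hfin : IsFiniteMeasure (ν.map (Prod.map A G)) := inferInstance
  unfold crossInv
  rw [integral_map hT.aemeasurable]
  · refine integral_congr_ae (Eventually.of_forall fun z => ?_)
    simp only
    rw [integral_map hT.aemeasurable]
    · refine integral_congr_ae ?_
      have a1 : ∀ᵐ w ∂ν, A w.1 ≠ A z.1 := measure_eq_zero_iff_ae_notMem.mp (h1 (A z.1))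
      have a2 : ∀ᵐ w ∂ν, G w.2 ≠ G z.2 := measure_eq_zero_iff_ae_notMem.mp (h2 (G z.2))
      filter_upwards [a1, a2] with w w1 w2
      have key : ∀ {B : unitInterval → unitInterval}, Monotone B → ∀ {u v : unitInterval},
          B v ≠ B u → ((0 < (u : ℝ) - v ↔ 0 < (B u : ℝ) - B v) ∧
            ((u : ℝ) - v < 0 ↔ (B u : ℝ) - B v < 0)) := by
        intro B hB u v huv
        rcases lt_trichotomy u v with hlt | heq | hgt
        · have hB' : B u < B v := lt_of_le_of_ne (hB hlt.le) huv.symm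
          have e1 : (u : ℝ) < v := hlt
          have e2 : (B u : ℝ) < B v := hB'
          constructor <;> constructor <;> intro <;> linarith
        · exact absurd (heq ▸ rfl) huv
        · have hB' : B v < B u := lt_of_le_of_ne (hB hgt.le) huv
          have e1 : (v : ℝ) < u := hgt
          have e2 : (B v : ℝ) < B u := hB'
          constructor <;> constructor <;> intro <;> linarith
      obtain ⟨k1, k2⟩ := key hA w1
      obtain ⟨k3, k4⟩ := key hG w2
      rw [h_eq_ite, h_eq_ite]
      simp only [Prod.map_fst, Prod.map_snd, mul_neg_iff, k1, k2, k3, k4]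
    · exact (measurable_h.comp (by fun_prop :
        Measurable fun w : Square => (Prod.map A G z, w))).aestronglyMeasurable
  · exact (measurable_h.stronglyMeasurable.integral_prod_right).aestronglyMeasurable

lemma lintegral_ofReal_eq_one {X : Type*} [MeasurableSpace X] {μ : Measure X} {g : X → ℝ}
    (h0 : ∀ x, 0 ≤ g x) (h1 : ∫ x, g x ∂μ = 1) : ∫⁻ x, ENNReal.ofReal (g x) ∂μ = 1 := by
  have hi : Integrable g μ := by
    by_contra hni
    rw [integral_undef hni] at h1
    exact zero_ne_one h1
  rw [← ofReal_integral_eq_lintegral_ofReal hi (Eventually.of_forall h0), h1, ENNReal.ofReal_one]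

/-- Equality in Gibbs' variational inequality is attained, for all atomless marginals of mass `t`:
transport the optimal copula by the distribution functions. -/
theorem exists_optimal_density (b : ℝ) {t : ℝ} (ht : 0 ≤ t) (α γ : Measure unitInterval)
    [NullSingletonClass α] [NullSingletonClass γ] [IsFiniteMeasure α] [IsFiniteMeasure γ]
    (hα : α Set.univ = ENNReal.ofReal t) (hγ : γ Set.univ = ENNReal.ofReal t) :
    ∃ f : Square → ℝ, Measurable f ∧ (∃ ε > 0, ∀ z, ε ≤ f z) ∧ (∃ K, ∀ z, f z ≤ K) ∧
      ((α.prod γ).withDensity fun z => ENNReal.ofReal (f z)).map Prod.fst = α ∧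
      ((α.prod γ).withDensity fun z => ENNReal.ofReal (f z)).map Prod.snd = γ ∧
      ∫ z, Real.log (t * f z) ∂((α.prod γ).withDensity fun z => ENNReal.ofReal (f z)) +
        b / 2 * crossInv ((α.prod γ).withDensity fun z => ENNReal.ofReal (f z))
          ((α.prod γ).withDensity fun z => ENNReal.ofReal (f z)) = -pressurePrimitive b t := by
  rcases ht.eq_or_lt with rfl | ht0
  · rw [ENNReal.ofReal_zero, Measure.measure_univ_eq_zero] at hα hγ
    refine ⟨fun _ => 1, measurable_const, ⟨1, one_pos, fun _ => le_rfl⟩, ⟨1, fun _ => le_rfl⟩, ?_⟩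
    simp [hα, hγ, crossInv]
  obtain ⟨c, hc, hcpos, hc1, hc2, hcv⟩ := exists_optimal_copula (b * t)
  have iα := isProbabilityMeasure_smul_ofReal_inv ht0 hα
  have iγ := isProbabilityMeasure_smul_ofReal_inv ht0 hγ
  have nα : NullSingletonClass (ENNReal.ofReal t⁻¹ • α) := ⟨fun x => by simp⟩
  have nγ : NullSingletonClass (ENNReal.ofReal t⁻¹ • γ) := ⟨fun x => by simp⟩
  have hct : ENNReal.ofReal t * ENNReal.ofReal t⁻¹ = 1 := by
    rw [← ENNReal.ofReal_mul ht, mul_inv_cancel₀ ht0.ne', ENNReal.ofReal_one]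
  set A := cdfMap (ENNReal.ofReal t⁻¹ • α) with hA
  set G := cdfMap (ENNReal.ofReal t⁻¹ • γ) with hG
  have mA : Measurable A := (continuous_cdfMap _).measurable
  have mG : Measurable G := (continuous_cdfMap _).measurable
  have pA : α.map A = ENNReal.ofReal t • volume := by
    rw [← map_cdfMap (ENNReal.ofReal t⁻¹ • α), Measure.map_smul, smul_smul, hct, one_smul]
  have pG : γ.map G = ENNReal.ofReal t • volume := by
    rw [← map_cdfMap (ENNReal.ofReal t⁻¹ • γ), Measure.map_smul, smul_smul, hct, one_smul]
  have hcomp : Measurable fun z : Square => c (A z.1, G z.2) :=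
    hc.measurable.comp ((mA.comp measurable_fst).prodMk (mG.comp measurable_snd))
  set f : Square → ℝ := fun z => t⁻¹ * c (A z.1, G z.2) with hf
  have hfm : Measurable f := hcomp.const_mul _
  have hf0 : ∀ z, 0 ≤ f z := fun z => (mul_pos (inv_pos.mpr ht0) (hcpos _)).le
  obtain ⟨zmin, -, hmin⟩ := isCompact_univ.exists_isMinOn (Set.univ_nonempty (α := Square))
    hc.continuousOn
  obtain ⟨zmax, -, hmax⟩ := isCompact_univ.exists_isMaxOn (Set.univ_nonempty (α := Square))
    hc.continuousOn
  have e1 : ((α.prod γ).withDensity fun z => ENNReal.ofReal (f z)).map Prod.fst = α := by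
    refine map_fst_withDensity α γ hfm.ennreal_ofReal fun x => ?_
    have hm1 : Measurable fun y => ENNReal.ofReal (t⁻¹ * c (A x, y)) := by
      have : Continuous fun y => c (A x, y) := by fun_prop
      exact (this.measurable.const_mul _).ennreal_ofReal
    rw [hf]
    rw [← lintegral_map (f := fun y => ENNReal.ofReal (t⁻¹ * c (A x, y))) hm1 mG, pG,
      lintegral_smul_measure]
    simp only [ENNReal.ofReal_mul (inv_nonneg.mpr ht)]
    rw [lintegral_const_mul _ (by
      have : Continuous fun y => c (A x, y) := by fun_prop
      exact this.measurable.ennreal_ofReal), lintegral_ofReal_eq_one (fun y => (hcpos _).le)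
      (hc1 (A x)), mul_one, smul_eq_mul, hct]
  have e2 : ((α.prod γ).withDensity fun z => ENNReal.ofReal (f z)).map Prod.snd = γ := by
    refine map_snd_withDensity α γ hfm.ennreal_ofReal fun y => ?_
    have hm1 : Measurable fun x => ENNReal.ofReal (t⁻¹ * c (x, G y)) := by
      have : Continuous fun x => c (x, G y) := by fun_prop
      exact (this.measurable.const_mul _).ennreal_ofReal
    rw [hf]
    rw [← lintegral_map (f := fun x => ENNReal.ofReal (t⁻¹ * c (x, G y))) hm1 mA, pA,
      lintegral_smul_measure]
    simp only [ENNReal.ofReal_mul (inv_nonneg.mpr ht)]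
    rw [lintegral_const_mul _ (by
      have : Continuous fun x => c (x, G y) := by fun_prop
      exact this.measurable.ennreal_ofReal), lintegral_ofReal_eq_one (fun y => (hcpos _).le)
      (hc2 (G y)), mul_one, smul_eq_mul, hct]
  refine ⟨f, hfm, ⟨t⁻¹ * c zmin, mul_pos (inv_pos.mpr ht0) (hcpos _), fun z =>
    mul_le_mul_of_nonneg_left (hmin (Set.mem_univ _)) (inv_nonneg.mpr ht)⟩,
    ⟨t⁻¹ * c zmax, fun z =>
      mul_le_mul_of_nonneg_left (hmax (Set.mem_univ _)) (inv_nonneg.mpr ht)⟩, e1, e2, ?_⟩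
  set ν := (α.prod γ).withDensity fun z => ENNReal.ofReal (f z) with hν
  have hνfin : IsFiniteMeasure ν := by
    refine ⟨?_⟩
    rw [← Set.preimage_univ (f := (Prod.fst : Square → unitInterval)),
      ← Measure.map_apply measurable_fst MeasurableSet.univ, e1]
    exact measure_lt_top _ _
  have hTm : Measurable (Prod.map A G) := mA.prodMap mG
  set π : Measure Square := volume.withDensity fun z => ENNReal.ofReal (c z) with hπ
  have hmap : ν.map (Prod.map A G) = ENNReal.ofReal t • π := by
    rw [hν]
    have h3 := map_withDensity_comp (μ := α.prod γ) hTm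
      (F := fun z => ENNReal.ofReal (t⁻¹ * c z)) (hc.measurable.const_mul _).ennreal_ofReal
    have h4 : (fun z : Square => ENNReal.ofReal (f z)) =
        fun z => ENNReal.ofReal (t⁻¹ * c (Prod.map A G z)) := rfl
    rw [h4, h3, ← Measure.map_prod_map _ _ mA mG, pA, pG, Measure.prod_smul_left,
      Measure.prod_smul_right, smul_smul, withDensity_smul_measure]
    have h5 : (fun z => ENNReal.ofReal (t⁻¹ * c z)) =
        ENNReal.ofReal t⁻¹ • fun z => ENNReal.ofReal (c z) := by
      funext z
      rw [Pi.smul_apply, smul_eq_mul, ENNReal.ofReal_mul (inv_nonneg.mpr ht)]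
    rw [h5, withDensity_smul _ hc.measurable.ennreal_ofReal, smul_smul, mul_assoc, hct, mul_one,
      ← Measure.volume_eq_prod]
  have hcross : crossInv ν ν = t ^ 2 * crossInv π π := by
    rw [← crossInv_map (A := A) (G := G) (monotone_cdfMap _) (monotone_cdfMap _), hmap,
      crossInv_smul, ENNReal.toReal_ofReal ht]
    · intro x
      have : {w : Square | A w.1 = x} = Prod.fst ⁻¹' (A ⁻¹' {x}) := rfl
      rw [this, ← Measure.map_apply measurable_fst (mA (measurableSet_singleton x)), e1,
        ← Measure.map_apply mA (measurableSet_singleton x), pA]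
      simp
    · intro y
      have : {w : Square | G w.2 = y} = Prod.snd ⁻¹' (G ⁻¹' {y}) := rfl
      rw [this, ← Measure.map_apply measurable_snd (mG (measurableSet_singleton y)), e2,
        ← Measure.map_apply mG (measurableSet_singleton y), pG]
      simp
  have hlog : ∫ z, Real.log (t * f z) ∂ν = t * ∫ z, Real.log (c z) ∂π := by
    have h6 : ∀ z, Real.log (t * f z) = Real.log (c (Prod.map A G z)) := by
      intro z
      simp only [hf, mul_inv_cancel_left₀ ht0.ne']
      rfl
    simp only [h6]
    rw [← integral_map (f := fun z => Real.log (c z)) hTm.aemeasurable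
      (hc.log fun z => (hcpos z).ne').measurable.aestronglyMeasurable, hmap,
      integral_smul_measure, ENNReal.toReal_ofReal ht, smul_eq_mul]
  rw [hcross, hlog, pressurePrimitive_eq]
  linear_combination t * hcv

/-! ### Interaction between the four rectangles -/

lemma crossInv_add_left (ν₁ ν₂ ν' : Measure Square) [IsFiniteMeasure ν₁] [IsFiniteMeasure ν₂]
    [IsFiniteMeasure ν'] : crossInv (ν₁ + ν₂) ν' = crossInv ν₁ ν' + crossInv ν₂ ν' := by
  rw [crossInv_eq_prod, crossInv_eq_prod, crossInv_eq_prod, Measure.add_prod,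
    integral_add_measure (integrable_h_prod _ _) (integrable_h_prod _ _)]

lemma crossInv_add_right (ν' ν₁ ν₂ : Measure Square) [IsFiniteMeasure ν₁] [IsFiniteMeasure ν₂]
    [IsFiniteMeasure ν'] : crossInv ν' (ν₁ + ν₂) = crossInv ν' ν₁ + crossInv ν' ν₂ := by
  rw [crossInv_comm, crossInv_add_left, crossInv_comm ν₁, crossInv_comm ν₂]

/-- For points of which the second lies above the first, inversion is decided by the first
coordinates. -/
lemma crossInv_of_snd_lt {ν ν' : Measure Square} [IsFiniteMeasure ν] [IsFiniteMeasure ν'] {θ : ℝ}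
    (hν : ∀ᵐ z ∂ν, (z.2 : ℝ) ≤ θ) (hν' : ∀ᵐ w ∂ν', θ < (w.2 : ℝ)) :
    crossInv ν ν' = ∫ x, (ν'.map Prod.fst).real (Set.Iio x) ∂(ν.map Prod.fst) := by
  classical
  have hm : Measurable fun x => (ν'.map Prod.fst).real (Set.Iio x) :=
    Monotone.measurable fun a b hab => measureReal_mono (Set.Iio_subset_Iio hab)
  rw [integral_map measurable_fst.aemeasurable hm.aestronglyMeasurable]
  refine integral_congr_ae ?_
  filter_upwards [hν] with z hz
  have h1 : (fun w => h z w) =ᵐ[ν'] (Prod.fst ⁻¹' Set.Iio z.1).indicator fun _ => 1 := by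
    filter_upwards [hν'] with w hw
    have h2 : (z.2 : ℝ) - w.2 < 0 := by linarith
    rw [h_eq_ite, Set.indicator_apply]
    simp [mul_neg_iff, h2, h2.not_gt]
  rw [integral_congr_ae h1, integral_indicator (measurable_fst measurableSet_Iio),
    map_measureReal_apply measurable_fst measurableSet_Iio]
  simp

/-- For points of which the second lies to the right of the first, inversion is decided by the
second coordinates. -/
lemma crossInv_of_fst_lt {ν ν' : Measure Square} [IsFiniteMeasure ν] [IsFiniteMeasure ν'] {θ : ℝ}
    (hν : ∀ᵐ z ∂ν, (z.1 : ℝ) ≤ θ) (hν' : ∀ᵐ w ∂ν', θ < (w.1 : ℝ)) :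
    crossInv ν ν' = ∫ y, (ν'.map Prod.snd).real (Set.Iio y) ∂(ν.map Prod.snd) := by
  classical
  have hm : Measurable fun x => (ν'.map Prod.snd).real (Set.Iio x) :=
    Monotone.measurable fun a b hab => measureReal_mono (Set.Iio_subset_Iio hab)
  rw [integral_map measurable_snd.aemeasurable hm.aestronglyMeasurable]
  refine integral_congr_ae ?_
  filter_upwards [hν] with z hz
  have h1 : (fun w => h z w) =ᵐ[ν'] (Prod.snd ⁻¹' Set.Iio z.2).indicator fun _ => 1 := by
    filter_upwards [hν'] with w hw
    have h2 : (z.1 : ℝ) - w.1 < 0 := by linarith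
    rw [h_eq_ite, Set.indicator_apply]
    simp [mul_neg_iff, h2, h2.not_gt]
  rw [integral_congr_ae h1, integral_indicator (measurable_snd measurableSet_Iio),
    map_measureReal_apply measurable_snd measurableSet_Iio]
  simp

lemma crossInv_of_const {ν ν' : Measure Square} {k : ℝ}
    (hk : ∀ᵐ z ∂ν, ∀ᵐ w ∂ν', h z w = k) :
    crossInv ν ν' = k * (ν.real Set.univ * ν'.real Set.univ) := by
  have h1 : (fun z => ∫ w, h z w ∂ν') =ᵐ[ν] fun _ => ν'.real Set.univ * k := by
    filter_upwards [hk] with z hz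
    rw [integral_congr_ae hz]
    simp
  rw [crossInv, integral_congr_ae h1, integral_const, smul_eq_mul]
  ring

lemma mem_rect {θ₁ θ₂ : ℝ} {i j : Fin 2} {z : Square} :
    z ∈ rect θ₁ θ₂ i j ↔ z.1 ∈ interval θ₁ i ∧ z.2 ∈ interval θ₂ j := Iff.rfl

@[simp] lemma mem_interval_zero {θ : ℝ} {x : unitInterval} :
    x ∈ interval θ 0 ↔ (x : ℝ) ≤ θ := Iff.rfl

@[simp] lemma mem_interval_one {θ : ℝ} {x : unitInterval} :
    x ∈ interval θ 1 ↔ θ < (x : ℝ) := Iff.rfl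

/-- The interaction of a sum of measures on the four rectangles. -/
lemma crossInv_four {θ₁ θ₂ : ℝ} (ν : Fin 2 → Fin 2 → Measure Square)
    [∀ i j, IsFiniteMeasure (ν i j)] (hν : ∀ i j, ∀ᵐ z ∂(ν i j), z ∈ rect θ₁ θ₂ i j) :
    crossInv (∑ i, ∑ j, ν i j) (∑ i, ∑ j, ν i j) =
      ∑ i, ∑ j, crossInv (ν i j) (ν i j) +
      2 * (∑ i, ∫ x, ((ν i 1).map Prod.fst).real (Set.Iio x) ∂((ν i 0).map Prod.fst) +
        ∑ j, ∫ y, ((ν 1 j).map Prod.snd).real (Set.Iio y) ∂((ν 0 j).map Prod.snd) +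
        (ν 0 1).real Set.univ * (ν 1 0).real Set.univ) := by
  have hcol : ∀ i, crossInv (ν i 0) (ν i 1) =
      ∫ x, ((ν i 1).map Prod.fst).real (Set.Iio x) ∂((ν i 0).map Prod.fst) := fun i =>
    crossInv_of_snd_lt ((hν i 0).mono fun z hz => mem_interval_zero.mp (mem_rect.mp hz).2)
      ((hν i 1).mono fun z hz => mem_interval_one.mp (mem_rect.mp hz).2)
  have hrow : ∀ j, crossInv (ν 0 j) (ν 1 j) =
      ∫ y, ((ν 1 j).map Prod.snd).real (Set.Iio y) ∂((ν 0 j).map Prod.snd) := fun j =>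
    crossInv_of_fst_lt ((hν 0 j).mono fun z hz => mem_interval_zero.mp (mem_rect.mp hz).1)
      ((hν 1 j).mono fun z hz => mem_interval_one.mp (mem_rect.mp hz).1)
  have hdiag : crossInv (ν 0 0) (ν 1 1) = 0 := by
    rw [crossInv_of_const (k := 0), zero_mul]
    filter_upwards [hν 0 0] with z hz
    filter_upwards [hν 1 1] with w hw
    obtain ⟨z1, z2⟩ := mem_rect.mp hz
    obtain ⟨w1, w2⟩ := mem_rect.mp hw
    rw [mem_interval_zero] at z1 z2
    rw [mem_interval_one] at w1 w2
    have e1 : (z.1 : ℝ) - w.1 < 0 := by linarith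
    have e2 : (z.2 : ℝ) - w.2 < 0 := by linarith
    rw [h_eq_ite, if_neg (mul_pos_of_neg_of_neg e1 e2).not_gt]
  have hanti : crossInv (ν 0 1) (ν 1 0) = (ν 0 1).real Set.univ * (ν 1 0).real Set.univ := by
    rw [crossInv_of_const (k := 1), one_mul]
    filter_upwards [hν 0 1] with z hz
    filter_upwards [hν 1 0] with w hw
    obtain ⟨z1, z2⟩ := mem_rect.mp hz
    obtain ⟨w1, w2⟩ := mem_rect.mp hw
    rw [mem_interval_zero] at z1 w2
    rw [mem_interval_one] at w1 z2
    have e1 : (z.1 : ℝ) - w.1 < 0 := by linarith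
    have e2 : 0 < (z.2 : ℝ) - w.2 := by linarith
    rw [h_eq_ite, if_pos (mul_neg_of_neg_of_pos e1 e2)]
  rw [← hanti]
  simp only [Fin.sum_univ_two, ← hcol, ← hrow]
  simp only [crossInv_add_left, crossInv_add_right]
  rw [crossInv_comm (ν 0 1) (ν 0 0), crossInv_comm (ν 1 1) (ν 1 0),
    crossInv_comm (ν 1 0) (ν 0 0), crossInv_comm (ν 1 1) (ν 0 1), crossInv_comm (ν 1 1) (ν 0 0),
    crossInv_comm (ν 1 0) (ν 0 1), hdiag]
  ring

/-! ### The rectangles -/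

/-- The length of `interval θ i`. -/
def intervalLength (θ : ℝ) : Fin 2 → ℝ := ![θ, 1 - θ]

lemma measurableSet_interval (θ : ℝ) (i : Fin 2) : MeasurableSet (interval θ i) := by
  fin_cases i
  · exact measurableSet_le measurable_subtype_coe measurable_const
  · exact measurableSet_lt measurable_const measurable_subtype_coe

lemma measurableSet_rect (θ₁ θ₂ : ℝ) (i j : Fin 2) : MeasurableSet (rect θ₁ θ₂ i j) :=
  (measurableSet_interval θ₁ i).prod (measurableSet_interval θ₂ j)

lemma interval_one_eq (θ : ℝ) : interval θ 1 = (interval θ 0)ᶜ := by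
  ext x
  simp

lemma intervalLength_pos {θ : ℝ} (hθ : θ ∈ Set.Ioo (0 : ℝ) 1) (i : Fin 2) :
    0 < intervalLength θ i := by
  fin_cases i
  · exact hθ.1
  · exact sub_pos.mpr hθ.2

lemma volume_interval {θ : ℝ} (hθ : θ ∈ Set.Ioo (0 : ℝ) 1) (i : Fin 2) :
    volume (interval θ i) = ENNReal.ofReal (intervalLength θ i) := by
  have h0 : interval θ 0 = Set.Iic (⟨θ, hθ.1.le, hθ.2.le⟩ : unitInterval) := by
    ext x
    exact Iff.rfl
  fin_cases i
  · simp only [Fin.zero_eta]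
    rw [h0, unitInterval.volume_Iic]
    rfl
  · simp only [Fin.mk_one]
    rw [interval_one_eq, h0, Set.compl_Iic, unitInterval.volume_Ioi]
    rfl

lemma volume_real_interval {θ : ℝ} (hθ : θ ∈ Set.Ioo (0 : ℝ) 1) (i : Fin 2) :
    (volume : Measure unitInterval).real (interval θ i) = intervalLength θ i := by
  rw [measureReal_def, volume_interval hθ, ENNReal.toReal_ofReal (intervalLength_pos hθ i).le]

lemma volume_real_rect {θ₁ θ₂ : ℝ} (h₁ : θ₁ ∈ Set.Ioo (0 : ℝ) 1) (h₂ : θ₂ ∈ Set.Ioo (0 : ℝ) 1)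
    (i j : Fin 2) : (volume : Measure Square).real (rect θ₁ θ₂ i j) =
      intervalLength θ₁ i * intervalLength θ₂ j := by
  rw [Measure.volume_eq_prod, rect, measureReal_prod_prod, volume_real_interval h₁,
    volume_real_interval h₂]

lemma restrict_rect_add_snd (ν : Measure Square) (θ₁ θ₂ : ℝ) (i : Fin 2) :
    ν.restrict (rect θ₁ θ₂ i 0) + ν.restrict (rect θ₁ θ₂ i 1) =
      ν.restrict (Prod.fst ⁻¹' interval θ₁ i) := by
  have h1 : ∀ j, rect θ₁ θ₂ i j = (Prod.snd ⁻¹' interval θ₂ j) ∩ (Prod.fst ⁻¹' interval θ₁ i) := by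
    intro j; rw [rect, Set.prod_eq, Set.inter_comm]
  rw [h1, h1, ← Measure.restrict_restrict (measurable_snd (measurableSet_interval θ₂ 0)),
    ← Measure.restrict_restrict (measurable_snd (measurableSet_interval θ₂ 1)), interval_one_eq,
    Set.preimage_compl, Measure.restrict_add_restrict_compl
      (measurable_snd (measurableSet_interval θ₂ 0))]

lemma restrict_rect_add_fst (ν : Measure Square) (θ₁ θ₂ : ℝ) (j : Fin 2) :
    ν.restrict (rect θ₁ θ₂ 0 j) + ν.restrict (rect θ₁ θ₂ 1 j) =
      ν.restrict (Prod.snd ⁻¹' interval θ₂ j) := by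
  have h1 : ∀ i, rect θ₁ θ₂ i j = (Prod.fst ⁻¹' interval θ₁ i) ∩ (Prod.snd ⁻¹' interval θ₂ j) := by
    intro i; rw [rect, Set.prod_eq]
  rw [h1, h1, ← Measure.restrict_restrict (measurable_fst (measurableSet_interval θ₁ 0)),
    ← Measure.restrict_restrict (measurable_fst (measurableSet_interval θ₁ 1)), interval_one_eq,
    Set.preimage_compl, Measure.restrict_add_restrict_compl
      (measurable_fst (measurableSet_interval θ₁ 0))]

lemma sum_restrict_rect (ν : Measure Square) (θ₁ θ₂ : ℝ) :
    ∑ i, ∑ j, ν.restrict (rect θ₁ θ₂ i j) = ν := by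
  simp only [Fin.sum_univ_two, restrict_rect_add_snd]
  rw [interval_one_eq, Set.preimage_compl, Measure.restrict_add_restrict_compl
      (measurable_fst (measurableSet_interval θ₁ 0))]

/-! ### The value of the minimum -/

lemma mul_log_div {s l : ℝ} (hl : l ≠ 0) : s * Real.log (s / l) = s * Real.log s - s * Real.log l := by
  by_cases hs : s = 0
  · simp [hs]
  · rw [Real.log_div hs hl]; ring

/-- `PhiTilde` as a sum of block, strip and marginal contributions. -/
lemma PhiTilde_eq (β : ℝ) {θ₁ θ₂ : ℝ} (h₁ : θ₁ ∈ Set.Ioo (0 : ℝ) 1) (h₂ : θ₂ ∈ Set.Ioo (0 : ℝ) 1)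
    (t : Fin 2 → Fin 2 → ℝ) :
    PhiTilde β θ₁ θ₂ t = pressure β +
      ∑ i, ∑ j, (-pressurePrimitive β (t i j) - t i j * Real.log (t i j)) +
      ∑ i, splitCost β (t i 0) (t i 1) + ∑ j, splitCost β (t 0 j) (t 1 j) +
      ∑ i, (t i 0 + t i 1) * Real.log ((t i 0 + t i 1) / intervalLength θ₁ i) +
      ∑ j, (t 0 j + t 1 j) * Real.log ((t 0 j + t 1 j) / intervalLength θ₂ j) +
      β * (t 0 1 * t 1 0) := by
  have e1 : ∀ i j, t i j * Real.log (t i j / (volume : Measure Square).real (rect θ₁ θ₂ i j)) =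
      t i j * Real.log (t i j) - t i j * Real.log (intervalLength θ₁ i) -
        t i j * Real.log (intervalLength θ₂ j) := by
    intro i j
    have p1 := (intervalLength_pos h₁ i).ne'
    have p2 := (intervalLength_pos h₂ j).ne'
    rw [volume_real_rect h₁ h₂, mul_log_div (mul_ne_zero p1 p2), Real.log_mul p1 p2]
    ring
  unfold PhiTilde
  simp only [e1, mul_log_div (intervalLength_pos h₁ _).ne',
    mul_log_div (intervalLength_pos h₂ _).ne', pressure_eq β, splitCost, pressure_eq,
    pressurePrimitive_eq, Fin.sum_univ_two]
  ring

/-! ### The lower bound -/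

lemma nullSingletonClass_withDensity {X : Type*} [MeasurableSpace X] (μ : Measure X)
    [NullSingletonClass μ] (F : X → ENNReal) : NullSingletonClass (μ.withDensity F) :=
  ⟨fun x => withDensity_absolutelyContinuous μ F (measure_singleton x)⟩

lemma prod_withDensity_ofReal {P Q : unitInterval → ℝ} (hP : Measurable P) (hQ : Measurable Q)
    {f : Square → ℝ} (hf : Measurable f) :
    (((volume : Measure unitInterval).withDensity fun x => ENNReal.ofReal (P x)).prod
      ((volume : Measure unitInterval).withDensity fun y => ENNReal.ofReal (Q y))).withDensity
        (fun z => ENNReal.ofReal (f z)) =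
      (volume : Measure Square).withDensity fun z =>
        ENNReal.ofReal (P z.1) * ENNReal.ofReal (Q z.2) * ENNReal.ofReal (f z) := by
  rw [prod_withDensity hP.ennreal_ofReal hQ.ennreal_ofReal, ← Measure.volume_eq_prod]
  exact (withDensity_mul _ ((hP.comp measurable_fst).ennreal_ofReal.mul
    (hQ.comp measurable_snd).ennreal_ofReal) hf.ennreal_ofReal).symm

/-- Gibbs' variational inequality for a part of the measure, relative to a product of two densities
`P` and `Q` of mass `t`. -/
lemma le_block (β : ℝ) {t : ℝ} (ht : 0 ≤ t) {P Q : unitInterval → ℝ} (hP : Measurable P)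
    (hQ : Measurable Q) (hPt : ∫⁻ x, ENNReal.ofReal (P x) = ENNReal.ofReal t)
    (hQt : ∫⁻ y, ENNReal.ofReal (Q y) = ENNReal.ofReal t) {κ : Measure Square}
    (hκt : κ Set.univ = ENNReal.ofReal t) {Φ : Square → ℝ} (hΦ : Measurable Φ) (hΦ0 : ∀ z, 0 ≤ Φ z)
    (hκ : κ = volume.withDensity fun z => ENNReal.ofReal (Φ z))
    (hP0 : ∀ x, 0 ≤ P x) (hQ0 : ∀ y, 0 ≤ Q y)
    (hpos : ∀ᵐ z ∂κ, 0 < P z.1 ∧ 0 < Q z.2) (iΦ : Integrable (fun z => Real.log (Φ z)) κ)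
    (iP : Integrable (fun z => Real.log (P z.1)) κ)
    (iQ : Integrable (fun z => Real.log (Q z.2)) κ) :
    -pressurePrimitive β t - t * Real.log t + ∫ z, Real.log (P z.1) ∂κ + ∫ z, Real.log (Q z.2) ∂κ
      ≤ ∫ z, Real.log (Φ z) ∂κ + β / 2 * crossInv κ κ := by
  rcases ht.eq_or_lt with rfl | ht0
  · rw [ENNReal.ofReal_zero, Measure.measure_univ_eq_zero] at hκt
    simp [hκt, crossInv]
  have hfin : IsFiniteMeasure κ := ⟨by rw [hκt]; exact ENNReal.ofReal_lt_top⟩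
  set f : Square → ℝ := fun z => Φ z / (P z.1 * Q z.2) with hf
  have hfm : Measurable f :=
    hΦ.div ((hP.comp measurable_fst).mul (hQ.comp measurable_snd))
  have hf0 : ∀ z, 0 ≤ f z := fun z => div_nonneg (hΦ0 z) (mul_nonneg (hP0 _) (hQ0 _))
  have n1 := nullSingletonClass_withDensity (volume : Measure unitInterval)
    (fun x => ENNReal.ofReal (P x))
  have n2 := nullSingletonClass_withDensity (volume : Measure unitInterval)
    (fun x => ENNReal.ofReal (Q x))
  have hκf : κ = (((volume : Measure unitInterval).withDensity fun x => ENNReal.ofReal (P x)).prod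
      ((volume : Measure unitInterval).withDensity fun y => ENNReal.ofReal (Q y))).withDensity
        (fun z => ENNReal.ofReal (f z)) := by
    rw [prod_withDensity_ofReal hP hQ hfm]
    have hpos' := hpos
    rw [hκ, ae_withDensity_iff hΦ.ennreal_ofReal] at hpos'
    rw [hκ]
    refine withDensity_congr_ae ?_
    filter_upwards [hpos'] with z hz
    rw [← ENNReal.ofReal_mul (hP0 _), ← ENNReal.ofReal_mul (mul_nonneg (hP0 _) (hQ0 _))]
    by_cases h0 : ENNReal.ofReal (Φ z) = 0
    · have : Φ z = 0 := le_antisymm (ENNReal.ofReal_eq_zero.mp h0) (hΦ0 z)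
      simp [hf, this]
    · obtain ⟨p1, p2⟩ := hz h0
      congr 1
      simp only [hf]
      field_simp
  have hΦpos : ∀ᵐ z ∂κ, 0 < Φ z := by rw [hκ]; exact ae_density_pos hΦ
  have hlog : (fun z => Real.log (t * f z)) =ᵐ[κ] fun z =>
      Real.log t + Real.log (Φ z) - Real.log (P z.1) - Real.log (Q z.2) := by
    filter_upwards [hpos, hΦpos] with z hz hΦz
    simp only [hf]
    rw [Real.log_mul ht0.ne' (div_pos hΦz (mul_pos hz.1 hz.2)).ne',
      Real.log_div hΦz.ne' (mul_pos hz.1 hz.2).ne', Real.log_mul hz.1.ne' hz.2.ne']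
    ring
  have i1 : Integrable (fun z => Real.log t + Real.log (Φ z)) κ := (integrable_const _).add iΦ
  have i2 : Integrable (fun z => Real.log t + Real.log (Φ z) - Real.log (P z.1)) κ := i1.sub iP
  have i3 : Integrable (fun z => Real.log t + Real.log (Φ z) - Real.log (P z.1) -
    Real.log (Q z.2)) κ := i2.sub iQ
  have key := neg_pressurePrimitive_le ht
    (α := (volume : Measure unitInterval).withDensity fun x => ENNReal.ofReal (P x))
    (γ := (volume : Measure unitInterval).withDensity fun x => ENNReal.ofReal (Q x))
    (by rw [withDensity_apply _ MeasurableSet.univ, Measure.restrict_univ, hPt])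
    (by rw [withDensity_apply _ MeasurableSet.univ, Measure.restrict_univ, hQt])
    hκt hfm hf0 hκf (i3.congr hlog.symm) β
  rw [integral_congr_ae hlog, integral_sub i2 iQ, integral_sub i1 iP,
    integral_add (integrable_const _) iΦ, integral_const, smul_eq_mul] at key
  have hκr : κ.real Set.univ = t := by
    rw [measureReal_def, hκt, ENNReal.toReal_ofReal ht]
  rw [hκr] at key
  linarith

/-- Restricting a density `g` to a strip `L` and weighting it by proportions `r`. -/
lemma withDensity_strip {μ : Measure unitInterval} {g r : unitInterval → ℝ} (hg : Measurable g)
    (hg0 : ∀ x, 0 ≤ g x) (hr : Measurable r) {L : Set unitInterval}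
    (hL : MeasurableSet L) (hμ : μ = volume.withDensity fun x => ENNReal.ofReal (g x)) :
    (volume.withDensity fun x => ENNReal.ofReal (L.indicator (fun x => g x * r x) x)) =
      (μ.restrict L).withDensity fun x => ENNReal.ofReal (r x) := by
  have h1 : (fun x => ENNReal.ofReal (L.indicator (fun x => g x * r x) x)) =
      L.indicator ((fun x => ENNReal.ofReal (g x)) * fun x => ENNReal.ofReal (r x)) := by
    funext x
    by_cases hx : x ∈ L
    · rw [Set.indicator_of_mem hx, Set.indicator_of_mem hx, Pi.mul_apply,
        ENNReal.ofReal_mul (hg0 x)]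
    · rw [Set.indicator_of_notMem hx, Set.indicator_of_notMem hx, ENNReal.ofReal_zero]
  rw [h1, withDensity_indicator hL, withDensity_mul _ hg.ennreal_ofReal hr.ennreal_ofReal, hμ,
    restrict_withDensity hL]

lemma lintegral_strip {μ : Measure unitInterval} [IsFiniteMeasure μ] {g r : unitInterval → ℝ}
    (hg : Measurable g) (hg0 : ∀ x, 0 ≤ g x) (hr : Measurable r) (hr0 : ∀ x, 0 ≤ r x)
    (hr1 : ∀ x, r x ≤ 1) {L : Set unitInterval} (hL : MeasurableSet L)
    (hμ : μ = volume.withDensity fun x => ENNReal.ofReal (g x)) {t : ℝ}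
    (ht : ∫ x, r x ∂(μ.restrict L) = t) :
    ∫⁻ x, ENNReal.ofReal (L.indicator (fun x => g x * r x) x) = ENNReal.ofReal t := by
  have h1 := congrArg (fun m : Measure unitInterval => m Set.univ)
    (withDensity_strip hg hg0 hr hL hμ)
  simp only [withDensity_apply _ MeasurableSet.univ, Measure.restrict_univ] at h1
  rw [h1, ← ht, ofReal_integral_eq_lintegral_ofReal _ (Eventually.of_forall hr0)]
  refine Integrable.of_bound hr.aestronglyMeasurable 1 (Eventually.of_forall fun x => ?_)
  rw [Real.norm_eq_abs, abs_of_nonneg (hr0 x)]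
  exact hr1 x

lemma integrable_log_of_bounds {X : Type*} [MeasurableSpace X] {κ : Measure X} [IsFiniteMeasure κ]
    {g : X → ℝ} (hg : Measurable g) {ε K : ℝ} (hε : 0 < ε) (hb : ∀ᵐ x ∂κ, ε ≤ g x ∧ g x ≤ K) :
    Integrable (fun x => Real.log (g x)) κ := by
  refine Integrable.of_bound hg.log.aestronglyMeasurable (|Real.log ε| + |Real.log K|) ?_
  filter_upwards [hb] with x hx
  have h1 := Real.log_le_log hε hx.1
  have h2 := Real.log_le_log (hε.trans_le hx.1) hx.2
  rw [Real.norm_eq_abs, abs_le]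
  constructor
  · linarith [neg_abs_le (Real.log ε), abs_nonneg (Real.log K)]
  · linarith [le_abs_self (Real.log K), abs_nonneg (Real.log ε)]

/-- Among densities with mass `s` on a set of measure `l` the constant one has minimal entropy. -/
lemma mul_log_le_setIntegral {μ : Measure unitInterval} [IsFiniteMeasure μ] {g : unitInterval → ℝ}
    (hg : Measurable g) (hg0 : ∀ x, 0 ≤ g x) {L : Set unitInterval} (hL : MeasurableSet L)
    (hμ : μ = volume.withDensity fun x => ENNReal.ofReal (g x)) {l s : ℝ} (hl : 0 < l)
    (hlL : (volume : Measure unitInterval).real L = l) (hs : μ.real L = s)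
    (hint : Integrable (fun x => Real.log (g x)) μ) :
    s * Real.log (s / l) ≤ ∫ x in L, Real.log (g x) ∂μ := by
  have hs0 : 0 ≤ s := hs ▸ measureReal_nonneg
  rcases hs0.eq_or_lt with h0 | h0
  · have h1 : μ.restrict L = 0 := by
      rw [Measure.restrict_eq_zero, ← measureReal_eq_zero_iff, hs, h0]
    rw [h1, ← h0]
    simp
  set k := s / l with hk
  have hk0 : 0 < k := div_pos h0 hl
  have hμL : μ.restrict L =
      ((volume : Measure unitInterval).restrict L).withDensity fun x => ENNReal.ofReal (g x) := by
    rw [hμ, restrict_withDensity hL]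
  have hb : ∀ x, g x * (k / g x) ≤ k := by
    intro x
    rcases (hg0 x).eq_or_lt with h2 | h2
    · rw [← h2, zero_mul]; exact hk0.le
    · rw [mul_div_cancel₀ _ h2.ne']
  have hb0 : ∀ x, 0 ≤ g x * (k / g x) := fun x =>
    mul_nonneg (hg0 x) (div_nonneg hk0.le (hg0 x))
  have hi0 : Integrable (fun x => g x * (k / g x)) ((volume : Measure unitInterval).restrict L) := by
    refine Integrable.of_bound (hg.mul (measurable_const.div hg)).aestronglyMeasurable k
      (Eventually.of_forall fun x => ?_)
    rw [Real.norm_eq_abs, abs_of_nonneg (hb0 x)]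
    exact hb x
  have hi1 : Integrable (fun x => k / g x) (μ.restrict L) := by
    rw [hμL, integrable_density_iff hg hg0]
    exact hi0
  have hv : ∫ x in L, k / g x ∂μ ≤ s := by
    rw [hμL, integral_density hg hg0]
    calc ∫ x in L, g x * (k / g x) ≤ ∫ _x in L, k :=
          integral_mono hi0 (integrable_const _) hb
      _ = s := by
          rw [setIntegral_const, hlL, smul_eq_mul, hk]
          field_simp
  have hpos : ∀ᵐ x ∂(μ.restrict L), 0 < g x := by
    rw [hμL]; exact ae_density_pos hg
  have hle : ∫ x in L, (Real.log k + 1 - k / g x) ∂μ ≤ ∫ x in L, Real.log (g x) ∂μ := by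
    refine integral_mono_ae ((integrable_const _).sub hi1) hint.restrict ?_
    filter_upwards [hpos] with x hx
    have h3 := Real.log_le_sub_one_of_pos (div_pos hk0 hx)
    rw [Real.log_div hk0.ne' hx.ne'] at h3
    linarith
  rw [integral_sub (integrable_const _) hi1, setIntegral_const, hs, smul_eq_mul] at hle
  linarith

/-- The excess of pressure, entropy and energy over `PhiTilde` is the sum of the excesses of the four
blocks and of the marginals. `E` stands for the entropy of the blocks, `G₁` and `G₂` for the
contributions of the marginal densities; they are arbitrary here, so that the identity applies both
to a general measure and to the minimizer. -/
lemma sum_blocks (β : ℝ) {θ₁ θ₂ : ℝ} (h₁ : θ₁ ∈ Set.Ioo (0 : ℝ) 1) (h₂ : θ₂ ∈ Set.Ioo (0 : ℝ) 1)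
    {t : Fin 2 → Fin 2 → ℝ} {ν : Fin 2 → Fin 2 → Measure Square} [∀ i j, IsFiniteMeasure (ν i j)]
    (hν : ∀ i j, ∀ᵐ z ∂(ν i j), z ∈ rect θ₁ θ₂ i j)
    (hνt : ∀ i j, (ν i j).real Set.univ = t i j) {rx ry : Fin 2 → Fin 2 → unitInterval → ℝ}
    (hrx : ∀ i, ∑ j, ∫ x, Real.log (rx i j x) ∂((ν i j).map Prod.fst) +
      β * ∫ x, ((ν i 1).map Prod.fst).real (Set.Iio x) ∂((ν i 0).map Prod.fst) =
        splitCost β (t i 0) (t i 1))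
    (hry : ∀ j, ∑ i, ∫ y, Real.log (ry j i y) ∂((ν i j).map Prod.snd) +
      β * ∫ y, ((ν 1 j).map Prod.snd).real (Set.Iio y) ∂((ν 0 j).map Prod.snd) =
        splitCost β (t 0 j) (t 1 j)) (G₁ G₂ E : Fin 2 → Fin 2 → ℝ) :
    pressure β + ∑ i, ∑ j, E i j + β / 2 * crossInv (∑ i, ∑ j, ν i j) (∑ i, ∑ j, ν i j) -
        PhiTilde β θ₁ θ₂ t =
      ∑ i, ∑ j, (E i j + β / 2 * crossInv (ν i j) (ν i j) -
        (-pressurePrimitive β (t i j) - t i j * Real.log (t i j) +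
          (G₁ i j + ∫ x, Real.log (rx i j x) ∂((ν i j).map Prod.fst)) +
          (G₂ i j + ∫ y, Real.log (ry j i y) ∂((ν i j).map Prod.snd)))) +
      ∑ i, ((∑ j, G₁ i j) -
        (t i 0 + t i 1) * Real.log ((t i 0 + t i 1) / intervalLength θ₁ i)) +
      ∑ j, ((∑ i, G₂ i j) -
        (t 0 j + t 1 j) * Real.log ((t 0 j + t 1 j) / intervalLength θ₂ j)) := by
  rw [crossInv_four ν hν, PhiTilde_eq β h₁ h₂]
  simp only [← hrx, ← hry, hνt, Fin.sum_univ_two]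
  ring

/-- The lower bound for every measure of finite entropy with the prescribed masses. Each restriction
to a rectangle is compared with the product of the marginal densities of `ν`, weighted by the optimal
proportions in its two strips. -/
theorem PhiTilde_le (β : ℝ) {θ₁ θ₂ : ℝ} (h₁ : θ₁ ∈ Set.Ioo (0 : ℝ) 1)
    (h₂ : θ₂ ∈ Set.Ioo (0 : ℝ) 1) {t : Fin 2 → Fin 2 → ℝ} (ht : ∀ i j, 0 ≤ t i j)
    {ν : Measure Square} [IsProbabilityMeasure ν] (hac : ν ≪ volume)
    (hint : Integrable (llr ν volume) ν) (hνt : ∀ i j, ν.real (rect θ₁ θ₂ i j) = t i j) :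
    PhiTilde β θ₁ θ₂ t ≤
      pressure β + ∫ z, llr ν volume z ∂ν + β / 2 * crossInv ν ν := by
  set Φ : Square → ℝ := fun z => (ν.rnDeriv volume z).toReal with hΦ
  have hΦm : Measurable Φ := (Measure.measurable_rnDeriv _ _).ennreal_toReal
  have hΦ0 : ∀ z, 0 ≤ Φ z := fun z => ENNReal.toReal_nonneg
  have hνΦ : ν = volume.withDensity fun z => ENNReal.ofReal (Φ z) := by
    have := Measure.haveLebesgueDecomposition_of_sigmaFinite ν (volume : Measure Square)
    refine (Measure.withDensity_rnDeriv_eq ν (volume : Measure Square) hac).symm.trans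
      (withDensity_congr_ae ?_)
    filter_upwards [Measure.rnDeriv_lt_top ν volume] with z hz
    rw [hΦ, ENNReal.ofReal_toReal hz.ne]
  have hllr : ∀ z, llr ν volume z = Real.log (Φ z) := fun z => rfl
  simp only [hllr]
  have iΦ : Integrable (fun z => Real.log (Φ z)) ν := hint
  -- the two marginals and their densities
  have hmarg : ∀ p : Square → unitInterval, Measurable p →
      (volume : Measure Square).map p = volume →
      ∃ g : unitInterval → ℝ, Measurable g ∧ (∀ x, 0 ≤ g x) ∧
        ν.map p = volume.withDensity (fun x => ENNReal.ofReal (g x)) ∧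
        Integrable (fun x => Real.log (g x)) (ν.map p) := by
    intro p hp hpv
    have hac' : ν.map p ≪ volume := by
      have := hac.map hp
      rwa [hpv] at this
    have hfin : IsFiniteMeasure (ν.map p) := inferInstance
    refine ⟨fun x => ((ν.map p).rnDeriv volume x).toReal,
      (Measure.measurable_rnDeriv _ _).ennreal_toReal, fun x => ENNReal.toReal_nonneg, ?_, ?_⟩
    · have := Measure.haveLebesgueDecomposition_of_sigmaFinite (ν.map p)
        (volume : Measure unitInterval)
      refine (Measure.withDensity_rnDeriv_eq (ν.map p) (volume : Measure unitInterval)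
        hac').symm.trans (withDensity_congr_ae ?_)
      filter_upwards [Measure.rnDeriv_lt_top (ν.map p) volume] with z hz
      rw [ENNReal.ofReal_toReal hz.ne]
    · have := InformationTheory.integrable_llr_map hac hp hint
      rw [hpv] at this
      exact this
  obtain ⟨g₁, g₁m, g₁0, hg₁, ig₁⟩ := hmarg Prod.fst measurable_fst
    (by rw [Measure.volume_eq_prod]; exact measurePreserving_fst.map_eq)
  obtain ⟨g₂, g₂m, g₂0, hg₂, ig₂⟩ := hmarg Prod.snd measurable_snd
    (by rw [Measure.volume_eq_prod]; exact measurePreserving_snd.map_eq)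
  have n1 : NullSingletonClass (ν.map Prod.fst) := by
    rw [hg₁]; exact nullSingletonClass_withDensity _ _
  have n2 : NullSingletonClass (ν.map Prod.snd) := by
    rw [hg₂]; exact nullSingletonClass_withDensity _ _
  -- the four parts
  set κ : Fin 2 → Fin 2 → Measure Square := fun i j => ν.restrict (rect θ₁ θ₂ i j) with hκ
  have hκmem : ∀ i j, ∀ᵐ z ∂(κ i j), z ∈ rect θ₁ θ₂ i j := fun i j =>
    ae_restrict_mem (measurableSet_rect θ₁ θ₂ i j)
  have hκt : ∀ i j, (κ i j).real Set.univ = t i j := by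
    intro i j
    rw [← hνt i j, hκ]
    simp
  have hκsum : ∑ i, ∑ j, κ i j = ν := sum_restrict_rect ν θ₁ θ₂
  have hcol : ∀ i, (κ i 0).map Prod.fst + (κ i 1).map Prod.fst =
      (ν.map Prod.fst).restrict (interval θ₁ i) := by
    intro i
    rw [← Measure.map_add _ _ measurable_fst, hκ, restrict_rect_add_snd,
      Measure.restrict_map measurable_fst (measurableSet_interval θ₁ i)]
  have hrow : ∀ j, (κ 0 j).map Prod.snd + (κ 1 j).map Prod.snd =
      (ν.map Prod.snd).restrict (interval θ₂ j) := by
    intro j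
    rw [← Measure.map_add _ _ measurable_snd, hκ, restrict_rect_add_fst,
      Measure.restrict_map measurable_snd (measurableSet_interval θ₂ j)]
  have hmfst : ∀ i j, ((κ i j).map Prod.fst).real Set.univ = t i j := by
    intro i j
    rw [map_measureReal_apply measurable_fst MeasurableSet.univ, Set.preimage_univ, hκt]
  have hmsnd : ∀ i j, ((κ i j).map Prod.snd).real Set.univ = t i j := by
    intro i j
    rw [map_measureReal_apply measurable_snd MeasurableSet.univ, Set.preimage_univ, hκt]
  have hs₁ : ∀ i, ((ν.map Prod.fst).restrict (interval θ₁ i)).real Set.univ = t i 0 + t i 1 := by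
    intro i
    rw [← hcol, measureReal_add_apply, hmfst, hmfst]
  have hs₂ : ∀ j, ((ν.map Prod.snd).restrict (interval θ₂ j)).real Set.univ = t 0 j + t 1 j := by
    intro j
    rw [← hrow, measureReal_add_apply, hmsnd, hmsnd]
  -- the optimal proportions in the four strips
  choose rx rxm rx0 rxs rxe rxt rxv using fun i => exists_split_profile β
    ((ν.map Prod.fst).restrict (interval θ₁ i)) (t i) (ht i) (hs₁ i)
  choose ry rym ry0 rys rye ryt ryv using fun j => exists_split_profile β
    ((ν.map Prod.snd).restrict (interval θ₂ j)) (fun i => t i j) (fun i => ht i j) (hs₂ j)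
  have le_one : ∀ r : Fin 2 → unitInterval → ℝ, (∀ j x, 0 ≤ r j x) → (∀ x, r 0 x + r 1 x = 1) →
      ∀ j x, r j x ≤ 1 := by
    intro r hr0 hr1 j x
    have e0 := hr0 0 x
    have e1 := hr0 1 x
    have e2 := hr1 x
    fin_cases j
    · simp only [Fin.zero_eta]; linarith
    · simp only [Fin.mk_one]; linarith
  have key := sum_blocks β h₁ h₂ hκmem hκt (rx := rx) (ry := ry)
    (fun i => rxv i (fun j => (κ i j).map Prod.fst) (hcol i) (hmfst i))
    (fun j => ryv j (fun i => (κ i j).map Prod.snd) (hrow j) (fun i => hmsnd i j))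
    (fun i j => ∫ z, Real.log (g₁ z.1) ∂(κ i j)) (fun i j => ∫ z, Real.log (g₂ z.2) ∂(κ i j))
    (fun i j => ∫ z, Real.log (Φ z) ∂(κ i j))
  have ig₁' : Integrable (fun z : Square => Real.log (g₁ z.1)) ν :=
    ig₁.comp_aemeasurable measurable_fst.aemeasurable
  have ig₂' : Integrable (fun z : Square => Real.log (g₂ z.2)) ν :=
    ig₂.comp_aemeasurable measurable_snd.aemeasurable
  have hpos₁ : ∀ᵐ z ∂ν, 0 < g₁ z.1 := by
    refine ae_of_ae_map (f := Prod.fst) (p := fun x => 0 < g₁ x) measurable_fst.aemeasurable ?_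
    rw [hg₁]; exact ae_density_pos g₁m
  have hpos₂ : ∀ᵐ z ∂ν, 0 < g₂ z.2 := by
    refine ae_of_ae_map (f := Prod.snd) (p := fun x => 0 < g₂ x) measurable_snd.aemeasurable ?_
    rw [hg₂]; exact ae_density_pos g₂m
  have hE : ∑ i, ∑ j, ∫ z, Real.log (Φ z) ∂(κ i j) = ∫ z, Real.log (Φ z) ∂ν := by
    conv_rhs => rw [← hκsum]
    simp only [Fin.sum_univ_two]
    have ii : ∀ i j, Integrable (fun z => Real.log (Φ z)) (κ i j) := fun i j => iΦ.restrict
    rw [integral_add_measure ((ii 0 0).add_measure (ii 0 1)) ((ii 1 0).add_measure (ii 1 1)),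
      integral_add_measure (ii 0 0) (ii 0 1), integral_add_measure (ii 1 0) (ii 1 1)]
  rw [hE, hκsum] at key
  have hG₁ : ∀ i, (t i 0 + t i 1) * Real.log ((t i 0 + t i 1) / intervalLength θ₁ i) ≤
      ∑ j, ∫ z, Real.log (g₁ z.1) ∂(κ i j) := by
    intro i
    have e1 : ∑ j, ∫ z, Real.log (g₁ z.1) ∂(κ i j) =
        ∫ x in interval θ₁ i, Real.log (g₁ x) ∂(ν.map Prod.fst) := by
      rw [Measure.restrict_map measurable_fst (measurableSet_interval θ₁ i),
        integral_map measurable_fst.aemeasurable g₁m.log.aestronglyMeasurable,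
        ← restrict_rect_add_snd ν θ₁ θ₂ i, integral_add_measure ig₁'.restrict ig₁'.restrict,
        Fin.sum_univ_two]
    rw [e1]
    refine mul_log_le_setIntegral g₁m g₁0 (measurableSet_interval θ₁ i) hg₁
      (intervalLength_pos h₁ i) (volume_real_interval h₁ i) ?_ ig₁
    rw [← hs₁ i]; simp
  have hG₂ : ∀ j, (t 0 j + t 1 j) * Real.log ((t 0 j + t 1 j) / intervalLength θ₂ j) ≤
      ∑ i, ∫ z, Real.log (g₂ z.2) ∂(κ i j) := by
    intro j
    have e1 : ∑ i, ∫ z, Real.log (g₂ z.2) ∂(κ i j) =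
        ∫ x in interval θ₂ j, Real.log (g₂ x) ∂(ν.map Prod.snd) := by
      rw [Measure.restrict_map measurable_snd (measurableSet_interval θ₂ j),
        integral_map measurable_snd.aemeasurable g₂m.log.aestronglyMeasurable,
        ← restrict_rect_add_fst ν θ₁ θ₂ j, integral_add_measure ig₂'.restrict ig₂'.restrict,
        Fin.sum_univ_two]
    rw [e1]
    refine mul_log_le_setIntegral g₂m g₂0 (measurableSet_interval θ₂ j) hg₂
      (intervalLength_pos h₂ j) (volume_real_interval h₂ j) ?_ ig₂
    rw [← hs₂ j]; simp
  have hblock : ∀ i j, -pressurePrimitive β (t i j) - t i j * Real.log (t i j) +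
      (∫ z, Real.log (g₁ z.1) ∂(κ i j) + ∫ x, Real.log (rx i j x) ∂((κ i j).map Prod.fst)) +
      (∫ z, Real.log (g₂ z.2) ∂(κ i j) + ∫ y, Real.log (ry j i y) ∂((κ i j).map Prod.snd)) ≤
      ∫ z, Real.log (Φ z) ∂(κ i j) + β / 2 * crossInv (κ i j) (κ i j) := by
    intro i j
    rcases (ht i j).eq_or_lt with h0 | h0
    · have hz : κ i j = 0 := eq_zero_of_measureReal_univ ((hκt i j).trans h0.symm)
      rw [hz, ← h0]
      simp [crossInv]
    obtain ⟨ε₁, hε₁, hε₁'⟩ := rxe i j h0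
    obtain ⟨ε₂, hε₂, hε₂'⟩ := rye j i h0
    have x1 := le_one _ (rx0 i) (rxs i) j
    have y1 := le_one _ (ry0 j) (rys j) i
    have irx : Integrable (fun z : Square => Real.log (rx i j z.1)) (κ i j) :=
      integrable_log_of_bounds ((rxm i j).comp measurable_fst) hε₁ (K := 1)
        (Eventually.of_forall fun z => ⟨hε₁' _, x1 _⟩)
    have iry : Integrable (fun z : Square => Real.log (ry j i z.2)) (κ i j) :=
      integrable_log_of_bounds ((rym j i).comp measurable_snd) hε₂ (K := 1)
        (Eventually.of_forall fun z => ⟨hε₂' _, y1 _⟩)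
    have ig₁'' : Integrable (fun z : Square => Real.log (g₁ z.1)) (κ i j) := ig₁'.restrict
    have ig₂'' : Integrable (fun z : Square => Real.log (g₂ z.2)) (κ i j) := ig₂'.restrict
    set P := (interval θ₁ i).indicator fun x => g₁ x * rx i j x with hP
    set Q := (interval θ₂ j).indicator fun y => g₂ y * ry j i y with hQ
    have hpos : ∀ᵐ z ∂(κ i j), (0 < P z.1 ∧ 0 < Q z.2) ∧
        (Real.log (P z.1) = Real.log (g₁ z.1) + Real.log (rx i j z.1) ∧
          Real.log (Q z.2) = Real.log (g₂ z.2) + Real.log (ry j i z.2)) := by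
      filter_upwards [hκmem i j, ae_restrict_of_ae hpos₁, ae_restrict_of_ae hpos₂] with z hz z1 z2
      obtain ⟨m1, m2⟩ := mem_rect.mp hz
      have r1 : 0 < rx i j z.1 := hε₁.trans_le (hε₁' _)
      have r2 : 0 < ry j i z.2 := hε₂.trans_le (hε₂' _)
      rw [hP, hQ, Set.indicator_of_mem m1, Set.indicator_of_mem m2, Real.log_mul z1.ne' r1.ne',
        Real.log_mul z2.ne' r2.ne']
      exact ⟨⟨mul_pos z1 r1, mul_pos z2 r2⟩, rfl, rfl⟩
    have eP : (fun z : Square => Real.log (P z.1)) =ᵐ[κ i j] fun z =>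
        Real.log (g₁ z.1) + Real.log (rx i j z.1) := hpos.mono fun z hz => hz.2.1
    have eQ : (fun z : Square => Real.log (Q z.2)) =ᵐ[κ i j] fun z =>
        Real.log (g₂ z.2) + Real.log (ry j i z.2) := hpos.mono fun z hz => hz.2.2
    set Ψ := (rect θ₁ θ₂ i j).indicator Φ with hΨ
    have eΨ : (fun z : Square => Real.log (Ψ z)) =ᵐ[κ i j] fun z => Real.log (Φ z) := by
      filter_upwards [hκmem i j] with z hz
      rw [hΨ, Set.indicator_of_mem hz]
    have hκΨ : κ i j = volume.withDensity fun z => ENNReal.ofReal (Ψ z) := by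
      have e1 : (fun z => ENNReal.ofReal (Ψ z)) =
          (rect θ₁ θ₂ i j).indicator fun z => ENNReal.ofReal (Φ z) := by
        funext z
        by_cases hz : z ∈ rect θ₁ θ₂ i j
        · rw [hΨ, Set.indicator_of_mem hz, Set.indicator_of_mem hz]
        · rw [hΨ, Set.indicator_of_notMem hz, Set.indicator_of_notMem hz, ENNReal.ofReal_zero]
      rw [e1, withDensity_indicator (measurableSet_rect θ₁ θ₂ i j), hκ,
        ← restrict_withDensity (measurableSet_rect θ₁ θ₂ i j), ← hνΦ]
    have hb := le_block β (ht i j) (P := P) (Q := Q) (κ := κ i j) (Φ := Ψ)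
      ((g₁m.mul (rxm i j)).indicator (measurableSet_interval θ₁ i))
      ((g₂m.mul (rym j i)).indicator (measurableSet_interval θ₂ j))
      (lintegral_strip g₁m g₁0 (rxm i j) (rx0 i j) x1 (measurableSet_interval θ₁ i) hg₁ (rxt i j))
      (lintegral_strip g₂m g₂0 (rym j i) (ry0 j i) y1 (measurableSet_interval θ₂ j) hg₂ (ryt j i))
      (by rw [← hκt i j, ofReal_measureReal])
      (hΦm.indicator (measurableSet_rect θ₁ θ₂ i j))
      (fun z => Set.indicator_nonneg (fun _ _ => hΦ0 _) z) hκΨ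
      (fun x => Set.indicator_nonneg (fun _ _ => mul_nonneg (g₁0 _) (rx0 i j _)) x)
      (fun x => Set.indicator_nonneg (fun _ _ => mul_nonneg (g₂0 _) (ry0 j i _)) x)
      (hpos.mono fun z hz => hz.1) ((Integrable.restrict iΦ).congr eΨ.symm)
      ((ig₁''.add irx).congr eP.symm) ((ig₂''.add iry).congr eQ.symm)
    rw [integral_congr_ae eP, integral_congr_ae eQ, integral_congr_ae eΨ,
      integral_add ig₁'' irx, integral_add ig₂'' iry] at hb
    rw [integral_map measurable_fst.aemeasurable (rxm i j).log.aestronglyMeasurable,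
      integral_map measurable_snd.aemeasurable (rym j i).log.aestronglyMeasurable]
    exact hb
  have hn1 := Finset.sum_nonneg fun i (_ : i ∈ Finset.univ) => Finset.sum_nonneg
    fun j (_ : j ∈ Finset.univ) => sub_nonneg.mpr (hblock i j)
  have hn2 := Finset.sum_nonneg fun i (_ : i ∈ Finset.univ) => sub_nonneg.mpr (hG₁ i)
  have hn3 := Finset.sum_nonneg fun j (_ : j ∈ Finset.univ) => sub_nonneg.mpr (hG₂ j)
  linarith

/-! ### The minimizer -/

/-- Two densities on a strip `L`, of masses `t 0` and `t 1`, whose sum is constant on `L` and whose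
proportions are optimal for the interaction between the two parts of the strip. -/
lemma exists_strip_densities (b : ℝ) {L : Set unitInterval} (hL : MeasurableSet L) {l : ℝ}
    (hl : 0 < l) (hlL : (volume : Measure unitInterval).real L = l) {t : Fin 2 → ℝ}
    (ht : ∀ j, 0 ≤ t j) :
    ∃ r P : Fin 2 → unitInterval → ℝ, (∀ j, Measurable (r j)) ∧ (∀ j, Measurable (P j)) ∧
      (∀ j x, 0 ≤ P j x) ∧ (∀ j x, P j x ≠ 0 → x ∈ L) ∧
      (∀ j, ∫⁻ x, ENNReal.ofReal (P j x) = ENNReal.ofReal (t j)) ∧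
      (∀ j, 0 < t j → ∃ ε > 0, ∃ K, ∀ x, P j x ≠ 0 → (ε ≤ P j x ∧ P j x ≤ K) ∧
        (ε ≤ r j x ∧ r j x ≤ K) ∧
        Real.log (P j x) = Real.log ((t 0 + t 1) / l) + Real.log (r j x)) ∧
      ∀ κ : Fin 2 → Measure unitInterval,
        (∀ j, κ j = volume.withDensity fun x => ENNReal.ofReal (P j x)) →
          ∑ j, ∫ x, Real.log (r j x) ∂(κ j) + b * ∫ x, (κ 1).real (Set.Iio x) ∂(κ 0) =
            splitCost b (t 0) (t 1) := by
  have hs0 : 0 ≤ t 0 + t 1 := add_nonneg (ht 0) (ht 1)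
  set k := (t 0 + t 1) / l with hk
  have hk0 : 0 ≤ k := div_nonneg hs0 hl.le
  set μ : Measure unitInterval := volume.withDensity fun _ => ENNReal.ofReal k with hμ
  have hfin : IsFiniteMeasure μ := by
    refine ⟨?_⟩
    rw [hμ, withDensity_const]
    simp
  have hns : NullSingletonClass μ := nullSingletonClass_withDensity _ _
  have hns' : NullSingletonClass (μ.restrict L) := nullSingletonClass_of_le Measure.restrict_le_self
  have hm : (μ.restrict L).real Set.univ = t 0 + t 1 := by
    rw [measureReal_restrict_apply_univ, hμ, withDensity_const, measureReal_ennreal_smul_apply,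
      hlL, ENNReal.toReal_ofReal hk0, hk]
    field_simp
  obtain ⟨r, rm, r0, rs, re, rt, rv⟩ := exists_split_profile b (μ.restrict L) t ht hm
  have r1 : ∀ j x, r j x ≤ 1 := by
    intro j x
    have e0 := r0 0 x
    have e1 := r0 1 x
    have e2 := rs x
    fin_cases j
    · simp only [Fin.zero_eta]; linarith
    · simp only [Fin.mk_one]; linarith
  have hmass : ∀ j, ∫⁻ x, ENNReal.ofReal (L.indicator (fun x => k * r j x) x) =
      ENNReal.ofReal (t j) := fun j =>
    lintegral_strip measurable_const (fun _ => hk0) (rm j) (r0 j) (r1 j) hL hμ (rt j)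
  refine ⟨r, fun j => L.indicator fun x => k * r j x, rm,
    fun j => (measurable_const.mul (rm j)).indicator hL,
    fun j x => Set.indicator_nonneg (fun _ _ => mul_nonneg hk0 (r0 j _)) x,
    fun j x hx => Set.mem_of_indicator_ne_zero hx, hmass, fun j hj => ?_, fun κ hκ => ?_⟩
  · obtain ⟨ε, hε, hεr⟩ := re j hj
    have hs : 0 < t 0 + t 1 := by
      fin_cases j
      · exact add_pos_of_pos_of_nonneg hj (ht 1)
      · exact add_pos_of_nonneg_of_pos (ht 0) hj
    have hkp : 0 < k := div_pos hs hl
    refine ⟨min (k * ε) ε, lt_min (mul_pos hkp hε) hε, max k 1, fun x hx => ?_⟩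
    have hxL := Set.mem_of_indicator_ne_zero hx
    simp only [Set.indicator_of_mem hxL]
    refine ⟨⟨(min_le_left _ _).trans (mul_le_mul_of_nonneg_left (hεr x) hk0),
      (mul_le_of_le_one_right hk0 (r1 j x)).trans (le_max_left _ _)⟩,
      ⟨(min_le_right _ _).trans (hεr x), (r1 j x).trans (le_max_right _ _)⟩, ?_⟩
    exact Real.log_mul hkp.ne' (hε.trans_le (hεr x)).ne'
  · have hκ' : ∀ j, κ j = (μ.restrict L).withDensity fun x => ENNReal.ofReal (r j x) := fun j =>
      (hκ j).trans (withDensity_strip measurable_const (fun _ => hk0) (rm j) hL hμ)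
    refine rv κ ?_ fun j => ?_
    · rw [hκ', hκ', ← withDensity_add_left (rm 0).ennreal_ofReal]
      have : ((fun x => ENNReal.ofReal (r 0 x)) + fun x => ENNReal.ofReal (r 1 x)) = 1 := by
        funext x
        rw [Pi.add_apply, ← ENNReal.ofReal_add (r0 0 x) (r0 1 x), rs x, ENNReal.ofReal_one]
        rfl
      rw [this, withDensity_one]
    · rw [measureReal_def, hκ, withDensity_apply _ MeasurableSet.univ, Measure.restrict_univ,
        hmass, ENNReal.toReal_ofReal (ht j)]

/-- A coupling of two densities `P` and `Q` of mass `t` that attains equality in Gibbs' variational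
inequality. -/
lemma exists_optimal_block (β : ℝ) {t : ℝ} (ht : 0 ≤ t) {P Q : unitInterval → ℝ}
    (hP : Measurable P) (hQ : Measurable Q) (hP0 : ∀ x, 0 ≤ P x) (hQ0 : ∀ y, 0 ≤ Q y)
    (hPt : ∫⁻ x, ENNReal.ofReal (P x) = ENNReal.ofReal t)
    (hQt : ∫⁻ y, ENNReal.ofReal (Q y) = ENNReal.ofReal t) :
    ∃ Φ : Square → ℝ, Measurable Φ ∧ (∀ z, 0 ≤ Φ z) ∧
      (∀ z, Φ z ≠ 0 → P z.1 ≠ 0 ∧ Q z.2 ≠ 0) ∧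
      ∀ κ : Measure Square, κ = volume.withDensity (fun z => ENNReal.ofReal (Φ z)) →
        κ Set.univ = ENNReal.ofReal t ∧
        κ.map Prod.fst = volume.withDensity (fun x => ENNReal.ofReal (P x)) ∧
        κ.map Prod.snd = volume.withDensity (fun y => ENNReal.ofReal (Q y)) ∧
        ∀ ε > 0, ∀ K, (∀ x, P x ≠ 0 → ε ≤ P x ∧ P x ≤ K) →
          ∀ δ > 0, ∀ M, (∀ y, Q y ≠ 0 → δ ≤ Q y ∧ Q y ≤ M) →
          Integrable (fun z => Real.log (Φ z)) κ ∧
          ∫ z, Real.log (Φ z) ∂κ + β / 2 * crossInv κ κ =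
            -pressurePrimitive β t - t * Real.log t + ∫ z, Real.log (P z.1) ∂κ +
              ∫ z, Real.log (Q z.2) ∂κ := by
  set α : Measure unitInterval := volume.withDensity fun x => ENNReal.ofReal (P x) with hα
  set γ : Measure unitInterval := volume.withDensity fun y => ENNReal.ofReal (Q y) with hγ
  have hαt : α Set.univ = ENNReal.ofReal t := by
    rw [hα, withDensity_apply _ MeasurableSet.univ, Measure.restrict_univ, hPt]
  have hγt : γ Set.univ = ENNReal.ofReal t := by
    rw [hγ, withDensity_apply _ MeasurableSet.univ, Measure.restrict_univ, hQt]
  have n1 : NullSingletonClass α := nullSingletonClass_withDensity _ _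
  have n2 : NullSingletonClass γ := nullSingletonClass_withDensity _ _
  have f1 : IsFiniteMeasure α := ⟨by rw [hαt]; exact ENNReal.ofReal_lt_top⟩
  have f2 : IsFiniteMeasure γ := ⟨by rw [hγt]; exact ENNReal.ofReal_lt_top⟩
  obtain ⟨f, fm, ⟨η, hη, hηf⟩, ⟨C, hC⟩, m1, m2, hval⟩ := exists_optimal_density β ht α γ hαt hγt
  have f0 : ∀ z, 0 < f z := fun z => hη.trans_le (hηf z)
  have hΦm : Measurable fun z : Square => P z.1 * Q z.2 * f z :=
    ((hP.comp measurable_fst).mul (hQ.comp measurable_snd)).mul fm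
  refine ⟨fun z => P z.1 * Q z.2 * f z, hΦm,
    fun z => mul_nonneg (mul_nonneg (hP0 _) (hQ0 _)) (f0 z).le, fun z hz =>
      ⟨left_ne_zero_of_mul (left_ne_zero_of_mul hz), right_ne_zero_of_mul (left_ne_zero_of_mul hz)⟩,
    fun κ hκ => ?_⟩
  have hκ' : (α.prod γ).withDensity (fun z => ENNReal.ofReal (f z)) = κ := by
    rw [hα, hγ, prod_withDensity_ofReal hP hQ fm, hκ]
    congr 1
    funext z
    rw [ENNReal.ofReal_mul (mul_nonneg (hP0 _) (hQ0 _)), ENNReal.ofReal_mul (hP0 _)]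
  rw [hκ'] at m1 m2 hval
  have hκt : κ Set.univ = ENNReal.ofReal t := by
    rw [← hαt, ← m1, Measure.map_apply measurable_fst MeasurableSet.univ, Set.preimage_univ]
  refine ⟨hκt, m1, m2, fun ε hε K hK δ hδ M hM => ?_⟩
  have hfin : IsFiniteMeasure κ := ⟨by rw [hκt]; exact ENNReal.ofReal_lt_top⟩
  rcases ht.eq_or_lt with rfl | ht0
  · rw [ENNReal.ofReal_zero, Measure.measure_univ_eq_zero] at hκt
    simp [hκt, crossInv]
  have hκr : κ.real Set.univ = t := by
    rw [measureReal_def, hκt, ENNReal.toReal_ofReal ht]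
  have hpos : ∀ᵐ z ∂κ, P z.1 ≠ 0 ∧ Q z.2 ≠ 0 := by
    have : ∀ᵐ z ∂κ, 0 < P z.1 * Q z.2 * f z := by rw [hκ]; exact ae_density_pos hΦm
    filter_upwards [this] with z hz
    exact ⟨left_ne_zero_of_mul (left_ne_zero_of_mul hz.ne'),
      right_ne_zero_of_mul (left_ne_zero_of_mul hz.ne')⟩
  have iP : Integrable (fun z : Square => Real.log (P z.1)) κ :=
    integrable_log_of_bounds (hP.comp measurable_fst) hε (hpos.mono fun z hz => hK _ hz.1)
  have iQ : Integrable (fun z : Square => Real.log (Q z.2)) κ :=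
    integrable_log_of_bounds (hQ.comp measurable_snd) hδ (hpos.mono fun z hz => hM _ hz.2)
  have ifl : Integrable (fun z : Square => Real.log (f z)) κ :=
    integrable_log_of_bounds fm hη (Eventually.of_forall fun z => ⟨hηf z, hC z⟩)
  have elog : (fun z : Square => Real.log (P z.1 * Q z.2 * f z)) =ᵐ[κ] fun z =>
      Real.log (P z.1) + Real.log (Q z.2) + Real.log (f z) := by
    filter_upwards [hpos] with z hz
    rw [Real.log_mul (mul_ne_zero hz.1 hz.2) (f0 z).ne', Real.log_mul hz.1 hz.2]
  have etf : ∀ z, Real.log (t * f z) = Real.log t + Real.log (f z) := fun z =>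
    Real.log_mul ht0.ne' (f0 z).ne'
  have iPQ : Integrable (fun z : Square => Real.log (P z.1) + Real.log (Q z.2)) κ := iP.add iQ
  refine ⟨(iPQ.add ifl).congr elog.symm, ?_⟩
  simp only [etf] at hval
  rw [integral_add (integrable_const _) ifl, integral_const, hκr, smul_eq_mul] at hval
  rw [integral_congr_ae elog, integral_add iPQ ifl, integral_add iP iQ]
  linarith

lemma interval_unique {θ : ℝ} {x : unitInterval} {i j : Fin 2} (hi : x ∈ interval θ i)
    (hj : x ∈ interval θ j) : i = j := by
  fin_cases i <;> fin_cases j <;> simp at hi hj ⊢ <;> linarith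

/-- The lower bound is attained: the marginals are uniform on the intervals, the strips are split in
the optimal proportions, and each rectangle carries an optimal coupling. -/
theorem exists_minimizer (β : ℝ) {θ₁ θ₂ : ℝ} (h₁ : θ₁ ∈ Set.Ioo (0 : ℝ) 1)
    (h₂ : θ₂ ∈ Set.Ioo (0 : ℝ) 1) {t : Fin 2 → Fin 2 → ℝ} (ht : ∀ i j, 0 ≤ t i j)
    (ht1 : ∑ i, ∑ j, t i j = 1) :
    ∃ N : Measure Square, IsProbabilityMeasure N ∧ N ≪ volume ∧ Integrable (llr N volume) N ∧
      (∀ i j, N.real (rect θ₁ θ₂ i j) = t i j) ∧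
      pressure β + ∫ z, llr N volume z ∂N + β / 2 * crossInv N N = PhiTilde β θ₁ θ₂ t := by
  choose rx P rxm Pm P0 PL Pt Pb Pv using fun i => exists_strip_densities β
    (measurableSet_interval θ₁ i) (intervalLength_pos h₁ i) (volume_real_interval h₁ i) (ht i)
  choose ry Q rym Qm Q0 QL Qt Qb Qv using fun j => exists_strip_densities β
    (measurableSet_interval θ₂ j) (intervalLength_pos h₂ j) (volume_real_interval h₂ j)
    (fun i => ht i j)
  choose Φ Φm Φ0 ΦPQ hΦ using fun i j => exists_optimal_block β (ht i j) (Pm i j) (Qm j i)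
    (P0 i j) (Q0 j i) (Pt i j) (Qt j i)
  set κ : Fin 2 → Fin 2 → Measure Square := fun i j =>
    volume.withDensity fun z => ENNReal.ofReal (Φ i j z) with hκ
  have hκt : ∀ i j, κ i j Set.univ = ENNReal.ofReal (t i j) := fun i j => (hΦ i j _ rfl).1
  have hfin : ∀ i j, IsFiniteMeasure (κ i j) := fun i j =>
    ⟨by rw [hκt]; exact ENNReal.ofReal_lt_top⟩
  have hκr : ∀ i j, (κ i j).real Set.univ = t i j := fun i j => by
    rw [measureReal_def, hκt, ENNReal.toReal_ofReal (ht i j)]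
  have hΦpos : ∀ i j, ∀ᵐ z ∂(κ i j), 0 < Φ i j z := fun i j => ae_density_pos (Φm i j)
  have hΦmem : ∀ i j z, Φ i j z ≠ 0 → z ∈ rect θ₁ θ₂ i j := fun i j z hz =>
    mem_rect.mpr ⟨PL i j _ (ΦPQ i j z hz).1, QL j i _ (ΦPQ i j z hz).2⟩
  have hκmem : ∀ i j, ∀ᵐ z ∂(κ i j), z ∈ rect θ₁ θ₂ i j := fun i j =>
    (hΦpos i j).mono fun z hz => hΦmem i j z hz.ne'
  have hdisj : ∀ i j i' j' z, z ∈ rect θ₁ θ₂ i j → (i', j') ≠ (i, j) → Φ i' j' z = 0 := by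
    intro i j i' j' z hz hne
    by_contra h0
    have hz' := hΦmem i' j' z h0
    exact hne (Prod.ext (interval_unique hz'.1 hz.1) (interval_unique hz'.2 hz.2))
  -- the sum of the four blocks and its density
  set N : Measure Square := ∑ i, ∑ j, κ i j with hN
  set Ψ : Square → ℝ := fun z => ∑ i, ∑ j, Φ i j z with hΨ
  have hΨm : Measurable Ψ := Finset.measurable_fun_sum _ fun i _ =>
    Finset.measurable_fun_sum _ fun j _ => Φm i j
  have hΨ0 : ∀ z, 0 ≤ Ψ z := fun z => Finset.sum_nonneg fun i _ => Finset.sum_nonneg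
    fun j _ => Φ0 i j z
  have hΨeq : ∀ i j z, z ∈ rect θ₁ θ₂ i j → Ψ z = Φ i j z := by
    intro i j z hz
    refine (Finset.sum_eq_single i (fun i' _ hi => Finset.sum_eq_zero fun j' _ =>
      hdisj i j i' j' z hz fun he => hi (congrArg Prod.fst he)) (by simp)).trans ?_
    exact Finset.sum_eq_single j (fun j' _ hj =>
      hdisj i j i j' z hz fun he => hj (congrArg Prod.snd he)) (by simp)
  have hNΨ : N = volume.withDensity fun z => ENNReal.ofReal (Ψ z) := by
    have e1 : (fun z => ENNReal.ofReal (Ψ z)) =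
        ((fun z => ENNReal.ofReal (Φ 0 0 z)) + fun z => ENNReal.ofReal (Φ 0 1 z)) +
          ((fun z => ENNReal.ofReal (Φ 1 0 z)) + fun z => ENNReal.ofReal (Φ 1 1 z)) := by
      funext z
      simp only [hΨ, Fin.sum_univ_two, Pi.add_apply]
      rw [ENNReal.ofReal_add (add_nonneg (Φ0 _ _ z) (Φ0 _ _ z))
        (add_nonneg (Φ0 _ _ z) (Φ0 _ _ z)), ENNReal.ofReal_add (Φ0 _ _ z) (Φ0 _ _ z),
        ENNReal.ofReal_add (Φ0 _ _ z) (Φ0 _ _ z)]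
    rw [e1, withDensity_add_left ((Φm 0 0).ennreal_ofReal.add (Φm 0 1).ennreal_ofReal),
      withDensity_add_left (Φm 0 0).ennreal_ofReal, withDensity_add_left (Φm 1 0).ennreal_ofReal,
      hN]
    simp only [Fin.sum_univ_two, hκ]
  have hNr : ∀ s, N.real s = ∑ i, ∑ j, (κ i j).real s := by
    intro s
    simp only [hN, Fin.sum_univ_two]
    rw [measureReal_add_apply, measureReal_add_apply, measureReal_add_apply]
  have hprob : IsProbabilityMeasure N := by
    rw [isProbabilityMeasure_iff_real, hNr]
    simpa only [hκr] using ht1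
  have hac : N ≪ volume := by rw [hNΨ]; exact withDensity_absolutelyContinuous _ _
  have hκΨ : ∀ i j, (fun z => Real.log (Ψ z)) =ᵐ[κ i j] fun z => Real.log (Φ i j z) := fun i j =>
    (hκmem i j).mono fun z hz => by simp only [hΨeq i j z hz]
  have hmass : ∀ i j, N.real (rect θ₁ θ₂ i j) = t i j := by
    intro i j
    have e1 : N.restrict (rect θ₁ θ₂ i j) = (κ i j).restrict (rect θ₁ θ₂ i j) := by
      rw [hNΨ, hκ, restrict_withDensity (measurableSet_rect θ₁ θ₂ i j),
        restrict_withDensity (measurableSet_rect θ₁ θ₂ i j)]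
      refine withDensity_congr_ae ?_
      filter_upwards [ae_restrict_mem (measurableSet_rect θ₁ θ₂ i j)] with z hz
      rw [hΨeq i j z hz]
    rw [← measureReal_restrict_apply_univ, e1, Measure.restrict_eq_self_of_ae_mem (hκmem i j), hκr]
  have hllr : llr N volume =ᵐ[N] fun z => Real.log (Ψ z) := by
    have e1 : N.rnDeriv volume =ᵐ[volume] fun z => ENNReal.ofReal (Ψ z) := by
      rw [hNΨ]; exact Measure.rnDeriv_withDensity _ hΨm.ennreal_ofReal
    filter_upwards [hac.ae_le e1] with z hz
    rw [llr, hz, ENNReal.toReal_ofReal (hΨ0 z)]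
  -- the value on each block
  have hblock : ∀ i j, Integrable (fun z => Real.log (Φ i j z)) (κ i j) ∧
      ∫ z, Real.log (Φ i j z) ∂(κ i j) + β / 2 * crossInv (κ i j) (κ i j) =
      -pressurePrimitive β (t i j) - t i j * Real.log (t i j) +
      (t i j * Real.log ((t i 0 + t i 1) / intervalLength θ₁ i) +
        ∫ x, Real.log (rx i j x) ∂((κ i j).map Prod.fst)) +
      (t i j * Real.log ((t 0 j + t 1 j) / intervalLength θ₂ j) +
        ∫ y, Real.log (ry j i y) ∂((κ i j).map Prod.snd)) := by
    intro i j
    rcases (ht i j).eq_or_lt with h0 | h0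
    · have hz : κ i j = 0 := eq_zero_of_measureReal_univ ((hκr i j).trans h0.symm)
      rw [hz, ← h0]
      simp [crossInv]
    obtain ⟨ε, hε, K, hK⟩ := Pb i j h0
    obtain ⟨δ, hδ, M, hM⟩ := Qb j i h0
    obtain ⟨i0, hval⟩ := (hΦ i j (κ i j) rfl).2.2.2 ε hε K (fun x hx => (hK x hx).1) δ hδ M
      (fun y hy => (hM y hy).1)
    refine ⟨i0, ?_⟩
    have hPQ : ∀ᵐ z ∂(κ i j), P i j z.1 ≠ 0 ∧ Q j i z.2 ≠ 0 :=
      (hΦpos i j).mono fun z hz => ΦPQ i j z hz.ne'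
    have irx : Integrable (fun z : Square => Real.log (rx i j z.1)) (κ i j) :=
      integrable_log_of_bounds ((rxm i j).comp measurable_fst) hε
        (hPQ.mono fun z hz => (hK _ hz.1).2.1)
    have iry : Integrable (fun z : Square => Real.log (ry j i z.2)) (κ i j) :=
      integrable_log_of_bounds ((rym j i).comp measurable_snd) hδ
        (hPQ.mono fun z hz => (hM _ hz.2).2.1)
    rw [hval, integral_congr_ae (hPQ.mono fun z hz => (hK _ hz.1).2.2),
      integral_congr_ae (hPQ.mono fun z hz => (hM _ hz.2).2.2),
      integral_add (integrable_const _) irx, integral_add (integrable_const _) iry,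
      integral_const, integral_const, hκr, smul_eq_mul, smul_eq_mul,
      integral_map measurable_fst.aemeasurable (rxm i j).log.aestronglyMeasurable,
      integral_map measurable_snd.aemeasurable (rym j i).log.aestronglyMeasurable]
  have ii : ∀ i j, Integrable (fun z => Real.log (Ψ z)) (κ i j) := fun i j =>
    (hblock i j).1.congr (hκΨ i j).symm
  have iN : Integrable (fun z => Real.log (Ψ z)) N := by
    simp only [hN, Fin.sum_univ_two]
    exact ((ii 0 0).add_measure (ii 0 1)).add_measure ((ii 1 0).add_measure (ii 1 1))
  refine ⟨N, hprob, hac, iN.congr hllr.symm, hmass, ?_⟩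
  have hE : ∑ i, ∑ j, ∫ z, Real.log (Φ i j z) ∂(κ i j) = ∫ z, Real.log (Ψ z) ∂N := by
    simp only [hN, Fin.sum_univ_two]
    rw [integral_add_measure ((ii 0 0).add_measure (ii 0 1)) ((ii 1 0).add_measure (ii 1 1)),
      integral_add_measure (ii 0 0) (ii 0 1), integral_add_measure (ii 1 0) (ii 1 1)]
    simp only [integral_congr_ae (hκΨ _ _)]
  have key := sum_blocks β h₁ h₂ hκmem hκr (rx := rx) (ry := ry)
    (fun i => Pv i (fun j => (κ i j).map Prod.fst) fun j => (hΦ i j _ rfl).2.1)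
    (fun j => Qv j (fun i => (κ i j).map Prod.snd) fun i => (hΦ i j _ rfl).2.2.1)
    (fun i j => t i j * Real.log ((t i 0 + t i 1) / intervalLength θ₁ i))
    (fun i j => t i j * Real.log ((t 0 j + t 1 j) / intervalLength θ₂ j))
    (fun i j => ∫ z, Real.log (Φ i j z) ∂(κ i j))
  rw [hE] at key
  simp only [(hblock _ _).2, sub_self, Finset.sum_const_zero] at key
  rw [integral_congr_ae hllr]
  have e1 : ∑ i, ((∑ j, t i j * Real.log ((t i 0 + t i 1) / intervalLength θ₁ i)) -
      (t i 0 + t i 1) * Real.log ((t i 0 + t i 1) / intervalLength θ₁ i)) = 0 := by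
    simp only [Fin.sum_univ_two]; ring
  have e2 : ∑ j, ((∑ i, t i j * Real.log ((t 0 j + t 1 j) / intervalLength θ₂ j)) -
      (t 0 j + t 1 j) * Real.log ((t 0 j + t 1 j) / intervalLength θ₂ j)) = 0 := by
    simp only [Fin.sum_univ_two]; ring
  rw [e1, e2] at key
  linarith

/-! ### The rate function -/

lemma rateFunction_of_integrable (β : ℝ) {ν : ProbabilityMeasure Square}
    (hac : (ν : Measure Square) ≪ volume)
    (hint : Integrable (llr (ν : Measure Square) volume) (ν : Measure Square)) :
    rateFunction β ν = ((pressure β + ∫ z, llr (ν : Measure Square) volume z ∂(ν : Measure Square) +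
      β / 2 * crossInv (ν : Measure Square) ν : ℝ) : EReal) := by
  have hne := InformationTheory.klDiv_ne_top hac hint
  have hto := InformationTheory.toReal_klDiv_of_measure_eq (μ := (ν : Measure Square))
    (ν := (volume : Measure Square)) hac (by simp)
  rw [rateFunction, relEntropy, ← ENNReal.ofReal_toReal hne, hto, EReal.coe_ennreal_ofReal,
    max_eq_left (hto ▸ ENNReal.toReal_nonneg), energy_eq, ← EReal.coe_neg, ← EReal.coe_sub,
    ← EReal.coe_sub, ← EReal.coe_neg]
  congr 1
  ring

lemma rateFunction_of_klDiv_eq_top (β : ℝ) {ν : ProbabilityMeasure Square}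
    (hν : InformationTheory.klDiv (ν : Measure Square) volume = ⊤) : rateFunction β ν = ⊤ := by
  rw [rateFunction, relEntropy, hν]
  simp

end

end FourSquare


theorem theorem3p2 :
    (∀ b : ℝ, Tendsto (fun n : ℕ => FourSquare.finitePressure n b) atTop
      (𝓝 (FourSquare.pressure b))) ∧
    ∀ (β θ₁ θ₂ : ℝ), θ₁ ∈ Set.Ioo (0 : ℝ) 1 → θ₂ ∈ Set.Ioo (0 : ℝ) 1 →
      ∀ t ∈ FourSquare.simplex,
        IsLeast (FourSquare.rateFunction β '' FourSquare.measuresWithMass θ₁ θ₂ t)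
          ((FourSquare.PhiTilde β θ₁ θ₂ t : ℝ) : EReal) := by
  refine ⟨fun b => ?_, fun β θ₁ θ₂ h₁ h₂ t ht => ⟨?_, ?_⟩⟩
  · rw [FourSquare.pressure_eq]
    exact FourSquare.tendsto_finitePressure b
  · obtain ⟨N, hN, hac, hint, hmass, hval⟩ :=
      FourSquare.exists_minimizer β h₁ h₂ (fun i j => (ht.1 i j).1) ht.2
    refine ⟨⟨N, hN⟩, hmass, ?_⟩
    rw [← hval]
    exact FourSquare.rateFunction_of_integrable β (ν := ⟨N, hN⟩) hac hint
  · rintro _ ⟨ν, hν, rfl⟩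
    by_cases htop : InformationTheory.klDiv (ν : Measure FourSquare.Square) volume = ⊤
    · rw [FourSquare.rateFunction_of_klDiv_eq_top β htop]
      exact le_top
    · obtain ⟨hac, hint⟩ := InformationTheory.klDiv_ne_top_iff.mp htop
      rw [FourSquare.rateFunction_of_integrable β hac hint]
      exact EReal.coe_le_coe_iff.mpr
        (FourSquare.PhiTilde_le β h₁ h₂ (fun i j => (ht.1 i j).1) hac hint hν)
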